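/- Let $N\in\mathbb N$, $1<p<N$, $m\in\mathbb R$ with $p+m-3>0$, and $0<\alpha_1\le\alpha_2<p$. Let $g\in C([0,\infty))\cap C^1((0,\infty))$ satisfy $g(0)=0$, $g(s)>0$ and $\alpha_1 g(s)/s\le g'(s)\le\alpha_2 g(s)/s$ for $s>0$; let $g^{-1}$ be its inverse on $[0,\infty)$. Put $f(x)=e^{g(|x|)}$, $S_\infty=\mathbb R^N\times(0,\infty)$, and consider $$ f\,u_t-\operatorname{div}\bigl(f\,u^{m-1}|\nabla u|^{p-2}\nabla u\bigr)=0\ \text{ in } S_\infty,\qquad u(\cdot,0)=u_0. \tag{1}$$ A weak solution of the equation is a function $u\ge0$ with $u\in C([0,\infty);L^1(f\,dx))\cap L^\infty(\mathbb R^N\times(\bar t,\infty))$ for all $\bar t>0$ and $\nabla u^{\frac{p+m-2}{p-1}}\in L^p_{\rm loc}(S_\infty)$ (weak gradient), such that $$\iint_{S_\infty}\bigl\{-u\,\eta_t+u^{m-1}|\nabla u|^{p-2}\nabla u\cdot\nabla\eta\bigr\}f\,dx\,dt=0\qquad\text{for all }\eta\in C_0^\infty(S_\infty).$$ It is strong if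 moreover $u_t\in L^\infty_{\rm loc}((0,\infty);L^1_{\rm loc}(f\,dx))$. Strong supersolutions are defined in the same way, with $\ge 0$ in place of $=0$, for $\eta\ge 0$. Solutions of the Cauchy problem satisfy in addition $u(0)=u_0$ in $L^1(f\,dx)$. Define $G(r)=\int_0^r g(s)\,s^{-1}ds$, $J(r)=r^p/G(r)$, $E(\tau)=J(G^{-1}(\tau))$ and, for constants $t_0>1$, $C_*,r_0,\Gamma>0$, $\nu_0\in(0,1)$, with $\tau=\Gamma\log(t+t_0)$ and $$I(r)=\nu_0\Bigl(\frac{r^p}{G(r_0)}\Bigr)^{\frac1{p-1}}+(1-\nu_0)J(r_0)^{\frac1{p-1}},$$ $$\widetilde u(x,t)=\frac{C_*}{(t+t_0)^{\frac1{p+m-3}}}\Bigl[E(\tau)^{\frac1{p-1}}-h(|x|)\Bigr]_+^{\frac{p-1}{p+m-3}},\qquad h(r)=\begin{cases}J(r)^{\frac1{p-1}},& r\ge r_0,\\ I(r),& r<r_0.\end{cases}$$ Theorem. Let $M,L\in\mathbb R$. There are constants $t_0>1$, $C_*,r_0,\Gamma,\gamma>0$ and $\nu_0=1-\frac{r_0G'(r_0)}{pG(r_0)}\in(0,1)$,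 depending only on $N,p,m,\alpha_1,\alpha_2,g,M,L$, such that $\widetilde u$ is a strong supersolution of the equation and, for every $u_0$ with $0\le u_0\le M$ a.e. and $\operatorname{supp}u_0\subset\{|x|\le L\}$ and every strong solution $u$ of the Cauchy problem (1): (i) $u\le\widetilde u$ in $S_\infty$ (for every $t>0$, a.e. in $x$); (ii) $\operatorname{supp}u(t)\subset B_{R(t)}(0)$ with $R(t)=\gamma\,g^{-1}(\log t)$, for all $t>t_0$; (iii) for all $t>t_0$ and a.e. $x\in\mathbb R^N$, $$u(x,t)\le\gamma\Bigl[\frac{g^{-1}(\log t)^p}{t\log t}\Bigr]^{\frac1{p+m-3}}.$$ Here $\operatorname{supp}$ is the essential support. -/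

import Mathlib

open MeasureTheory Filter Topology Set

noncomputable section

namespace DNL

/-- The standing assumptions on the exponent `g` of the weight `f(x) = exp (g |x|)`. -/
structure IsPowerlike (α₁ α₂ : ℝ) (g : ℝ → ℝ) : Prop where
  continuousOn : ContinuousOn g (Ici 0)
  contDiffOn : ContDiffOn ℝ 1 g (Ioi 0)
  map_zero : g 0 = 0
  pos : ∀ s, 0 < s → 0 < g s
  lower : ∀ s, 0 < s → α₁ * (g s / s) ≤ deriv g s
  upper : ∀ s, 0 < s → deriv g s ≤ α₂ * (g s / s)

/-- The inverse of a function `h` on `[0, ∞)` (used for increasing bijections of `[0, ∞)`). -/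
def inv (h : ℝ → ℝ) : ℝ → ℝ := Function.invFunOn h (Ici 0)

/-- The weight `f(x) = exp (g |x|)`. -/
def weight {N : ℕ} (g : ℝ → ℝ) (x : EuclideanSpace ℝ (Fin N)) : ℝ := Real.exp (g ‖x‖)

/-- The measure `f(x) dx` on `ℝ^N`; the spaces `L^q_f` are the `L^q` spaces of this measure. -/
def weightMeasure (N : ℕ) (g : ℝ → ℝ) : Measure (EuclideanSpace ℝ (Fin N)) :=
  volume.withDensity fun x => ENNReal.ofReal (weight g x)

/-- The space-time half-space `S_∞`, with points written `(t, x)`, `t > 0`. -/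
def halfSpace (N : ℕ) : Set (ℝ × EuclideanSpace ℝ (Fin N)) := {z | 0 < z.1}

/-- Test functions: smooth, with compact support contained in the open set `S_∞`. -/
structure IsTest {N : ℕ} (η : ℝ × EuclideanSpace ℝ (Fin N) → ℝ) : Prop where
  smooth : ContDiff ℝ (⊤ : ℕ∞) η
  compact : HasCompactSupport η
  support : tsupport η ⊆ halfSpace N

/-- The classical time derivative of a function of `(t, x)`. -/
def timeDeriv {N : ℕ} (η : ℝ × EuclideanSpace ℝ (Fin N) → ℝ)
    (z : ℝ × EuclideanSpace ℝ (Fin N)) : ℝ :=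
  deriv (fun s => η (s, z.2)) z.1

/-- The classical gradient with respect to `x` of a function of `(t, x)`. -/
def spaceGrad {N : ℕ} (η : ℝ × EuclideanSpace ℝ (Fin N) → ℝ)
    (z : ℝ × EuclideanSpace ℝ (Fin N)) : EuclideanSpace ℝ (Fin N) :=
  gradient (fun y => η (z.1, y)) z.2

/-- `V` is the weak gradient of `w` with respect to `x`, in `S_∞`. -/
def HasWeakSpaceGrad {N : ℕ} (w : ℝ × EuclideanSpace ℝ (Fin N) → ℝ)
    (V : ℝ × EuclideanSpace ℝ (Fin N) → EuclideanSpace ℝ (Fin N)) : Prop :=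
  LocallyIntegrableOn w (halfSpace N) ∧ LocallyIntegrableOn V (halfSpace N) ∧
    ∀ η, IsTest η → ∫ z, w z • spaceGrad η z = -∫ z, η z • V z

/-- `v` is the weak time derivative of `w` in `S_∞`. -/
def HasWeakTimeDeriv {N : ℕ} (w v : ℝ × EuclideanSpace ℝ (Fin N) → ℝ) : Prop :=
  LocallyIntegrableOn w (halfSpace N) ∧ LocallyIntegrableOn v (halfSpace N) ∧
    ∀ η, IsTest η → ∫ z, w z * timeDeriv η z = -∫ z, η z * v z

/-- The essential support of a function: the complement of the largest open set on which it
vanishes almost everywhere. -/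
def essSupport {N : ℕ} (v : EuclideanSpace ℝ (Fin N) → ℝ) : Set (EuclideanSpace ℝ (Fin N)) :=
  {x | ∀ U ∈ 𝓝 x, ∃ᵐ y, y ∈ U ∧ v y ≠ 0}

/-- The exponent `(p + m - 2) / (p - 1)`. -/
def gradExponent (p m : ℝ) : ℝ := (p + m - 2) / (p - 1)

/-- The flux `u^(m-1) |∇u|^(p-2) ∇u`, in terms of the weak gradient `V` of
`u^((p+m-2)/(p-1))`. Since formally `V = κ u^(κ-1) ∇u` with `κ = (p+m-2)/(p-1)` and
`(κ-1)(p-1) = m-1`, it equals `κ^(1-p) |V|^(p-2) V`. -/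
def flux {N : ℕ} (p m : ℝ) (V : EuclideanSpace ℝ (Fin N)) : EuclideanSpace ℝ (Fin N) :=
  (gradExponent p m ^ (1 - p) * ‖V‖ ^ (p - 2)) • V

/-- The left-hand side of the integral formulation, tested with `η`. -/
def weakForm {N : ℕ} (p m : ℝ) (g : ℝ → ℝ) (u : ℝ → EuclideanSpace ℝ (Fin N) → ℝ)
    (V : ℝ × EuclideanSpace ℝ (Fin N) → EuclideanSpace ℝ (Fin N))
    (η : ℝ × EuclideanSpace ℝ (Fin N) → ℝ) : ℝ :=
  ∫ z : ℝ × EuclideanSpace ℝ (Fin N),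
    (-(u z.1 z.2 * timeDeriv η z) + inner ℝ (flux p m (V z)) (spaceGrad η z)) * weight g z.2

/-- The regularity class common to weak solutions, supersolutions and subsolutions; `u t` is a
function on `ℝ^N` for each time `t`, and `V` is the weak gradient of `u^((p+m-2)/(p-1))`. -/
structure IsInClass (N : ℕ) (p m : ℝ) (g : ℝ → ℝ) (u : ℝ → EuclideanSpace ℝ (Fin N) → ℝ)
    (V : ℝ × EuclideanSpace ℝ (Fin N) → EuclideanSpace ℝ (Fin N)) : Prop where
  nonneg : ∀ t, 0 ≤ t → ∀ᵐ x, 0 ≤ u t x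
  memL1 : ∀ t, 0 ≤ t → MemLp (u t) 1 (weightMeasure N g)
  continuousL1 : ∀ t, 0 ≤ t →
    Tendsto (fun s => eLpNorm (u s - u t) 1 (weightMeasure N g)) (𝓝[Ici 0] t) (𝓝 0)
  memLinfty : ∀ T, 0 < T →
    MemLp (fun z : ℝ × EuclideanSpace ℝ (Fin N) => u z.1 z.2) ⊤
      (volume.restrict {z | T < z.1})
  weakGrad : HasWeakSpaceGrad (fun z => u z.1 z.2 ^ gradExponent p m) V
  gradLp : ∀ K, IsCompact K → K ⊆ halfSpace N →
    MemLp V (ENNReal.ofReal p) (volume.restrict K)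

/-- `u` has a weak time derivative of class `L^∞_loc((0,∞); L^1_{f,loc}(ℝ^N))`. -/
def HasStrongTimeDeriv (N : ℕ) (g : ℝ → ℝ) (u : ℝ → EuclideanSpace ℝ (Fin N) → ℝ) : Prop :=
  ∃ v : ℝ × EuclideanSpace ℝ (Fin N) → ℝ, HasWeakTimeDeriv (fun z => u z.1 z.2) v ∧
    ∀ a b, 0 < a → ∀ K : Set (EuclideanSpace ℝ (Fin N)), IsCompact K →
      ∃ C : NNReal, ∀ᵐ t, t ∈ Icc a b →
        ∫⁻ x in K, ‖v (t, x)‖ₑ ∂(weightMeasure N g) ≤ C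

/-- Strong solutions of `f u_t = div (f u^(m-1) |∇u|^(p-2) ∇u)` in `S_∞`. -/
def IsStrongSolution (N : ℕ) (p m : ℝ) (g : ℝ → ℝ)
    (u : ℝ → EuclideanSpace ℝ (Fin N) → ℝ) : Prop :=
  (∃ V, IsInClass N p m g u V ∧ ∀ η, IsTest η → weakForm p m g u V η = 0) ∧
    HasStrongTimeDeriv N g u

/-- Strong supersolutions of the same equation. -/
def IsStrongSupersolution (N : ℕ) (p m : ℝ) (g : ℝ → ℝ)
    (u : ℝ → EuclideanSpace ℝ (Fin N) → ℝ) : Prop :=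
  (∃ V, IsInClass N p m g u V ∧
    ∀ η, IsTest η → (∀ z, 0 ≤ η z) → 0 ≤ weakForm p m g u V η) ∧
    HasStrongTimeDeriv N g u

/-- Strong solutions of the Cauchy problem with initial datum `u₀`; the datum is attained in
the sense of `C([0,∞); L^1_f)`. -/
def IsStrongCauchySolution (N : ℕ) (p m : ℝ) (g : ℝ → ℝ)
    (u₀ : EuclideanSpace ℝ (Fin N) → ℝ) (u : ℝ → EuclideanSpace ℝ (Fin N) → ℝ) : Prop :=
  IsStrongSolution N p m g u ∧ u 0 =ᵐ[volume] u₀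

/-- `G(r) = ∫_0^r g(s)/s ds`. -/
def bigG (g : ℝ → ℝ) (r : ℝ) : ℝ := ∫ s in (0 : ℝ)..r, g s / s

/-- `J(r) = r^p / G(r)`. -/
def bigJ (p : ℝ) (g : ℝ → ℝ) (r : ℝ) : ℝ := r ^ p / bigG g r

/-- `E(τ) = J(G⁻¹(τ))`. -/
def bigE (p : ℝ) (g : ℝ → ℝ) (τ : ℝ) : ℝ := bigJ p g (inv (bigG g) τ)

/-- `I(r) = ν₀ (r^p / G(r₀))^(1/(p-1)) + (1 - ν₀) J(r₀)^(1/(p-1))`. -/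
def bigI (p : ℝ) (g : ℝ → ℝ) (r₀ ν₀ r : ℝ) : ℝ :=
  ν₀ * (r ^ p / bigG g r₀) ^ (1 / (p - 1)) + (1 - ν₀) * bigJ p g r₀ ^ (1 / (p - 1))

/-- The explicit barrier, with `τ = Γ log (t + t₀)` and `r = |x|`. -/
def barrier {N : ℕ} (p m : ℝ) (g : ℝ → ℝ) (t₀ C r₀ Γ ν₀ : ℝ) (t : ℝ)
    (x : EuclideanSpace ℝ (Fin N)) : ℝ :=
  C / (t + t₀) ^ (1 / (p + m - 3)) *
    (max (bigE p g (Γ * Real.log (t + t₀)) ^ (1 / (p - 1)) -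
      (if r₀ ≤ ‖x‖ then bigJ p g ‖x‖ ^ (1 / (p - 1)) else bigI p g r₀ ν₀ ‖x‖)) 0)
      ^ ((p - 1) / (p + m - 3))

end DNL

end

/-! Write `k = p + m - 3`, `s = (p - 1) / k`, `κ = (p + m - 2) / (p - 1)`. The barrier has the form
`b(t) (a(t) - h(|x|))_+ ^ s` and bounded support at each time. Once it is known to be a
supersolution lying above the datum at time `0`, the bounds on `u` and on its support are read off
by comparison. There are two independent tasks.

Comparison (`comparison`). The difference of the two integral relations is tested with a smoothed
Heaviside function of `u₁^κ - u₂^κ` times a cutoff. The flux is a monotone function of the gradient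
of `u^κ`, so the gradient term has a sign; since powers are increasing, the same indicator turns the
strong time derivative into that of `(u₁ - u₂)_+` (`comparison_test`). A boundary term at infinity
remains. There the barrier vanishes, the gradient of the cutoff is `O(1/R)`, and the flux of `u` is
bounded in `L^1(f dx dt)` on time strips, uniformly in the radius (`flux_bound`). That bound is the
delicate point, because the measure `f dx` of balls is unbounded and Hölder's inequality on balls
loses it. Put `w = u^κ` and `σ = k / (k + 1)`. Testing the equation with a regularized `w^σ` bounds
the integral of `w^(σ-1) |∇w|^p f` by that of `u f` (`energy_bound`), and for this `σ` Young's
inequality reads `|∇w|^(p-1) ≤ w^(σ-1) |∇w|^p + u` where `w > 0`. Hence the integral of `(u₁ - u₂)_+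
f` is continuous in time, weakly nonincreasing and zero initially, so it vanishes
(`eq_zero_of_weak_antitone`).

Supersolution (`isStrongSupersolution_barrier`). With `A = a - h`, `q = h'^(p-1)` and `Λ = s^(p-1)
C^k`, the inequality in the positivity set is, up to a positive factor, `Λ (-s h' q + A (q' + g' q +
(N - 1) q / r)) + s (t + t₀) a' - A / k ≥ 0`. Polar coordinates and the fundamental theorem of
calculus along rays carry it to the weak formulation (`integral_ray_nonneg`). For `r ≥ r₀` the
weight contributes `g' q ≥ α₁ g q / r`, which dominates `q'` when `g(r₀)` is large and `A / k` when
`C` is large. The bad term `-s h' q` is absorbed by the same contribution if the front is at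
distance at least `2r` from the origin, and by the motion of the front, `s (t + t₀) a'`, otherwise,
when `Γ` is large (`barrier_inequality_outer`). For `r < r₀` the replacement `I` of `J^(1/(p-1))`
makes `q` linear in `r` (`barrier_inequality_inner`).

The growth of `g` is used through `α₁ G ≤ g ≤ α₂ G`: the function `G` satisfies the same assumptions
as `g`. This also bounds the front radius `G⁻¹(Γ log(t + t₀))` by a multiple of `g⁻¹(log t)`. -/

noncomputable section

namespace DNL

/-! ### Mollification in a finite-dimensional space. -/

section Mollification

variable {X : Type*} [NormedAddCommGroup X] [NormedSpace ℝ X] [FiniteDimensional ℝ X]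
  [MeasureSpace X] {F : Type*} [NormedAddCommGroup F] [NormedSpace ℝ F]

/-- The mollification of `h` by a normalized bump function. -/
def moll (φ : ContDiffBump (0 : X)) (h : X → F) : X → F :=
  convolution (φ.normed volume) h (ContinuousLinearMap.lsmul ℝ ℝ) volume

theorem moll_apply (φ : ContDiffBump (0 : X)) (h : X → F) (x : X) :
    moll φ h x = ∫ t, φ.normed volume t • h (x - t) := rfl

variable [BorelSpace X] [(volume : Measure X).IsAddHaarMeasure]

theorem moll_apply_swap (φ : ContDiffBump (0 : X)) (h : X → F) (x : X) :
    moll φ h x = ∫ t, φ.normed volume (x - t) • h t := by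
  rw [moll, convolution_eq_swap]
  rfl

theorem lintegral_normed (φ : ContDiffBump (0 : X)) :
    ∫⁻ t, ENNReal.ofReal (φ.normed volume t) = 1 := by
  rw [← ofReal_integral_eq_lintegral_ofReal _ (ae_of_all _ φ.nonneg_normed), φ.integral_normed,
    ENNReal.ofReal_one]
  exact φ.continuous_normed.integrable_of_hasCompactSupport φ.hasCompactSupport_normed

/-- Jensen's inequality for the probability measure with density `φ.normed` bounds `‖moll φ h x‖ ^
r` by an average of translates of `‖h‖ ^ r`; Tonelli and translation invariance then give the
contraction. -/
theorem lintegral_rpow_moll_le (φ : ContDiffBump (0 : X)) {r : ℝ} (hr : 1 ≤ r) {h : X → F}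
    (hh : AEStronglyMeasurable h volume) :
    ∫⁻ x, ‖moll φ h x‖ₑ ^ r ≤ ∫⁻ x, ‖h x‖ₑ ^ r := by
  set ν : Measure X := volume.withDensity fun t => ENNReal.ofReal (φ.normed volume t) with hν
  have hφm : Measurable fun t => ENNReal.ofReal (φ.normed volume t) :=
    φ.continuous_normed.measurable.ennreal_ofReal
  have : IsProbabilityMeasure ν := ⟨by
    rw [hν, withDensity_apply _ MeasurableSet.univ, Measure.restrict_univ, lintegral_normed]⟩
  have hνa : ν ≪ volume := withDensity_absolutelyContinuous _ _
  have hmeas : ∀ x, AEStronglyMeasurable (fun t => h (x - t)) volume := fun x =>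
    hh.comp_quasiMeasurePreserving
      (Measure.measurePreserving_sub_left (volume : Measure X) x).quasiMeasurePreserving
  have key : ∀ x, ‖moll φ h x‖ₑ ^ r ≤
      ∫⁻ t, ENNReal.ofReal (φ.normed volume t) * ‖h (x - t)‖ₑ ^ r := by
    intro x
    have h1 : ‖moll φ h x‖ₑ ≤ ∫⁻ t, ‖h (x - t)‖ₑ ∂ν := by
      rw [moll_apply]
      refine (enorm_integral_le_lintegral_enorm _).trans ?_
      rw [hν, lintegral_withDensity_eq_lintegral_mul₀' hφm.aemeasurable
        ((hmeas x).enorm.mono_ac hνa)]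
      refine lintegral_mono fun t => ?_
      simp only [enorm_smul, Pi.mul_apply]
      gcongr
      rw [Real.enorm_eq_ofReal (φ.nonneg_normed t)]
    have h2 : (∫⁻ t, ‖h (x - t)‖ₑ ∂ν) ^ r ≤ ∫⁻ t, ‖h (x - t)‖ₑ ^ r ∂ν := by
      have := eLpNorm'_le_eLpNorm'_of_exponent_le (p := 1) (q := r) one_pos hr ν
        ((hmeas x).mono_ac hνa)
      rw [eLpNorm', eLpNorm'] at this
      simp only [ENNReal.rpow_one, div_one] at this
      rw [one_div] at this
      exact (ENNReal.le_rpow_inv_iff (by linarith)).1 this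
    refine (ENNReal.rpow_le_rpow h1 (by linarith)).trans (h2.trans (le_of_eq ?_))
    rw [hν, lintegral_withDensity_eq_lintegral_mul₀' hφm.aemeasurable
      (((hmeas x).enorm.pow_const r).mono_ac hνa)]
    rfl
  have hjm : AEMeasurable (fun q : X × X =>
      ENNReal.ofReal (φ.normed volume q.2) * ‖h (q.1 - q.2)‖ₑ ^ r) (volume.prod volume) := by
    refine AEMeasurable.mul (hφm.comp measurable_snd).aemeasurable (AEMeasurable.pow_const ?_ r)
    exact (hh.comp_quasiMeasurePreserving
      (quasiMeasurePreserving_sub (volume : Measure X) volume)).enorm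
  calc ∫⁻ x, ‖moll φ h x‖ₑ ^ r
      ≤ ∫⁻ x, ∫⁻ t, ENNReal.ofReal (φ.normed volume t) * ‖h (x - t)‖ₑ ^ r := lintegral_mono key
    _ = ∫⁻ t, ∫⁻ x, ENNReal.ofReal (φ.normed volume t) * ‖h (x - t)‖ₑ ^ r :=
        lintegral_lintegral_swap hjm
    _ = ∫⁻ t, ENNReal.ofReal (φ.normed volume t) * ∫⁻ x, ‖h x‖ₑ ^ r := by
        refine lintegral_congr fun t => ?_
        rw [lintegral_const_mul' _ _ ENNReal.ofReal_ne_top,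
          lintegral_sub_right_eq_self (fun x => ‖h x‖ₑ ^ r) t]
    _ = ∫⁻ x, ‖h x‖ₑ ^ r := by
        rw [lintegral_mul_const _ hφm, lintegral_normed, one_mul]

theorem eLpNorm_moll_le (φ : ContDiffBump (0 : X)) {p : ENNReal} (hp : 1 ≤ p) (hp' : p ≠ ⊤)
    {h : X → F} (hh : AEStronglyMeasurable h volume) :
    eLpNorm (moll φ h) p volume ≤ eLpNorm h p volume := by
  have h0 : p ≠ 0 := (one_pos.trans_le hp).ne'
  rw [eLpNorm_eq_lintegral_rpow_enorm_toReal h0 hp', eLpNorm_eq_lintegral_rpow_enorm_toReal h0 hp']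
  refine ENNReal.rpow_le_rpow (lintegral_rpow_moll_le φ ?_ hh) (by positivity)
  simpa using ENNReal.toReal_mono hp' hp

theorem continuous_moll (φ : ContDiffBump (0 : X)) {h : X → F} (hh : LocallyIntegrable h) :
    Continuous (moll φ h) :=
  φ.hasCompactSupport_normed.continuous_convolution_left _ φ.continuous_normed hh

theorem contDiff_moll (φ : ContDiffBump (0 : X)) {h : X → F} (hh : LocallyIntegrable h) :
    ContDiff ℝ (⊤ : ℕ∞) (moll φ h) :=
  φ.hasCompactSupport_normed.contDiff_convolution_left _ φ.contDiff_normed hh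

theorem norm_moll_le [CompleteSpace F] (φ : ContDiffBump (0 : X)) {h : X → F} {C : ℝ}
    (hC : ∀ᵐ x, ‖h x‖ ≤ C) (x : X) : ‖moll φ h x‖ ≤ C := by
  rw [moll_apply_swap]
  have hi : Integrable fun t => φ.normed volume (x - t) * C := by
    refine Integrable.mul_const ?_ _
    exact (φ.continuous_normed.integrable_of_hasCompactSupport
      φ.hasCompactSupport_normed).comp_sub_left x
  calc ‖∫ t, φ.normed volume (x - t) • h t‖ ≤ ∫ t, φ.normed volume (x - t) * C := by
        refine norm_integral_le_of_norm_le hi ?_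
        filter_upwards [hC] with t ht
        rw [norm_smul, Real.norm_of_nonneg (φ.nonneg_normed _)]
        exact mul_le_mul_of_nonneg_left ht (φ.nonneg_normed _)
    _ = C := by
        rw [integral_mul_const, integral_sub_left_eq_self (fun t => φ.normed volume t) volume x,
          φ.integral_normed, one_mul]

theorem moll_sub (φ : ContDiffBump (0 : X)) {h k : X → F} (hh : LocallyIntegrable h)
    (hk : LocallyIntegrable k) : moll φ (h - k) = moll φ h - moll φ k := by
  have ex : ∀ {f : X → F}, LocallyIntegrable f → ∀ x,
      ConvolutionExistsAt (φ.normed volume) f x (ContinuousLinearMap.lsmul ℝ ℝ) volume :=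
    fun hf => φ.hasCompactSupport_normed.convolutionExists_left _ φ.continuous_normed hf
  funext x
  have h1 := ex hh x
  have h2 := ex hk x
  rw [ConvolutionExistsAt] at h1 h2
  simp only [Pi.sub_apply, moll_apply]
  rw [← integral_sub (by simpa using h1) (by simpa using h2)]
  simp [smul_sub]

/-- Density of compactly supported continuous `c` in `L^p`, with an `ε / 3` argument: mollification
does not increase the norm of `h - c`, and `c` itself is uniformly continuous. -/
theorem tendsto_eLpNorm_moll_sub {φ : ℕ → ContDiffBump (0 : X)}
    (hφ : Tendsto (fun n => (φ n).rOut) atTop (𝓝 0)) {p : ENNReal} (hp : 1 ≤ p) (hp' : p ≠ ⊤)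
    [CompleteSpace F] {h : X → F} (hh : MemLp h p volume) :
    Tendsto (fun n => eLpNorm (moll (φ n) h - h) p volume) atTop (𝓝 0) := by
  have hφ1 : ∀ᶠ n in atTop, (φ n).rOut ≤ 1 := hφ.eventually_le_const one_pos
  rw [ENNReal.tendsto_nhds_zero]
  intro ε hε
  obtain ⟨c, hcs, hcp, hcc, -⟩ := hh.exists_hasCompactSupport_eLpNorm_sub_le hp'
    (ε := ε / 3) (by simp [hε.ne'])
  -- the continuous case
  have hcl : LocallyIntegrable c := hcc.locallyIntegrable
  have hhl : LocallyIntegrable h := hh.locallyIntegrable hp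
  -- As soon as `rOut ≤ 1`, both `c` and its mollification live in this fixed compact set, so that
  -- uniform smallness of the difference becomes smallness in `L^p`.
  set K : Set X := Metric.cthickening 1 (tsupport c) with hK
  have hKc : IsCompact K := hcs.isCompact.cthickening
  have huc : UniformContinuous c := hcs.uniformContinuous_of_continuous hcc
  obtain ⟨δ, hδ, hδε⟩ : ∃ δ : ℝ, 0 < δ ∧ ENNReal.ofReal δ * volume K ^ (1 / p.toReal) ≤ ε / 3 := by
    have hV : volume K ^ (1 / p.toReal) ≠ ⊤ :=
      (ENNReal.rpow_lt_top_of_nonneg (by positivity) hKc.measure_lt_top.ne).ne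
    have : Tendsto (fun δ : ℝ => ENNReal.ofReal δ * volume K ^ (1 / p.toReal)) (𝓝[>] 0) (𝓝 0) := by
      have h1 : Tendsto (fun δ : ℝ => ENNReal.ofReal δ) (𝓝[>] 0) (𝓝 0) := by
        simpa using (ENNReal.tendsto_ofReal (tendsto_id (α := ℝ) (x := 𝓝 0))).mono_left
          nhdsWithin_le_nhds
      simpa using ENNReal.Tendsto.mul_const h1 (Or.inr hV)
    have h3 : 0 < ε / 3 := by simp [hε.ne']
    obtain ⟨δ, h1, h2⟩ := ((this.eventually_le_const h3).and self_mem_nhdsWithin).exists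
    exact ⟨δ, h2, h1⟩
  obtain ⟨η, hη, hηδ⟩ := Metric.uniformContinuous_iff.1 huc δ hδ
  filter_upwards [hφ1, hφ.eventually_lt_const hη] with n hn1 hn2
  have hcsupp : ∀ x, ‖moll (φ n) c x - c x‖ ≤ K.indicator (fun _ => δ) x := by
    intro x
    by_cases hx : x ∈ K
    · rw [indicator_of_mem hx, ← dist_eq_norm]
      refine (φ n).dist_normed_convolution_le hcc.aestronglyMeasurable fun y hy => ?_
      exact (hηδ (lt_trans (Metric.mem_ball.1 hy) hn2)).le
    · rw [indicator_of_notMem hx]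
      have hball : ∀ y ∈ Metric.closedBall x (φ n).rOut, c y = 0 := by
        intro y hy
        by_contra hne
        apply hx
        exact Metric.mem_cthickening_of_dist_le x y 1 _ (subset_tsupport _ hne)
          (by rw [dist_comm]; exact (Metric.mem_closedBall.1 hy).trans hn1)
      have h1 : moll (φ n) c x = 0 := by
        rw [moll_apply_swap]
        refine integral_eq_zero_of_ae (ae_of_all _ fun t => ?_)
        by_cases ht : t ∈ Metric.closedBall x (φ n).rOut
        · simp [hball t ht]
        · have : (φ n).normed volume (x - t) = 0 := by
            have := (φ n).support_normed_eq (μ := (volume : Measure X))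
            rw [← Function.notMem_support, this]
            intro h'
            apply ht
            simpa [dist_eq_norm, norm_sub_rev] using (Metric.mem_ball.1 h').le
          simp [this]
      have h2 : c x = 0 := hball x (Metric.mem_closedBall_self (φ n).rOut_pos.le)
      simp [h1, h2]
  have hc3 : eLpNorm (moll (φ n) c - c) p volume ≤ ε / 3 := by
    have h0 : p ≠ 0 := (one_pos.trans_le hp).ne'
    calc eLpNorm (moll (φ n) c - c) p volume
        ≤ eLpNorm (K.indicator fun _ => δ) p volume := eLpNorm_mono_real hcsupp
      _ = ENNReal.ofReal δ * volume K ^ (1 / p.toReal) := by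
          rw [eLpNorm_indicator_const hKc.measurableSet h0 hp', Real.enorm_eq_ofReal hδ.le]
      _ ≤ ε / 3 := hδε
  have hsplit : moll (φ n) h - h = (moll (φ n) (h - c) + (moll (φ n) c - c)) + (c - h) := by
    rw [moll_sub _ hhl hcl]
    abel
  have hm1 : AEStronglyMeasurable (moll (φ n) (h - c)) volume :=
    (continuous_moll _ (hhl.sub hcl)).aestronglyMeasurable
  have hm2 : AEStronglyMeasurable (moll (φ n) c - c) volume :=
    ((continuous_moll _ hcl).sub hcc).aestronglyMeasurable
  rw [hsplit]
  calc _ ≤ eLpNorm (moll (φ n) (h - c)) p volume + eLpNorm (moll (φ n) c - c) p volume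
        + eLpNorm (c - h) p volume :=
        (eLpNorm_add_le (hm1.add hm2) (hcc.aestronglyMeasurable.sub hh.1) hp).trans
          (by gcongr; exact eLpNorm_add_le hm1 hm2 hp)
    _ ≤ ε / 3 + ε / 3 + ε / 3 := by
        gcongr
        · exact (eLpNorm_moll_le _ hp hp' (hh.1.sub hcc.aestronglyMeasurable)).trans hcp
        · rw [eLpNorm_sub_comm]; exact hcp
    _ = ε := ENNReal.add_thirds ε

/-- If `v` is the weak derivative of `w` in the direction `e` in the open set `U`, then the
classical derivative of a mollification of `w` is the mollification of `v`. -/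
theorem fderiv_moll_apply (φ : ContDiffBump (0 : X)) {U : Set X} {w v : X → ℝ} {e : X}
    (hw : LocallyIntegrable w)
    (hwv : ∀ η : X → ℝ, ContDiff ℝ (⊤ : ℕ∞) η → HasCompactSupport η → tsupport η ⊆ U →
      ∫ y, w y * fderiv ℝ η y e = -∫ y, η y * v y)
    {z : X} (hz : Metric.closedBall z φ.rOut ⊆ U) :
    fderiv ℝ (moll φ w) z e = moll φ v z := by
  have hd := φ.hasCompactSupport_normed.hasFDerivAt_convolution_left
    (ContinuousLinearMap.lsmul ℝ ℝ) (φ.contDiff_normed (μ := (volume : Measure X)) (n := 1)) hw z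
  have hex : ConvolutionExistsAt (fderiv ℝ (φ.normed volume)) w z
      ((ContinuousLinearMap.lsmul ℝ ℝ : ℝ →L[ℝ] ℝ →L[ℝ] ℝ).precompL X) volume :=
    (φ.hasCompactSupport_normed.fderiv ℝ).convolutionExists_left _
      ((φ.contDiff_normed (n := 1)).continuous_fderiv one_ne_zero) hw z
  have h1 : fderiv ℝ (moll φ w) z e =
      ∫ t, fderiv ℝ (φ.normed volume) (z - t) e * w t := by
    rw [show fderiv ℝ (moll φ w) z = _ from hd.fderiv, convolution_eq_swap,
      ContinuousLinearMap.integral_apply]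
    · rfl
    · exact hex.integrable_swap
  -- The reflected kernel is an admissible test function, its support being contained in the ball
  -- around `z` that lies in `U`. The sign produced by the reflection cancels the one in the
  -- definition of weak derivative.
  set η : X → ℝ := fun t => φ.normed volume (z - t) with hη
  have hηd : ∀ y, fderiv ℝ η y e = - fderiv ℝ (φ.normed volume) (z - y) e := by
    intro y
    have hφd : DifferentiableAt ℝ (φ.normed volume) (z - y) :=
      (φ.contDiff_normed (μ := (volume : Measure X)) (n := 1)).differentiable one_ne_zero _
    have := hφd.hasFDerivAt.comp y ((hasFDerivAt_id y).const_sub z)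
    rw [show fderiv ℝ η y = _ from this.fderiv]
    simp
  have hηs : HasCompactSupport η :=
    φ.hasCompactSupport_normed.comp_homeomorph (Homeomorph.subLeft z)
  have hηt : tsupport η ⊆ Metric.closedBall z φ.rOut := by
    refine closure_minimal (fun t ht => ?_) Metric.isClosed_closedBall
    have : z - t ∈ Function.support (φ.normed (volume : Measure X)) := ht
    rw [φ.support_normed_eq] at this
    simpa [dist_eq_norm, norm_sub_rev] using (Metric.mem_ball.1 this).le
  have h2 := hwv η (φ.contDiff_normed.comp (contDiff_const.sub contDiff_id)) hηs (hηt.trans hz)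
  rw [h1, moll_apply_swap]
  have h3 : ∫ y, w y * fderiv ℝ η y e = -∫ t, fderiv ℝ (φ.normed volume) (z - t) e * w t := by
    rw [← integral_neg]
    congr 1
    funext y
    rw [hηd]
    ring
  rw [h3] at h2
  simpa using neg_injective h2

end Mollification

/-! ### Smooth local approximation of weakly differentiable functions. -/

section Approximation

variable {X : Type*} [NormedAddCommGroup X] [NormedSpace ℝ X] [FiniteDimensional ℝ X]
  [MeasureSpace X] [BorelSpace X] [(volume : Measure X).IsAddHaarMeasure]
  {F : Type*} [NormedAddCommGroup F] [InnerProductSpace ℝ F] [FiniteDimensional ℝ F]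

theorem inner_moll (φ : ContDiffBump (0 : X)) {V : X → F} (hV : LocallyIntegrable V) (e : F)
    (z : X) : inner ℝ (moll φ V z) e = moll φ (fun y => inner ℝ (V y) e) z := by
  have ex : ConvolutionExistsAt (φ.normed volume) V z (ContinuousLinearMap.lsmul ℝ ℝ) volume :=
    φ.hasCompactSupport_normed.convolutionExists_left _ φ.continuous_normed hV z
  rw [ConvolutionExistsAt] at ex
  rw [real_inner_comm, moll_apply, moll_apply, ← integral_inner (by simpa using ex)]
  refine integral_congr_ae (ae_of_all _ fun t => ?_)
  simp only [inner_smul_right, smul_eq_mul]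
  rw [real_inner_comm]

/-- Smooth local approximation of a locally bounded function `w` with weak derivative `V` along
the subspace `ι F`, with convergence of the derivatives in `L^p`. -/
theorem exists_smooth_approx (ι : F →L[ℝ] X) {U : Set X} (hU : IsOpen U) {w : X → ℝ} {V : X → F}
    (hw : LocallyIntegrableOn w U)
    (hwV : ∀ η : X → ℝ, ContDiff ℝ (⊤ : ℕ∞) η → HasCompactSupport η → tsupport η ⊆ U →
      ∀ e : F, ∫ y, w y * fderiv ℝ η y (ι e) = -∫ y, η y * inner ℝ (V y) e)
    {p : ENNReal} (hp : 1 ≤ p) (hp' : p ≠ ⊤)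
    (hV : ∀ K, IsCompact K → K ⊆ U → MemLp V p (volume.restrict K))
    (hb : ∀ K, IsCompact K → K ⊆ U → ∃ C, ∀ᵐ z, z ∈ K → |w z| ≤ C)
    {K : Set X} (hK : IsCompact K) (hKU : K ⊆ U) :
    ∃ (ω : ℕ → X → ℝ) (W : ℕ → X → F) (C : ℝ), (∀ n, ContDiff ℝ (⊤ : ℕ∞) (ω n)) ∧
      (∀ n, Continuous (W n)) ∧ (∀ n z, |ω n z| ≤ C) ∧
      (∀ᵐ z, z ∈ K → Tendsto (fun n => ω n z) atTop (𝓝 (w z))) ∧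
      (∀ n, ∀ z ∈ K, ∀ e, fderiv ℝ (ω n) z (ι e) = inner ℝ (W n z) e) ∧
      Tendsto (fun n => eLpNorm (W n - V) p (volume.restrict K)) atTop (𝓝 0) := by
  -- `w` and `V` are replaced by zero outside a compact neighbourhood `K1` of `K`. The mollification
  -- radii stay below `δ`, so the truncation is invisible on `K`.
  obtain ⟨δ, hδ, hδU⟩ := hK.exists_cthickening_subset_open hU hKU
  set K1 := Metric.cthickening δ K with hK1
  have hK1c : IsCompact K1 := hK.cthickening
  have hK1m : MeasurableSet K1 := hK1c.measurableSet
  have hKK1 : K ⊆ K1 := Metric.self_subset_cthickening K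
  obtain ⟨C, hC⟩ := hb K1 hK1c hδU
  set w1 := K1.indicator w
  set V1 := K1.indicator V
  have hw1 : LocallyIntegrable w1 :=
    ((integrable_indicator_iff hK1m).2 (hw.integrableOn_compact_subset hδU hK1c)).locallyIntegrable
  have hV1p : MemLp V1 p volume := (memLp_indicator_iff_restrict hK1m).2 (hV K1 hK1c hδU)
  have hV1 : LocallyIntegrable V1 := hV1p.locallyIntegrable hp
  let φ : ℕ → ContDiffBump (0 : X) := fun n =>
    ⟨δ / (n + 2) / 2, δ / (n + 2), by positivity, half_lt_self (by positivity)⟩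
  have hφ : Tendsto (fun n => (φ n).rOut) atTop (𝓝 0) := by
    have := (tendsto_const_div_atTop_nhds_zero_nat δ).comp (tendsto_add_atTop_nat 2)
    refine this.congr fun n => ?_
    simp [φ]
  -- The ratio of the two radii is kept bounded: convergence at Lebesgue points requires it.
  have hφ' : ∀ᶠ n in atTop, (φ n).rOut ≤ 2 * (φ n).rIn :=
    Eventually.of_forall fun n => by simp only [φ]; linarith
  refine ⟨fun n => moll (φ n) w1, fun n => moll (φ n) V1, max C 0, fun n => contDiff_moll _ hw1,
    fun n => continuous_moll _ hV1, fun n z => ?_, ?_, fun n z hz e => ?_, ?_⟩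
  · refine norm_moll_le (F := ℝ) (φ n) ?_ z
    filter_upwards [hC] with x hx
    by_cases hxK : x ∈ K1
    · simpa [w1, indicator_of_mem hxK] using Or.inl (hx hxK)
    · simp [w1, indicator_of_notMem hxK]
  · filter_upwards [ContDiffBump.ae_convolution_tendsto_right_of_locallyIntegrable (μ := volume)
      hφ hφ' hw1] with z hz hzK
    rw [show w z = w1 z from (indicator_of_mem (hKK1 hzK) w).symm]
    exact hz
  · rw [inner_moll _ hV1]
    refine fderiv_moll_apply (φ n) (U := Metric.thickening δ K) hw1 (fun η h1 h2 h3 => ?_) ?_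
    · have h4 : tsupport η ⊆ K1 := h3.trans (Metric.thickening_subset_cthickening δ K)
      convert hwV η h1 h2 (h4.trans hδU) e using 2
      · funext y
        by_cases hy : y ∈ K1
        · simp [w1, indicator_of_mem hy]
        · have : fderiv ℝ η y = 0 := by
            by_contra hne
            exact hy (h4 (support_fderiv_subset ℝ hne))
          simp [this]
      · refine integral_congr_ae (ae_of_all _ fun y => ?_)
        by_cases hy : y ∈ K1
        · simp [V1, indicator_of_mem hy]
        · have : η y = 0 := image_eq_zero_of_notMem_tsupport fun h => hy (h4 h)
          simp [this]
    · intro y hy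
      rw [Metric.mem_thickening_iff]
      refine ⟨z, hz, (Metric.mem_closedBall.1 hy).trans_lt ?_⟩
      simp only [φ]
      rw [div_lt_iff₀ (by positivity)]
      nlinarith [(Nat.cast_nonneg n : (0 : ℝ) ≤ n)]
  · refine tendsto_of_tendsto_of_tendsto_of_le_of_le tendsto_const_nhds
      (tendsto_eLpNorm_moll_sub hφ hp hp' hV1p) (fun _ => zero_le) fun n => ?_
    calc eLpNorm (moll (φ n) V1 - V) p (volume.restrict K)
        = eLpNorm (moll (φ n) V1 - V1) p (volume.restrict K) := by
          refine eLpNorm_congr_ae ?_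
          filter_upwards [ae_restrict_mem hK.measurableSet] with z hz
          simp [V1, indicator_of_mem (hKK1 hz)]
      _ ≤ _ := eLpNorm_mono_measure _ Measure.restrict_le_self

end Approximation

/-! ### Test functions and their time and space derivatives. -/

section SpaceTime

variable {N : ℕ}

local notation "𝔼" => EuclideanSpace ℝ (Fin N)

instance : (volume : Measure (ℝ × 𝔼)).IsAddHaarMeasure :=
  inferInstanceAs ((volume : Measure ℝ).prod (volume : Measure 𝔼)).IsAddHaarMeasure

theorem isOpen_halfSpace : IsOpen (halfSpace N) := isOpen_lt continuous_const continuous_fst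

theorem hasDerivAt_slice {η : ℝ × 𝔼 → ℝ} {z : ℝ × 𝔼} (hη : DifferentiableAt ℝ η z) :
    HasDerivAt (fun s => η (s, z.2)) (fderiv ℝ η z (1, 0)) z.1 := by
  have h1 : HasDerivAt (fun s : ℝ => (s, z.2)) ((1 : ℝ), (0 : 𝔼)) z.1 :=
    (hasDerivAt_id z.1).prodMk (hasDerivAt_const z.1 z.2)
  exact hη.hasFDerivAt.comp_hasDerivAt z.1 h1

theorem timeDeriv_eq {η : ℝ × 𝔼 → ℝ} {z : ℝ × 𝔼} (hη : DifferentiableAt ℝ η z) :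
    timeDeriv η z = fderiv ℝ η z (1, 0) := (hasDerivAt_slice hη).deriv

theorem inner_spaceGrad {η : ℝ × 𝔼 → ℝ} {z : ℝ × 𝔼} (hη : DifferentiableAt ℝ η z) (e : 𝔼) :
    inner ℝ (spaceGrad η z) e = fderiv ℝ η z (0, e) := by
  have h1 : HasFDerivAt (fun y : 𝔼 => (z.1, y)) (ContinuousLinearMap.inr ℝ ℝ 𝔼) z.2 :=
    (hasFDerivAt_const z.1 z.2).prodMk (hasFDerivAt_id z.2)
  have h2 : HasFDerivAt (fun y => η (z.1, y))
      ((fderiv ℝ η z).comp (ContinuousLinearMap.inr ℝ ℝ 𝔼)) z.2 := hη.hasFDerivAt.comp z.2 h1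
  rw [spaceGrad, gradient, h2.fderiv]
  simp

theorem spaceGrad_eq_iff {η : ℝ × 𝔼 → ℝ} {z : ℝ × 𝔼} (hη : DifferentiableAt ℝ η z) {V : 𝔼} :
    spaceGrad η z = V ↔ ∀ e, fderiv ℝ η z (0, e) = inner ℝ V e := by
  constructor
  · rintro rfl e
    exact (inner_spaceGrad hη e).symm
  · intro h
    exact ext_inner_right ℝ fun e => by rw [inner_spaceGrad hη, h]

theorem IsTest.differentiable {η : ℝ × 𝔼 → ℝ} (hη : IsTest η) : Differentiable ℝ η :=
  hη.smooth.differentiable (by simp)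

theorem IsTest.continuous_timeDeriv {η : ℝ × 𝔼 → ℝ} (hη : IsTest η) : Continuous (timeDeriv η) := by
  have : timeDeriv η = fun z => fderiv ℝ η z (1, 0) :=
    funext fun z => timeDeriv_eq (hη.differentiable z)
  rw [this]
  exact (hη.smooth.continuous_fderiv (by simp)).clm_apply continuous_const

theorem IsTest.continuous_spaceGrad {η : ℝ × 𝔼 → ℝ} (hη : IsTest η) :
    Continuous (spaceGrad η) := by
  have : spaceGrad η = fun z => (InnerProductSpace.toDual ℝ 𝔼).symm
      ((fderiv ℝ η z).comp (ContinuousLinearMap.inr ℝ ℝ 𝔼)) := by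
    funext z
    refine (spaceGrad_eq_iff (hη.differentiable z)).2 fun e => ?_
    simp
  rw [this]
  exact (InnerProductSpace.toDual ℝ 𝔼).symm.continuous.comp
    ((hη.smooth.continuous_fderiv (by simp)).clm_comp continuous_const)

theorem timeDeriv_eq_zero_of_notMem {η : ℝ × 𝔼 → ℝ} {z : ℝ × 𝔼} (hz : z ∉ tsupport η) :
    timeDeriv η z = 0 := by
  have h := notMem_tsupport_iff_eventuallyEq.1 hz
  have hd : DifferentiableAt ℝ η z := (differentiableAt_const (0 : ℝ)).congr_of_eventuallyEq h
  rw [timeDeriv_eq hd, h.fderiv_eq]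
  simp

theorem spaceGrad_eq_zero_of_notMem {η : ℝ × 𝔼 → ℝ} {z : ℝ × 𝔼} (hz : z ∉ tsupport η) :
    spaceGrad η z = 0 := by
  have h := notMem_tsupport_iff_eventuallyEq.1 hz
  have hd : DifferentiableAt ℝ η z := (differentiableAt_const (0 : ℝ)).congr_of_eventuallyEq h
  rw [spaceGrad_eq_iff hd, h.fderiv_eq]
  simp

theorem HasWeakSpaceGrad.integral_eq {w : ℝ × 𝔼 → ℝ} {V : ℝ × 𝔼 → 𝔼} (h : HasWeakSpaceGrad w V)
    {η : ℝ × 𝔼 → ℝ} (hη : IsTest η) (e : 𝔼) :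
    ∫ z, w z * fderiv ℝ η z (0, e) = -∫ z, η z * inner ℝ (V z) e := by
  have h1 : Integrable fun z => η z • V z := by
    have := (h.2.1.integrableOn_compact_subset hη.support hη.compact).continuousOn_smul
      hη.smooth.continuous.continuousOn hη.compact
    exact (integrableOn_iff_integrable_of_support_subset (fun z hz => by
      by_contra hz'
      exact hz (by simp [image_eq_zero_of_notMem_tsupport hz']))).1 this
  have h2 : Integrable fun z => w z • spaceGrad η z := by
    have := (h.1.integrableOn_compact_subset hη.support hη.compact).smul_continuousOn
      hη.continuous_spaceGrad.continuousOn hη.compact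
    exact (integrableOn_iff_integrable_of_support_subset (fun z hz => by
      by_contra hz'
      exact hz (by simp [spaceGrad_eq_zero_of_notMem hz']))).1 this
  have h3 := congrArg (fun v => inner ℝ e v) (h.2.2 η hη)
  simp only [inner_neg_right] at h3
  rw [← integral_inner h1, ← integral_inner h2] at h3
  have e1 : ∀ z, inner ℝ e (w z • spaceGrad η z) = w z * fderiv ℝ η z (0, e) := fun z => by
    rw [inner_smul_right, real_inner_comm, inner_spaceGrad (hη.differentiable z)]
  have e2 : ∀ z, inner ℝ e (η z • V z) = η z * inner ℝ (V z) e := fun z => by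
    rw [inner_smul_right, real_inner_comm]
  simpa only [e1, e2] using h3

end SpaceTime

/-! ### Limits of pairings between dual Lebesgue spaces. -/

section Limits

variable {α : Type*} [MeasurableSpace α] {μ : Measure α}
  {F : Type*} [NormedAddCommGroup F] [InnerProductSpace ℝ F]

theorem integrable_inner_of_memLp {p q : ENNReal} [p.HolderTriple q 1] {a V : α → F}
    (ha : MemLp a p μ) (hV : MemLp V q μ) : Integrable (fun x => inner ℝ (a x) (V x)) μ := by
  rw [← memLp_one_iff_integrable]
  refine MemLp.of_bilin (fun a b => inner ℝ a b) 1 ha hV (ha.1.inner hV.1) (ae_of_all _ fun x => ?_)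
  simpa using nnnorm_inner_le_nnnorm (𝕜 := ℝ) (a x) (V x)

/-- Convergence of the pairing of a dominated, a.e. convergent sequence with an `L^q`-convergent
sequence. -/
theorem tendsto_integral_inner {p q : ENNReal} [p.HolderTriple q 1] {a : ℕ → α → F}
    {b V : α → F} {A : α → ℝ} {W : ℕ → α → F} (hA : MemLp A p μ)
    (ham : ∀ n, AEStronglyMeasurable (a n) μ) (hle : ∀ n, ∀ᵐ x ∂μ, ‖a n x‖ ≤ A x)
    (hlim : ∀ᵐ x ∂μ, Tendsto (fun n => a n x) atTop (𝓝 (b x)))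
    (hV : MemLp V q μ) (hWm : ∀ n, AEStronglyMeasurable (W n) μ)
    (hW : Tendsto (fun n => eLpNorm (W n - V) q μ) atTop (𝓝 0)) :
    Tendsto (fun n => ∫ x, inner ℝ (a n x) (W n x) ∂μ) atTop (𝓝 (∫ x, inner ℝ (b x) (V x) ∂μ)) := by
  have haL : ∀ n, MemLp (a n) p μ := fun n => hA.of_le (ham n)
    ((hle n).mono fun x hx => hx.trans (le_abs_self _))
  have hAV : Integrable (fun x => A x * ‖V x‖) μ := by
    have := integrable_inner_of_memLp (F := ℝ) hA hV.norm
    simpa [mul_comm] using this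
  -- The pairing with `W n` is split into the pairing with the fixed `V`, by dominated convergence,
  -- and the pairing with `W n - V`, by Hölder's inequality.
  have h1 : Tendsto (fun n => ∫ x, inner ℝ (a n x) (V x) ∂μ) atTop
      (𝓝 (∫ x, inner ℝ (b x) (V x) ∂μ)) := by
    refine tendsto_integral_of_dominated_convergence (fun x => A x * ‖V x‖)
      (fun n => (ham n).inner hV.1) hAV (fun n => ?_) ?_
    · filter_upwards [hle n] with x hx
      exact (norm_inner_le_norm _ _).trans (by gcongr)
    · filter_upwards [hlim] with x hx
      exact hx.inner tendsto_const_nhds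
  have h2 : Tendsto (fun n => eLpNorm (fun x => inner ℝ (a n x) ((W n - V) x)) 1 μ) atTop (𝓝 0) := by
    have : Tendsto (fun n => eLpNorm A p μ * eLpNorm (W n - V) q μ) atTop (𝓝 0) := by
      simpa using ENNReal.Tendsto.const_mul hW (Or.inr hA.2.ne)
    refine tendsto_of_tendsto_of_tendsto_of_le_of_le tendsto_const_nhds this (fun _ => zero_le)
      fun n => ?_
    refine (eLpNorm_le_eLpNorm_mul_eLpNorm_of_nnnorm (p := p) (q := q) (ham n)
      ((hWm n).sub hV.1) (fun a b => inner ℝ a b) 1 (ae_of_all _ fun x => ?_)).trans ?_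
    · simpa using nnnorm_inner_le_nnnorm (𝕜 := ℝ) (a n x) ((W n - V) x)
    · rw [ENNReal.coe_one, one_mul]
      gcongr
      exact eLpNorm_mono_ae_real (hle n)
  -- Convergence of the norms makes them finite only from some index on; the identities between
  -- integrals are used only there.
  have hfin : ∀ᶠ n in atTop, MemLp (W n - V) q μ := by
    filter_upwards [hW.eventually_lt_const (ENNReal.zero_lt_top)] with n hn
    exact ⟨(hWm n).sub hV.1, hn⟩
  have h3 : Tendsto (fun n => ∫ x, inner ℝ (a n x) ((W n - V) x) ∂μ) atTop (𝓝 0) := by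
    rw [tendsto_zero_iff_norm_tendsto_zero]
    have h2' := (ENNReal.tendsto_toReal ENNReal.zero_ne_top).comp h2
    refine squeeze_zero' (Eventually.of_forall fun _ => norm_nonneg _) ?_ h2'
    filter_upwards [hfin] with n hn
    have hi := integrable_inner_of_memLp (haL n) hn
    refine (norm_integral_le_integral_norm _).trans (le_of_eq ?_)
    rw [integral_norm_eq_lintegral_enorm hi.1, Function.comp_apply, eLpNorm_one_eq_lintegral_enorm]
  have h4 := h3.add h1
  rw [zero_add] at h4
  refine h4.congr' ?_
  filter_upwards [hfin] with n hn
  rw [← integral_add (integrable_inner_of_memLp (haL n) hn) (integrable_inner_of_memLp (haL n) hV)]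
  refine integral_congr_ae (ae_of_all _ fun x => ?_)
  simp [inner_sub_right]

end Limits

/-! ### Chain rules and nonlinear test functions in the half-space. -/

section SpaceTime

variable {N : ℕ}

local notation "𝔼" => EuclideanSpace ℝ (Fin N)

/-- Local essential boundedness in `S_∞`. -/
def LocBdd (w : ℝ × 𝔼 → ℝ) : Prop :=
  ∀ K, IsCompact K → K ⊆ halfSpace N → ∃ C, ∀ᵐ z, z ∈ K → |w z| ≤ C

/-- Local `L^q` integrability in `S_∞`. -/
def LocLp {F : Type*} [NormedAddCommGroup F] (q : ENNReal) (V : ℝ × 𝔼 → F) : Prop :=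
  ∀ K, IsCompact K → K ⊆ halfSpace N → MemLp V q (volume.restrict K)

theorem hasWeakTimeDeriv_fderiv {y v : ℝ × 𝔼 → ℝ} (h : HasWeakTimeDeriv y v) {η : ℝ × 𝔼 → ℝ}
    (hη : IsTest η) (e : ℝ) :
    ∫ z, y z * fderiv ℝ η z (e, 0) = -∫ z, η z * inner ℝ (v z) e := by
  have h1 : ∀ z, y z * fderiv ℝ η z (e, 0) = e * (y z * timeDeriv η z) := fun z => by
    rw [timeDeriv_eq (hη.differentiable z), show ((e, 0) : ℝ × 𝔼) = e • ((1 : ℝ), (0 : 𝔼)) by simp,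
      map_smul, smul_eq_mul]
    ring
  have h2 : ∀ z, η z * inner ℝ (v z) e = e * (η z * v z) := fun z => by
    rw [show inner ℝ (v z) e = e * v z from by simp]
    ring
  simp only [h1, h2, integral_const_mul]
  rw [h.2.2 η hη]
  ring

/-- The chain rule for the weak time derivative, in integrated form and with a time-independent
continuous weight. -/
theorem integral_time_chain {y v : ℝ × 𝔼 → ℝ} (h : HasWeakTimeDeriv y v) (hy : LocBdd y)
    {B b : ℝ → ℝ} (hB : ∀ s, HasDerivAt B (b s) s) (hb : Continuous b) {χ : ℝ × 𝔼 → ℝ}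
    (hχ : IsTest χ) {f : 𝔼 → ℝ} (hf : Continuous f) :
    Integrable (fun z => (v z * (b (y z) * χ z) + B (y z) * timeDeriv χ z) * f z.2) ∧
      ∫ z, (v z * (b (y z) * χ z) + B (y z) * timeDeriv χ z) * f z.2 = 0 := by
  set K := tsupport χ
  have hK : IsCompact K := hχ.compact
  have hKS : K ⊆ halfSpace N := hχ.support
  have hBc : Continuous B := continuous_iff_continuousAt.2 fun s => (hB s).continuousAt
  have hvL : LocLp 1 v := fun K' h1 h2 => by
    rw [memLp_one_iff_integrable]
    exact h.2.1.integrableOn_compact_subset h2 h1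
  obtain ⟨ω, W, C, hω, hWc, hωC, hωlim, hωW, hWlim⟩ := exists_smooth_approx (F := ℝ)
    (ContinuousLinearMap.inl ℝ ℝ 𝔼) isOpen_halfSpace h.1
    (fun η h1 h2 h3 e => hasWeakTimeDeriv_fderiv h ⟨h1, h2, h3⟩ e) le_rfl ENNReal.one_ne_top
    hvL hy hK hKS
  have hfc : Continuous fun z : ℝ × 𝔼 => f z.2 := hf.comp continuous_snd
  have hχc := hχ.smooth.continuous
  have hχt := hχ.continuous_timeDeriv
  have hχ0 : ∀ z ∉ K, χ z = 0 := fun z hz => image_eq_zero_of_notMem_tsupport hz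
  have hχt0 : ∀ z ∉ K, timeDeriv χ z = 0 := fun z hz => timeDeriv_eq_zero_of_notMem hz
  -- each approximation satisfies the identity
  have hzero : ∀ n, ∫ z, (W n z * (b (ω n z) * χ z) + B (ω n z) * timeDeriv χ z) * f z.2 = 0 := by
    intro n
    set k : ℝ × 𝔼 → ℝ := fun z =>
      (W n z * (b (ω n z) * χ z) + B (ω n z) * timeDeriv χ z) * f z.2 with hk
    have hωc := (hω n).continuous
    have hkc : Continuous k := by
      have := hWc n
      fun_prop
    have hk0 : ∀ z ∉ K, k z = 0 := fun z hz => by simp [hk, hχ0 z hz, hχt0 z hz]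
    have hks : HasCompactSupport k := HasCompactSupport.intro hK hk0
    have hki : Integrable k := hkc.integrable_of_hasCompactSupport hks
    have hder : ∀ x t, HasDerivAt (fun s => B (ω n (s, x)) * χ (s, x) * f x) (k (t, x)) t := by
      intro x t
      have e1 := hasDerivAt_slice (z := (t, x)) ((hω n).differentiable (by simp) (t, x))
      have e2 := hasDerivAt_slice (hχ.differentiable (t, x))
      have e3 := (((hB _).comp t e1).mul e2).mul_const (f x)
      refine e3.congr_deriv ?_
      rw [← timeDeriv_eq (hχ.differentiable (t, x))]
      by_cases hz : (t, x) ∈ K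
      · have := hωW n _ hz 1
        rw [show inner ℝ (W n (t, x)) (1 : ℝ) = W n (t, x) by simp] at this
        rw [ContinuousLinearMap.inl_apply] at this
        simp only [hk, this]
        simp only [Function.comp_apply]
        ring
      · simp [hk, hχ0 _ hz, hχt0 _ hz]
    -- For smooth `ω n` the integrand is the time derivative of `B (ω n) χ f`, which has compact
    -- support on each line `x = const`. This is where the weight must not depend on time.
    rw [Measure.volume_eq_prod, integral_prod_symm _ (by rwa [← Measure.volume_eq_prod])]
    refine integral_eq_zero_of_ae (ae_of_all _ fun x => ?_)
    have hKx : IsCompact ((fun t : ℝ => (t, x)) ⁻¹' K) := by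
      refine (hK.image continuous_fst).of_isClosed_subset
        (hK.isClosed.preimage (by fun_prop)) fun t ht => ⟨(t, x), ht, rfl⟩
    refine integral_eq_zero_of_hasDerivAt_of_integrable (hder x) ?_ ?_
    · exact (hkc.comp (by fun_prop : Continuous fun t : ℝ => (t, x))).integrable_of_hasCompactSupport
        (HasCompactSupport.intro hKx fun t ht => hk0 _ ht)
    · refine Continuous.integrable_of_hasCompactSupport
        (continuous_iff_continuousAt.2 fun t => (hder x t).continuousAt)
        (HasCompactSupport.intro hKx fun t ht => ?_)
      simp [hχ0 _ ht]
  -- bounds on the compact set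
  obtain ⟨Mf, hMf⟩ := hK.exists_bound_of_continuousOn hfc.continuousOn
  obtain ⟨Mχ, hMχ⟩ := hK.exists_bound_of_continuousOn hχc.continuousOn
  obtain ⟨Mt, hMt⟩ := hK.exists_bound_of_continuousOn hχt.continuousOn
  obtain ⟨Mb, hMb⟩ := (isCompact_Icc (a := -C) (b := C)).exists_bound_of_continuousOn hb.continuousOn
  obtain ⟨MB, hMB⟩ := (isCompact_Icc (a := -C) (b := C)).exists_bound_of_continuousOn
    hBc.continuousOn
  have hfinK : IsFiniteMeasure ((volume : Measure (ℝ × 𝔼)).restrict K) :=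
    ⟨by rw [Measure.restrict_apply_univ]; exact hK.measure_lt_top⟩
  have hmemK := ae_restrict_mem (μ := (volume : Measure (ℝ × 𝔼))) hK.measurableSet
  have hlimK : ∀ᵐ z ∂(volume.restrict K), Tendsto (fun n => ω n z) atTop (𝓝 (y z)) :=
    (ae_restrict_iff' hK.measurableSet).2 hωlim
  have hωIcc : ∀ n z, ω n z ∈ Icc (-C) C := fun n z => abs_le.1 (hωC n z)
  have hvK : MemLp v 1 (volume.restrict K) := hvL K hK hKS
  -- The time derivative is only in `L^1`, so the dual exponent is infinity and the local bound on
  -- `y` is indispensable.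
  have t1 : Tendsto (fun n => ∫ z in K, inner ℝ (b (ω n z) * χ z * f z.2) (W n z)) atTop
      (𝓝 (∫ z in K, inner ℝ (b (y z) * χ z * f z.2) (v z))) := by
    refine tendsto_integral_inner (p := ⊤) (q := 1) (A := fun _ => Mb * Mχ * Mf)
      (memLp_const _) (fun n => ?_) (fun n => ?_) ?_ hvK (fun n => (hWc n).aestronglyMeasurable)
      hWlim
    · have hωc := (hω n).continuous
      exact (by fun_prop : Continuous fun z : ℝ × 𝔼 => b (ω n z) * χ z * f z.2).aestronglyMeasurable
    · filter_upwards [hmemK] with z hz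
      rw [norm_mul, norm_mul]
      have h1 := hMb _ (hωIcc n z)
      have h2 := hMχ z hz
      have h3 := hMf z hz
      have := (norm_nonneg _).trans h1
      have := (norm_nonneg _).trans h2
      gcongr
    · filter_upwards [hlimK] with z hz
      exact ((((hb.tendsto _).comp hz)).mul_const _).mul_const _
  have t2 : Tendsto (fun n => ∫ z in K, B (ω n z) * timeDeriv χ z * f z.2) atTop
      (𝓝 (∫ z in K, B (y z) * timeDeriv χ z * f z.2)) := by
    refine tendsto_integral_of_dominated_convergence (fun _ => MB * Mt * Mf) (fun n => ?_)
      (integrable_const _) (fun n => ?_) ?_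
    · have hωc := (hω n).continuous
      exact (by fun_prop : Continuous fun z : ℝ × 𝔼 =>
        B (ω n z) * timeDeriv χ z * f z.2).aestronglyMeasurable
    · filter_upwards [hmemK] with z hz
      rw [norm_mul, norm_mul]
      have h1 := hMB _ (hωIcc n z)
      have h2 := hMt z hz
      have h3 := hMf z hz
      have := (norm_nonneg _).trans h1
      have := (norm_nonneg _).trans h2
      gcongr
    · filter_upwards [hlimK] with z hz
      exact ((((hBc.tendsto _).comp hz)).mul_const _).mul_const _
  have hym : AEStronglyMeasurable y (volume.restrict K) :=
    (h.1.integrableOn_compact_subset hKS hK).1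
  have hyIcc : ∀ᵐ z ∂(volume.restrict K), y z ∈ Icc (-C) C := by
    filter_upwards [hlimK] with z hz
    exact isClosed_Icc.mem_of_tendsto hz (Eventually.of_forall fun n => hωIcc n z)
  have t3 := t1.add t2
  -- Formulated for general `u` and `V` because it is applied twice: to `y, v` and to each
  -- approximation `ω n, W n`.
  have hsum : ∀ (u : ℝ × 𝔼 → ℝ) (V : ℝ × 𝔼 → ℝ), AEStronglyMeasurable u (volume.restrict K) →
      (∀ᵐ z ∂(volume.restrict K), u z ∈ Icc (-C) C) → MemLp V 1 (volume.restrict K) →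
      (∫ z in K, inner ℝ (b (u z) * χ z * f z.2) (V z)) +
        ∫ z in K, B (u z) * timeDeriv χ z * f z.2 =
      ∫ z, (V z * (b (u z) * χ z) + B (u z) * timeDeriv χ z) * f z.2 ∧
      Integrable (fun z => (V z * (b (u z) * χ z) + B (u z) * timeDeriv χ z) * f z.2) := by
    intro u V hu huC hV
    have hVi := memLp_one_iff_integrable.1 hV
    have i1 : Integrable (fun z => inner ℝ (b (u z) * χ z * f z.2) (V z)) (volume.restrict K) := by
      have : MemLp (fun z => b (u z) * χ z * f z.2) ⊤ (volume.restrict K) := by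
        refine MemLp.of_bound (((hb.comp_aestronglyMeasurable hu).mul hχc.aestronglyMeasurable).mul
          hfc.aestronglyMeasurable) (Mb * Mχ * Mf) ?_
        filter_upwards [hmemK, huC] with z hz hzu
        rw [norm_mul, norm_mul]
        have h1 := hMb _ hzu
        have h2 := hMχ z hz
        have h3 := hMf z hz
        have := (norm_nonneg _).trans h1
        have := (norm_nonneg _).trans h2
        gcongr
      exact integrable_inner_of_memLp (p := ⊤) (q := 1) this hV
    have i2 : Integrable (fun z => B (u z) * timeDeriv χ z * f z.2) (volume.restrict K) := by
      refine Integrable.of_bound (((hBc.comp_aestronglyMeasurable hu).mul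
        hχt.aestronglyMeasurable).mul hfc.aestronglyMeasurable) (MB * Mt * Mf) ?_
      filter_upwards [hmemK, huC] with z hz hzu
      rw [norm_mul, norm_mul]
      have h1 := hMB _ hzu
      have h2 := hMt z hz
      have h3 := hMf z hz
      have := (norm_nonneg _).trans h1
      have := (norm_nonneg _).trans h2
      gcongr
    rw [← integral_add i1 i2]
    have hpt : ∀ z, inner ℝ (b (u z) * χ z * f z.2) (V z) + B (u z) * timeDeriv χ z * f z.2 =
        (V z * (b (u z) * χ z) + B (u z) * timeDeriv χ z) * f z.2 := fun z => by
      simp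
      ring
    have h0 : ∀ z ∉ K, (V z * (b (u z) * χ z) + B (u z) * timeDeriv χ z) * f z.2 = 0 :=
      fun z hz => by simp [hχ0 z hz, hχt0 z hz]
    refine ⟨Eq.trans ?_ (setIntegral_eq_integral_of_forall_compl_eq_zero (s := K) h0), ?_⟩
    · exact integral_congr_ae (ae_of_all _ hpt)
    · refine (integrableOn_iff_integrable_of_support_subset fun z hz => ?_).1
        ((i1.add i2).congr (ae_of_all _ hpt))
      by_contra hzK
      exact hz (h0 z hzK)
  refine ⟨(hsum y v hym hyIcc hvK).2, ?_⟩
  rw [(hsum y v hym hyIcc hvK).1] at t3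
  refine tendsto_nhds_unique t3 (tendsto_const_nhds.congr fun n => ?_)
  rw [(hsum (ω n) (W n) (hω n).continuous.aestronglyMeasurable (ae_of_all _ (hωIcc n)) ?_).1,
    hzero n]
  exact MemLp.of_bound (hWc n).aestronglyMeasurable _
    ((ae_restrict_iff' hK.measurableSet).2 (ae_of_all _
      (hK.exists_bound_of_continuousOn (hWc n).continuousOn).choose_spec))

/-- Nonlinear functions of a weakly differentiable function, times a test function, can be
approximated by test functions in the integral formulation. -/
theorem exists_test_approx {w : ℝ × 𝔼 → ℝ} {V : ℝ × 𝔼 → 𝔼} (hwV : HasWeakSpaceGrad w V)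
    (hw : LocBdd w) {p : ℝ} (hp : 1 < p) (hV : LocLp (ENNReal.ofReal p) V)
    {b : ℝ → ℝ} (hb : ContDiff ℝ (⊤ : ℕ∞) b) {χ : ℝ × 𝔼 → ℝ} (hχ : IsTest χ) :
    ∃ η : ℕ → ℝ × 𝔼 → ℝ, (∀ n, IsTest (η n)) ∧
      ((∀ s, 0 ≤ b s) → (∀ z, 0 ≤ χ z) → ∀ n z, 0 ≤ η n z) ∧
      ∀ (v : ℝ × 𝔼 → ℝ) (A : ℝ × 𝔼 → 𝔼), LocLp 1 v → LocLp (ENNReal.ofReal (p / (p - 1))) A →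
        ∀ f : 𝔼 → ℝ, Continuous f →
        Integrable (fun z => (v z * (b (w z) * χ z) + inner ℝ (A z)
            ((deriv b (w z) * χ z) • V z + b (w z) • spaceGrad χ z)) * f z.2) ∧
        Tendsto (fun n => ∫ z, (v z * η n z + inner ℝ (A z) (spaceGrad (η n) z)) * f z.2) atTop
          (𝓝 (∫ z, (v z * (b (w z) * χ z) + inner ℝ (A z)
            ((deriv b (w z) * χ z) • V z + b (w z) • spaceGrad χ z)) * f z.2)) := by
  set K := tsupport χ
  have hK : IsCompact K := hχ.compact
  have hKS : K ⊆ halfSpace N := hχ.support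
  have hp1 : 1 ≤ ENNReal.ofReal p := by simpa using hp.le
  obtain ⟨ω, W, C, hω, hWc, hωC, hωlim, hωW, hWlim⟩ := exists_smooth_approx
    (ContinuousLinearMap.inr ℝ ℝ 𝔼) isOpen_halfSpace hwV.1
    (fun η h1 h2 h3 e => hwV.integral_eq ⟨h1, h2, h3⟩ e) hp1 ENNReal.ofReal_ne_top
    hV hw hK hKS
  have hχc := hχ.smooth.continuous
  have hχs := hχ.continuous_spaceGrad
  have hbc := hb.continuous
  have hdb : Continuous (deriv b) := hb.continuous_deriv (by simp)
  have hχ0 : ∀ z ∉ K, χ z = 0 := fun z hz => image_eq_zero_of_notMem_tsupport hz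
  have hχs0 : ∀ z ∉ K, spaceGrad χ z = 0 := fun z hz => spaceGrad_eq_zero_of_notMem hz
  -- The approximations depend on `w`, `V`, `b` and `χ` only, so a single sequence serves all
  -- pairings `v`, `A`.
  set η : ℕ → ℝ × 𝔼 → ℝ := fun n z => b (ω n z) * χ z with hη
  have hηsupp : ∀ n, tsupport (η n) ⊆ K := fun n => tsupport_mul_subset_right
  have hηt : ∀ n, IsTest (η n) := fun n => ⟨(hb.comp (hω n)).mul hχ.smooth,
    hK.of_isClosed_subset (isClosed_tsupport _) (hηsupp n), (hηsupp n).trans hKS⟩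
  have hgrad : ∀ n z, spaceGrad (η n) z =
      (deriv b (ω n z) * χ z) • W n z + b (ω n z) • spaceGrad χ z := by
    intro n z
    by_cases hz : z ∈ K
    · rw [spaceGrad_eq_iff ((hηt n).differentiable z)]
      intro e
      have e1 : HasFDerivAt (ω n) (fderiv ℝ (ω n) z) z :=
        ((hω n).differentiable (by simp) z).hasFDerivAt
      have e2 : HasDerivAt b (deriv b (ω n z)) (ω n z) :=
        (hb.differentiable (by simp) _).hasDerivAt
      have e3 := (e2.comp_hasFDerivAt z e1).mul (hχ.differentiable z).hasFDerivAt
      rw [show fderiv ℝ (η n) z = _ from e3.fderiv]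
      have e4 := hωW n z hz e
      rw [ContinuousLinearMap.inr_apply] at e4
      simp only [add_apply, smul_apply, e4, inner_add_left,
        inner_smul_left, inner_spaceGrad (hχ.differentiable z), smul_eq_mul, Function.comp_apply]
      simp
      ring
    · rw [spaceGrad_eq_zero_of_notMem fun h => hz (hηsupp n h), hχ0 z hz, hχs0 z hz]
      simp
  refine ⟨η, hηt, fun h1 h2 n z => mul_nonneg (h1 _) (h2 _), fun v A hv hA f hf => ?_⟩
  have hpq : p.HolderConjugate (p / (p - 1)) := Real.HolderConjugate.conjExponent hp
  have : (ENNReal.ofReal (p / (p - 1))).HolderTriple (ENNReal.ofReal p) 1 :=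
    hpq.symm.ennrealOfReal
  have hfc : Continuous fun z : ℝ × 𝔼 => f z.2 := hf.comp continuous_snd
  obtain ⟨Mf, hMf⟩ := hK.exists_bound_of_continuousOn hfc.continuousOn
  obtain ⟨Mχ, hMχ⟩ := hK.exists_bound_of_continuousOn hχc.continuousOn
  obtain ⟨Ms, hMs⟩ := hK.exists_bound_of_continuousOn hχs.continuousOn
  obtain ⟨Mb, hMb⟩ := (isCompact_Icc (a := -C) (b := C)).exists_bound_of_continuousOn
    hbc.continuousOn
  obtain ⟨Md, hMd⟩ := (isCompact_Icc (a := -C) (b := C)).exists_bound_of_continuousOn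
    hdb.continuousOn
  have hfinK : IsFiniteMeasure ((volume : Measure (ℝ × 𝔼)).restrict K) :=
    ⟨by rw [Measure.restrict_apply_univ]; exact hK.measure_lt_top⟩
  have hmemK := ae_restrict_mem (μ := (volume : Measure (ℝ × 𝔼))) hK.measurableSet
  have hlimK : ∀ᵐ z ∂(volume.restrict K), Tendsto (fun n => ω n z) atTop (𝓝 (w z)) :=
    (ae_restrict_iff' hK.measurableSet).2 hωlim
  have hωIcc : ∀ n z, ω n z ∈ Icc (-C) C := fun n z => abs_le.1 (hωC n z)
  have hwIcc : ∀ᵐ z ∂(volume.restrict K), w z ∈ Icc (-C) C := by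
    filter_upwards [hlimK] with z hz
    exact isClosed_Icc.mem_of_tendsto hz (Eventually.of_forall fun n => hωIcc n z)
  have hwm : AEStronglyMeasurable w (volume.restrict K) :=
    (hwV.1.integrableOn_compact_subset hKS hK).1
  have hVK := hV K hK hKS
  have hAK := hA K hK hKS
  have hvK := memLp_one_iff_integrable.1 (hv K hK hKS)
  have hAi : Integrable (fun z => ‖A z‖) (volume.restrict K) :=
    (hAK.integrable (by simpa using hpq.symm.lt.le)).norm
  have hm1 : ∀ u : ℝ × 𝔼 → ℝ, AEStronglyMeasurable u (volume.restrict K) →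
      AEStronglyMeasurable (fun z => (deriv b (u z) * χ z * f z.2) • A z) (volume.restrict K) :=
    fun u hu => (((hdb.comp_aestronglyMeasurable hu).mul hχc.aestronglyMeasurable).mul
      hfc.aestronglyMeasurable).smul hAK.1
  have hb1 : ∀ (u : ℝ × 𝔼 → ℝ), (∀ᵐ z ∂(volume.restrict K), u z ∈ Icc (-C) C) →
      ∀ᵐ z ∂(volume.restrict K), ‖(deriv b (u z) * χ z * f z.2) • A z‖ ≤
        Md * Mχ * Mf * ‖A z‖ := by
    intro u hu
    filter_upwards [hmemK, hu] with z hz hzu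
    rw [norm_smul, norm_mul, norm_mul]
    have h1 := hMd _ hzu
    have h2 := hMχ z hz
    have h3 := hMf z hz
    have := (norm_nonneg _).trans h1
    have := (norm_nonneg _).trans h2
    gcongr
  have hm2 : ∀ u : ℝ × 𝔼 → ℝ, AEStronglyMeasurable u (volume.restrict K) →
      AEStronglyMeasurable (fun z => v z * (b (u z) * χ z * f z.2) +
        b (u z) * f z.2 * inner ℝ (A z) (spaceGrad χ z)) (volume.restrict K) :=
    fun u hu => (hvK.1.mul (((hbc.comp_aestronglyMeasurable hu).mul
      hχc.aestronglyMeasurable).mul hfc.aestronglyMeasurable)).add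
      (((hbc.comp_aestronglyMeasurable hu).mul hfc.aestronglyMeasurable).mul
        (hAK.1.inner hχs.aestronglyMeasurable))
  have hb2 : ∀ (u : ℝ × 𝔼 → ℝ), (∀ᵐ z ∂(volume.restrict K), u z ∈ Icc (-C) C) →
      ∀ᵐ z ∂(volume.restrict K), ‖v z * (b (u z) * χ z * f z.2) +
        b (u z) * f z.2 * inner ℝ (A z) (spaceGrad χ z)‖ ≤
        ‖v z‖ * (Mb * Mχ * Mf) + Mb * Mf * (‖A z‖ * Ms) := by
    intro u hu
    filter_upwards [hmemK, hu] with z hz hzu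
    have h1 := hMb _ hzu
    have h2 := hMχ z hz
    have h3 := hMf z hz
    have h4 := hMs z hz
    have := (norm_nonneg _).trans h1
    have := (norm_nonneg _).trans h2
    have := (norm_nonneg _).trans h3
    refine (norm_add_le _ _).trans ?_
    simp only [norm_mul]
    have h5 : ‖inner ℝ (A z) (spaceGrad χ z)‖ ≤ ‖A z‖ * Ms :=
      (norm_inner_le_norm _ _).trans (by gcongr)
    gcongr
  have hbi : Integrable (fun z => ‖v z‖ * (Mb * Mχ * Mf) + Mb * Mf * (‖A z‖ * Ms))
      (volume.restrict K) := (hvK.norm.mul_const _).add ((hAi.mul_const _).const_mul _)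
  have hAdom : MemLp (fun z => Md * Mχ * Mf * ‖A z‖) (ENNReal.ofReal (p / (p - 1)))
      (volume.restrict K) := hAK.norm.const_mul _
  -- The gradients `W n` converge in `L^p`, while the coefficient is dominated by a multiple of
  -- `‖A‖` in the dual space. The terms without `W n` are treated separately by dominated
  -- convergence.
  have t1 : Tendsto (fun n => ∫ z in K, inner ℝ ((deriv b (ω n z) * χ z * f z.2) • A z) (W n z))
      atTop (𝓝 (∫ z in K, inner ℝ ((deriv b (w z) * χ z * f z.2) • A z) (V z))) := by
    refine tendsto_integral_inner (p := ENNReal.ofReal (p / (p - 1))) (q := ENNReal.ofReal p)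
      hAdom (fun n => hm1 _ (hω n).continuous.aestronglyMeasurable)
      (fun n => hb1 _ (ae_of_all _ (hωIcc n))) ?_ hVK (fun n => (hWc n).aestronglyMeasurable)
      hWlim
    filter_upwards [hlimK] with z hz
    exact (((((hdb.tendsto _).comp hz)).mul_const _).mul_const _).smul_const _
  have t2 : Tendsto (fun n => ∫ z in K, (v z * (b (ω n z) * χ z * f z.2) +
        b (ω n z) * f z.2 * inner ℝ (A z) (spaceGrad χ z))) atTop
      (𝓝 (∫ z in K, (v z * (b (w z) * χ z * f z.2) +
        b (w z) * f z.2 * inner ℝ (A z) (spaceGrad χ z)))) := by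
    refine tendsto_integral_of_dominated_convergence _
      (fun n => hm2 _ (hω n).continuous.aestronglyMeasurable) hbi
      (fun n => hb2 _ (ae_of_all _ (hωIcc n))) ?_
    filter_upwards [hlimK] with z hz
    have hz' := (hbc.tendsto _).comp hz
    exact (tendsto_const_nhds.mul ((hz'.mul_const _).mul_const _)).add
      ((hz'.mul_const _).mul_const _)
  have hsum : ∀ (u : ℝ × 𝔼 → ℝ) (Z : ℝ × 𝔼 → 𝔼), AEStronglyMeasurable u (volume.restrict K) →
      (∀ᵐ z ∂(volume.restrict K), u z ∈ Icc (-C) C) →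
      MemLp Z (ENNReal.ofReal p) (volume.restrict K) →
      (∫ z in K, inner ℝ ((deriv b (u z) * χ z * f z.2) • A z) (Z z)) +
        ∫ z in K, (v z * (b (u z) * χ z * f z.2) +
          b (u z) * f z.2 * inner ℝ (A z) (spaceGrad χ z)) =
      ∫ z, (v z * (b (u z) * χ z) + inner ℝ (A z)
        ((deriv b (u z) * χ z) • Z z + b (u z) • spaceGrad χ z)) * f z.2 ∧
      Integrable (fun z => (v z * (b (u z) * χ z) + inner ℝ (A z)
        ((deriv b (u z) * χ z) • Z z + b (u z) • spaceGrad χ z)) * f z.2) := by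
    intro u Z hu huC hZ
    have i1 := integrable_inner_of_memLp (p := ENNReal.ofReal (p / (p - 1)))
      (q := ENNReal.ofReal p) (hAdom.of_le (hm1 u hu)
        ((hb1 u huC).mono fun z hz => hz.trans (le_abs_self _))) hZ
    have i2 := hbi.mono' (hm2 u hu) (hb2 u huC)
    rw [← integral_add i1 i2]
    have hpt : ∀ z, inner ℝ ((deriv b (u z) * χ z * f z.2) • A z) (Z z) +
        (v z * (b (u z) * χ z * f z.2) + b (u z) * f z.2 * inner ℝ (A z) (spaceGrad χ z)) =
        (v z * (b (u z) * χ z) + inner ℝ (A z)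
          ((deriv b (u z) * χ z) • Z z + b (u z) • spaceGrad χ z)) * f z.2 := fun z => by
      simp only [inner_add_right, inner_smul_right, inner_smul_left]
      simp
      ring
    have h0 : ∀ z ∉ K, (v z * (b (u z) * χ z) + inner ℝ (A z)
        ((deriv b (u z) * χ z) • Z z + b (u z) • spaceGrad χ z)) * f z.2 = 0 :=
      fun z hz => by simp [hχ0 z hz, hχs0 z hz]
    refine ⟨Eq.trans ?_ (setIntegral_eq_integral_of_forall_compl_eq_zero (s := K) h0), ?_⟩
    · exact integral_congr_ae (ae_of_all _ hpt)
    · refine (integrableOn_iff_integrable_of_support_subset fun z hz => ?_).1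
        ((i1.add i2).congr (ae_of_all _ hpt))
      by_contra hzK
      exact hz (h0 z hzK)
  have t3 := t1.add t2
  refine ⟨(hsum w V hwm hwIcc hVK).2, ?_⟩
  rw [(hsum w V hwm hwIcc hVK).1] at t3
  refine t3.congr fun n => ?_
  rw [(hsum (ω n) (W n) (hω n).continuous.aestronglyMeasurable (ae_of_all _ (hωIcc n)) ?_).1]
  · simp only [hgrad]
    rfl
  · exact MemLp.of_bound (hWc n).aestronglyMeasurable _
      ((ae_restrict_iff' hK.measurableSet).2 (ae_of_all _
        (hK.exists_bound_of_continuousOn (hWc n).continuousOn).choose_spec))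

end SpaceTime

/-! ### Size and monotonicity of the flux. -/

section Flux

variable {N : ℕ} {p m : ℝ}

local notation "𝔼" => EuclideanSpace ℝ (Fin N)

theorem gradExponent_pos (hp : 1 < p) (hm : 0 < p + m - 3) : 0 < gradExponent p m :=
  div_pos (by linarith) (by linarith)

theorem norm_flux (hp : 1 < p) (hm : 0 < p + m - 3) (V : 𝔼) :
    ‖flux p m V‖ = gradExponent p m ^ (1 - p) * ‖V‖ ^ (p - 1) := by
  have hκ := gradExponent_pos hp hm
  rw [flux, norm_smul, Real.norm_of_nonneg (by positivity), mul_assoc]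
  congr 1
  rcases eq_or_ne V 0 with rfl | hV
  · simp [Real.zero_rpow (by linarith : p - 1 ≠ 0)]
  · have : 0 < ‖V‖ := norm_pos_iff.2 hV
    rw [show p - 1 = (p - 2) + 1 by ring, Real.rpow_add_one this.ne']

theorem rpow_sub_one_mul_self {x : ℝ} (hx : 0 ≤ x) (hp : 1 < p) : x ^ (p - 1) * x = x ^ p := by
  rcases hx.eq_or_lt with rfl | h
  · rw [Real.zero_rpow (by linarith : p ≠ 0)]
    simp
  · rw [← Real.rpow_add_one h.ne']
    ring_nf

theorem inner_flux_self (hp : 1 < p) (V : 𝔼) :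
    inner ℝ (flux p m V) V = gradExponent p m ^ (1 - p) * ‖V‖ ^ p := by
  rw [flux, inner_smul_left, real_inner_self_eq_norm_sq]
  simp only [conj_trivial]
  rw [mul_assoc]
  congr 1
  rcases eq_or_ne V 0 with rfl | hV
  · simp [Real.zero_rpow (by linarith : p ≠ 0)]
  · have : 0 < ‖V‖ := norm_pos_iff.2 hV
    rw [← Real.rpow_natCast, ← Real.rpow_add this]
    congr 1
    push_cast
    ring

/-- By the Cauchy–Schwarz inequality the claim reduces to the scalar one `(a^(p-1) - b^(p-1)) (a -
b) ≥ 0` for the norms `a` and `b`. -/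
theorem inner_flux_sub_nonneg (hp : 1 < p) (hm : 0 < p + m - 3) (V W : 𝔼) :
    0 ≤ inner ℝ (flux p m V - flux p m W) (V - W) := by
  have hκ := gradExponent_pos hp hm
  set c := gradExponent p m ^ (1 - p) with hc
  have hc0 : 0 < c := by positivity
  have h1 := (real_inner_le_norm (flux p m V) W)
  have h2 := (real_inner_le_norm (flux p m W) V)
  rw [norm_flux hp hm] at h1 h2
  rw [inner_sub_left, inner_sub_right, inner_sub_right, inner_flux_self hp, inner_flux_self hp,
    ← rpow_sub_one_mul_self (norm_nonneg V) hp, ← rpow_sub_one_mul_self (norm_nonneg W) hp]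
  have h3 : 0 ≤ (‖V‖ ^ (p - 1) - ‖W‖ ^ (p - 1)) * (‖V‖ - ‖W‖) := by
    rcases le_total ‖V‖ ‖W‖ with h | h
    · exact mul_nonneg_of_nonpos_of_nonpos
        (sub_nonpos.2 (Real.rpow_le_rpow (norm_nonneg _) h (by linarith))) (sub_nonpos.2 h)
    · exact mul_nonneg
        (sub_nonneg.2 (Real.rpow_le_rpow (norm_nonneg _) h (by linarith))) (sub_nonneg.2 h)
  nlinarith [mul_nonneg hc0.le h3]

theorem flux_zero (hp : 1 < p) (hm : 0 < p + m - 3) : flux p m (0 : 𝔼) = 0 := by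
  rw [← norm_eq_zero, norm_flux hp hm, norm_zero, Real.zero_rpow (by linarith : p - 1 ≠ 0),
    mul_zero]

theorem measurable_flux : Measurable (flux p m : 𝔼 → 𝔼) := by
  unfold flux
  fun_prop

theorem LocLp.flux (hp : 1 < p) (hm : 0 < p + m - 3) {V : ℝ × 𝔼 → 𝔼}
    (hV : LocLp (ENNReal.ofReal p) V) :
    LocLp (ENNReal.ofReal (p / (p - 1))) fun z => flux p m (V z) := by
  intro K hK hKS
  have h1 := ((hV K hK hKS).norm_rpow_div (ENNReal.ofReal (p - 1))).const_mul
    (gradExponent p m ^ (1 - p))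
  rw [← ENNReal.ofReal_div_of_pos (by linarith), ENNReal.toReal_ofReal (by linarith)] at h1
  refine h1.of_le (measurable_flux.comp_aemeasurable
    (hV K hK hKS).1.aemeasurable).aestronglyMeasurable (ae_of_all _ fun z => ?_)
  rw [norm_flux hp hm]
  exact le_abs_self _

end Flux

/-! ### Consequences of the regularity class: bounds, sign, integrability. -/

section Class

variable {N : ℕ} {p m : ℝ} {g : ℝ → ℝ}

local notation "𝔼" => EuclideanSpace ℝ (Fin N)

theorem exists_time_lt_of_isCompact {K : Set (ℝ × 𝔼)} (hK : IsCompact K) (hKS : K ⊆ halfSpace N) :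
    ∃ T, 0 < T ∧ ∀ z ∈ K, T < z.1 := by
  rcases K.eq_empty_or_nonempty with rfl | hne
  · exact ⟨1, one_pos, by simp⟩
  · obtain ⟨z, hz, hmin⟩ := hK.exists_isMinOn hne continuous_fst.continuousOn
    have hz0 : 0 < z.1 := hKS hz
    exact ⟨z.1 / 2, by linarith, fun y hy => by
      have : z.1 ≤ y.1 := hmin hy
      linarith⟩

/-- The sign is known at every time but for almost every `x` only. Fubini is applied to a measurable
representative, since the set where `u ≥ 0` need not be measurable. -/
theorem ae_nonneg_of_slices {u : ℝ × 𝔼 → ℝ} {T : ℝ}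
    (hu : AEStronglyMeasurable u (volume.restrict {z : ℝ × 𝔼 | T < z.1}))
    (h : ∀ t, T < t → ∀ᵐ x : 𝔼, 0 ≤ u (t, x)) : ∀ᵐ z, T < z.1 → 0 ≤ u z := by
  obtain ⟨w, hw, huw⟩ := hu
  have hS : MeasurableSet {z : ℝ × 𝔼 | T < z.1} := measurableSet_lt measurable_const measurable_fst
  rw [EventuallyEq, ae_restrict_iff' hS] at huw
  have h1 : ∀ᵐ t : ℝ, ∀ᵐ x : 𝔼, T < t → u (t, x) = w (t, x) :=
    by
    refine Measure.ae_ae_of_ae_prod (p := fun z : ℝ × 𝔼 => T < z.1 → u z = w z) ?_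
    rwa [← Measure.volume_eq_prod]
  have h2 : ∀ᵐ z : ℝ × 𝔼, T < z.1 → 0 ≤ w z := by
    have hm : MeasurableSet {z : ℝ × 𝔼 | T < z.1 → 0 ≤ w z} := by
      have : {z : ℝ × 𝔼 | T < z.1 → 0 ≤ w z} = {z | T < z.1}ᶜ ∪ {z | 0 ≤ w z} := by
        ext z
        simp [imp_iff_not_or]
      rw [this]
      exact hS.compl.union (measurableSet_le measurable_const hw.measurable)
    rw [Measure.volume_eq_prod, Measure.ae_prod_iff_ae_ae hm]
    filter_upwards [h1] with t ht
    by_cases hT : T < t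
    · filter_upwards [ht, h t hT] with x hx hx2 _
      rwa [← hx hT]
    · exact ae_of_all _ fun x hx => absurd hx hT
  filter_upwards [huw, h2] with z hz1 hz2 hT
  rw [hz1 hT]
  exact hz2 hT

variable {u : ℝ → EuclideanSpace ℝ (Fin N) → ℝ}
  {V : ℝ × EuclideanSpace ℝ (Fin N) → EuclideanSpace ℝ (Fin N)}

theorem IsInClass.ae_bound (h : IsInClass N p m g u V) {T : ℝ} (hT : 0 < T) :
    ∃ C, 0 ≤ C ∧ ∀ᵐ z : ℝ × 𝔼, T < z.1 → |u z.1 z.2| ≤ C := by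
  have hS : MeasurableSet {z : ℝ × 𝔼 | T < z.1} := measurableSet_lt measurable_const measurable_fst
  have h1 := h.memLinfty T hT
  have h2 := h1.2
  rw [eLpNorm_exponent_top] at h2
  refine ⟨(eLpNormEssSup (fun z : ℝ × 𝔼 => u z.1 z.2)
    (volume.restrict {z | T < z.1})).toReal, ENNReal.toReal_nonneg, (ae_restrict_iff' hS).1 ?_⟩
  filter_upwards [enorm_ae_le_eLpNormEssSup (fun z : ℝ × 𝔼 => u z.1 z.2)
    (volume.restrict {z | T < z.1})] with z hz
  have h3 := ENNReal.toReal_mono h2.ne hz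
  rwa [toReal_enorm] at h3

theorem IsInClass.ae_nonneg (h : IsInClass N p m g u V) :
    ∀ᵐ z : ℝ × 𝔼, 0 < z.1 → 0 ≤ u z.1 z.2 := by
  have h1 : ∀ n : ℕ, ∀ᵐ z : ℝ × 𝔼, 1 / ((n : ℝ) + 1) < z.1 → 0 ≤ u z.1 z.2 := fun n =>
    ae_nonneg_of_slices (u := fun z => u z.1 z.2) (h.memLinfty (1 / ((n : ℝ) + 1)) (by positivity)).1
      fun t ht => h.nonneg t (lt_trans (by positivity) ht).le
  filter_upwards [ae_all_iff.2 h1] with z hz hz0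
  obtain ⟨n, hn⟩ := exists_nat_one_div_lt hz0
  exact hz n hn

theorem IsInClass.locBdd (h : IsInClass N p m g u V) : LocBdd fun z : ℝ × 𝔼 => u z.1 z.2 := by
  intro K hK hKS
  obtain ⟨T, hT, hTK⟩ := exists_time_lt_of_isCompact hK hKS
  obtain ⟨C, -, hC⟩ := h.ae_bound hT
  exact ⟨C, hC.mono fun z hz hzK => hz (hTK z hzK)⟩

theorem IsInClass.locBdd_rpow (hp : 1 < p) (hm : 0 < p + m - 3) (h : IsInClass N p m g u V) :
    LocBdd fun z : ℝ × 𝔼 => u z.1 z.2 ^ gradExponent p m := by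
  intro K hK hKS
  obtain ⟨T, hT, hTK⟩ := exists_time_lt_of_isCompact hK hKS
  obtain ⟨C, -, hC⟩ := h.ae_bound hT
  refine ⟨C ^ gradExponent p m, (hC.and h.ae_nonneg).mono fun z hz hzK => ?_⟩
  have h0 := hz.2 (hKS hzK)
  have h1 := hz.1 (hTK z hzK)
  rw [abs_of_nonneg (by positivity)]
  rw [abs_of_nonneg h0] at h1
  exact Real.rpow_le_rpow h0 h1 (gradExponent_pos hp hm).le

theorem IsInClass.aestronglyMeasurable (h : IsInClass N p m g u V) {a : ℝ} (ha : 0 < a) {s : Set (ℝ × 𝔼)}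
    (hs : ∀ z ∈ s, a ≤ z.1) :
    AEStronglyMeasurable (fun z : ℝ × 𝔼 => u z.1 z.2) (volume.restrict s) :=
  (h.memLinfty (a / 2) (by linarith)).1.mono_measure
    (Measure.restrict_mono (fun z hz => show a / 2 < z.1 by linarith [hs z hz]) le_rfl)

theorem continuous_weight (hg : ContinuousOn g (Ici 0)) : Continuous (weight g : 𝔼 → ℝ) :=
  Real.continuous_exp.comp (hg.comp_continuous continuous_norm fun x => norm_nonneg x)

theorem weight_pos (x : 𝔼) : 0 < weight g x := Real.exp_pos _

theorem eLpNorm_weightMeasure (hg : ContinuousOn g (Ici 0)) (v : 𝔼 → ℝ) :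
    eLpNorm v 1 (weightMeasure N g) = ∫⁻ x, ‖v x * weight g x‖ₑ := by
  rw [eLpNorm_one_eq_lintegral_enorm, weightMeasure,
    lintegral_withDensity_eq_lintegral_mul_non_measurable _
      (continuous_weight hg).measurable.ennreal_ofReal (ae_of_all _ fun x => ENNReal.ofReal_lt_top)]
  refine lintegral_congr fun x => ?_
  rw [Pi.mul_apply, enorm_mul, Real.enorm_eq_ofReal (weight_pos x).le, mul_comm]

theorem volume_ac_weightMeasure (hg : ContinuousOn g (Ici 0)) :
    (volume : Measure 𝔼) ≪ weightMeasure N g :=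
  withDensity_absolutelyContinuous' (continuous_weight hg).measurable.ennreal_ofReal.aemeasurable
    (ae_of_all _ fun x => by simpa using weight_pos x)

theorem weightMeasure_ac (g : ℝ → ℝ) : weightMeasure N g ≪ (volume : Measure 𝔼) :=
  withDensity_absolutelyContinuous _ _

theorem integrable_mul_weight_iff (hg : ContinuousOn g (Ici 0)) {v : 𝔼 → ℝ} :
    MemLp v 1 (weightMeasure N g) ↔ Integrable fun x => v x * weight g x := by
  have hw : AEStronglyMeasurable (weight g : 𝔼 → ℝ) volume :=
    (continuous_weight hg).aestronglyMeasurable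
  constructor
  · intro h
    refine ⟨(h.1.mono_ac (volume_ac_weightMeasure hg)).mul hw, ?_⟩
    rw [HasFiniteIntegral, ← eLpNorm_weightMeasure hg]
    exact h.2
  · intro h
    refine ⟨?_, ?_⟩
    · refine AEStronglyMeasurable.mono_ac (weightMeasure_ac g) ?_
      refine (h.1.mul (hw.aemeasurable.inv.aestronglyMeasurable)).congr (ae_of_all _ fun x => ?_)
      have := (weight_pos (g := g) x).ne'
      simp only [Pi.mul_apply, Pi.inv_apply]
      field_simp
    · rw [eLpNorm_weightMeasure hg]
      exact h.2

theorem IsInClass.integrable_slice (hg : ContinuousOn g (Ici 0)) (h : IsInClass N p m g u V) {t : ℝ}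
    (ht : 0 ≤ t) : Integrable fun x => u t x * weight g x :=
  (integrable_mul_weight_iff hg).1 (h.memL1 t ht)

/-- Continuity into `L^1(f)` and compactness of `[0, b]`: finitely many neighbourhoods suffice, and
the sum of the local bounds is a bound. -/
theorem IsInClass.norm_bound (h : IsInClass N p m g u V) (b : ℝ) :
    ∃ C : ENNReal, C ≠ ⊤ ∧ ∀ t ∈ Icc 0 b, eLpNorm (u t) 1 (weightMeasure N g) ≤ C := by
  have hloc : ∀ t ∈ Icc 0 b, ∃ s ∈ 𝓝[Icc 0 b] t, ∃ C : ENNReal, C ≠ ⊤ ∧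
      ∀ r ∈ s, r ∈ Icc 0 b → eLpNorm (u r) 1 (weightMeasure N g) ≤ C := by
    intro t ht
    have h1 := (h.continuousL1 t ht.1).eventually_le_const (u := 1) one_pos
    refine ⟨_, nhdsWithin_mono t Icc_subset_Ici_self h1,
      1 + eLpNorm (u t) 1 (weightMeasure N g), ?_, fun r hr hrI => ?_⟩
    · exact ENNReal.add_ne_top.2 ⟨ENNReal.one_ne_top, (h.memL1 t ht.1).2.ne⟩
    · have := eLpNorm_add_le ((h.memL1 r hrI.1).1.sub (h.memL1 t ht.1).1) (h.memL1 t ht.1).1 le_rfl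
      rw [sub_add_cancel] at this
      exact this.trans (by gcongr; exact hr)
  choose! s hs C hC hCs using hloc
  obtain ⟨T, hT, hcov⟩ := (isCompact_Icc (a := (0 : ℝ)) (b := b)).elim_nhdsWithin_subcover s
    fun t ht => hs t ht
  refine ⟨∑ t ∈ T, C t, ?_, fun t ht => ?_⟩
  · exact (ENNReal.sum_lt_top.2 fun t ht => (hC t (hT t ht)).lt_top).ne
  · obtain ⟨r, hr, htr⟩ := mem_iUnion₂.1 (hcov ht)
    exact (hCs r (hT r hr) t htr ht).trans
      (Finset.single_le_sum (f := C) (fun _ _ => zero_le) hr)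

/-- Tonelli and the uniform bound on slices. The strip stays away from `t = 0` because joint
measurability comes from the `L^∞` condition, which concerns positive times. -/
theorem IsInClass.integrableOn_strip (hg : ContinuousOn g (Ici 0)) (h : IsInClass N p m g u V)
    {a b : ℝ} (ha : 0 < a) :
    IntegrableOn (fun z : ℝ × 𝔼 => u z.1 z.2 * weight g z.2) (Icc a b ×ˢ univ) := by
  have hm : AEStronglyMeasurable (fun z : ℝ × 𝔼 => u z.1 z.2 * weight g z.2)
      (volume.restrict (Icc a b ×ˢ univ)) :=
    (h.aestronglyMeasurable ha fun z hz => hz.1.1).mul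
      ((continuous_weight hg).comp continuous_snd).aestronglyMeasurable
  refine ⟨hm, ?_⟩
  obtain ⟨C, hC, hCb⟩ := h.norm_bound b
  rw [HasFiniteIntegral]
  have hprod : (volume.restrict (Icc a b ×ˢ univ) : Measure (ℝ × 𝔼)) =
      (volume.restrict (Icc a b)).prod volume := by
    rw [Measure.volume_eq_prod, ← Measure.prod_restrict, Measure.restrict_univ]
  rw [hprod] at hm ⊢
  rw [lintegral_prod _ hm.enorm]
  calc ∫⁻ t in Icc a b, ∫⁻ x, ‖u t x * weight g x‖ₑ
      ≤ ∫⁻ t in Icc a b, C := by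
        refine setLIntegral_mono measurable_const fun t ht => ?_
        rw [← eLpNorm_weightMeasure hg]
        exact hCb t ⟨ha.le.trans ht.1, ht.2⟩
    _ < ⊤ := by
        rw [setLIntegral_const]
        exact ENNReal.mul_lt_top hC.lt_top measure_Icc_lt_top

/-- The strong time derivative is moved from the test function to `u`. No integrability of the flux
term is needed: the two integrands differ by an integrable function, so they are integrable
together, and otherwise both integrals are zero by convention. -/
theorem weakForm_eq (hg : ContinuousOn g (Ici 0)) (h : IsInClass N p m g u V)
    {v : ℝ × 𝔼 → ℝ} (hv : HasWeakTimeDeriv (fun z => u z.1 z.2) v) {η : ℝ × 𝔼 → ℝ} (hη : IsTest η) :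
    weakForm p m g u V η =
      ∫ z, (v z * η z + inner ℝ (flux p m (V z)) (spaceGrad η z)) * weight g z.2 := by
  obtain ⟨h1, h2⟩ := integral_time_chain (f := weight g) hv h.locBdd (B := id) (b := fun _ => 1)
    (fun s => hasDerivAt_id s) continuous_const hη (continuous_weight hg)
  simp only [one_mul, id] at h1 h2
  have heq : ∀ z, (v z * η z + inner ℝ (flux p m (V z)) (spaceGrad η z)) * weight g z.2 =
      (-(u z.1 z.2 * timeDeriv η z) + inner ℝ (flux p m (V z)) (spaceGrad η z)) * weight g z.2 +
      (v z * η z + u z.1 z.2 * timeDeriv η z) * weight g z.2 := fun z => by ring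
  simp only [weakForm, heq]
  by_cases hi : Integrable fun z : ℝ × 𝔼 =>
      (-(u z.1 z.2 * timeDeriv η z) + inner ℝ (flux p m (V z)) (spaceGrad η z)) * weight g z.2
  · rw [integral_add hi h1, h2, add_zero]
  · rw [integral_undef hi, integral_undef]
    intro hc
    exact hi ((integrable_add_iff_integrable_left h1).1 hc)

end Class

/-! ### Regularized powers and absorption of the gradient. -/

section Regularization

/-- A smooth odd regularization of the power `s ^ σ`. -/
def powReg (σ δ s : ℝ) : ℝ := s * (s ^ 2 + δ ^ 2) ^ ((σ - 1) / 2)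

variable {σ δ : ℝ}

theorem sq_add_sq_pos (hδ : 0 < δ) (s : ℝ) : 0 < s ^ 2 + δ ^ 2 := by positivity

theorem contDiff_powReg (hδ : 0 < δ) : ContDiff ℝ (⊤ : ℕ∞) (powReg σ δ) := by
  unfold powReg
  refine contDiff_id.mul (ContDiff.rpow_const_of_ne (by fun_prop) fun s => ?_)
  exact (sq_add_sq_pos hδ s).ne'

/-- The derivative is `(1 + (σ - 1) s² / (s² + δ²))` times the regularized power; the fraction is at
most `1` and `σ - 1 ≤ 0`. -/
theorem le_deriv_powReg (hσ1 : σ ≤ 1) (hδ : 0 < δ) (s : ℝ) :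
    σ * (s ^ 2 + δ ^ 2) ^ ((σ - 1) / 2) ≤ deriv (powReg σ δ) s := by
  have hA := sq_add_sq_pos hδ s
  have h1 : HasDerivAt (fun s : ℝ => s ^ 2 + δ ^ 2) (2 * s) s := by
    simpa using (hasDerivAt_pow 2 s).add_const (δ ^ 2)
  have h2 := (hasDerivAt_id s).mul (h1.rpow_const (p := (σ - 1) / 2) (Or.inl hA.ne'))
  rw [show deriv (powReg σ δ) s = _ from h2.deriv, Real.rpow_sub_one hA.ne']
  have h3 : 0 < (s ^ 2 + δ ^ 2) ^ ((σ - 1) / 2) := Real.rpow_pos_of_pos hA _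
  simp only [id, one_mul]
  have h4 : s * (2 * s * ((σ - 1) / 2) * ((s ^ 2 + δ ^ 2) ^ ((σ - 1) / 2) / (s ^ 2 + δ ^ 2))) =
      (σ - 1) * (s ^ 2 / (s ^ 2 + δ ^ 2)) * (s ^ 2 + δ ^ 2) ^ ((σ - 1) / 2) := by
    field_simp
  rw [h4]
  have h5 : s ^ 2 / (s ^ 2 + δ ^ 2) ≤ 1 := (div_le_one hA).2 (by nlinarith)
  have h6 : (σ - 1) * 1 ≤ (σ - 1) * (s ^ 2 / (s ^ 2 + δ ^ 2)) :=
    mul_le_mul_of_nonpos_left h5 (by linarith)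
  nlinarith

theorem powReg_nonneg {s : ℝ} (hs : 0 ≤ s) : 0 ≤ powReg σ δ s := by
  unfold powReg
  positivity

theorem rpow_regularized_le (hσ1 : σ ≤ 1) {s : ℝ} (hs : 0 < s) :
    (s ^ 2 + δ ^ 2) ^ ((σ - 1) / 2) ≤ s ^ (σ - 1) := by
  calc (s ^ 2 + δ ^ 2) ^ ((σ - 1) / 2) ≤ (s ^ 2) ^ ((σ - 1) / 2) :=
        Real.rpow_le_rpow_of_nonpos (by positivity) (by nlinarith [sq_nonneg δ]) (by linarith)
    _ = s ^ (σ - 1) := by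
        rw [← Real.rpow_natCast, ← Real.rpow_mul hs.le]
        congr 1
        push_cast
        ring

theorem powReg_le (hσ0 : 0 < σ) (hσ1 : σ ≤ 1) {s : ℝ} (hs : 0 ≤ s) : powReg σ δ s ≤ s ^ σ := by
  rcases hs.eq_or_lt with rfl | hs
  · simp [powReg, Real.zero_rpow hσ0.ne']
  · unfold powReg
    calc s * (s ^ 2 + δ ^ 2) ^ ((σ - 1) / 2) ≤ s * s ^ (σ - 1) :=
          mul_le_mul_of_nonneg_left (rpow_regularized_le hσ1 hs) hs.le
      _ = s ^ σ := by
          rw [mul_comm, ← Real.rpow_add_one hs.ne']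
          ring_nf

/-- This is the remainder left by `absorb_gradient`. With `E` the regularized power, `E^p E^(1-p) =
E ≤ s^(σ-1)`, so the bound does not depend on `δ`. -/
theorem powReg_rpow_mul_le {p : ℝ} (hp : 1 < p) (hσ0 : 0 < σ) (hσ1 : σ ≤ 1) (hδ : 0 < δ) {s : ℝ}
    (hs : 0 ≤ s) :
    powReg σ δ s ^ p * (σ * (s ^ 2 + δ ^ 2) ^ ((σ - 1) / 2)) ^ (1 - p) ≤
      σ ^ (1 - p) * s ^ (p + σ - 1) := by
  have hA := sq_add_sq_pos hδ s
  rcases hs.eq_or_lt with rfl | hs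
  · rw [powReg, zero_mul, Real.zero_rpow (by linarith : p ≠ 0), zero_mul]
    positivity
  · set E := (s ^ 2 + δ ^ 2) ^ ((σ - 1) / 2)
    have hE : 0 < E := Real.rpow_pos_of_pos hA _
    have hEs : E ≤ s ^ (σ - 1) := rpow_regularized_le hσ1 hs
    rw [show powReg σ δ s = s * E from rfl, Real.mul_rpow hs.le hE.le, Real.mul_rpow hσ0.le hE.le]
    calc s ^ p * E ^ p * (σ ^ (1 - p) * E ^ (1 - p))
        = σ ^ (1 - p) * (s ^ p * (E ^ p * E ^ (1 - p))) := by ring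
      _ = σ ^ (1 - p) * (s ^ p * E) := by
          rw [← Real.rpow_add hE, show p + (1 - p) = 1 by ring, Real.rpow_one]
      _ ≤ σ ^ (1 - p) * (s ^ p * s ^ (σ - 1)) := by gcongr
      _ = σ ^ (1 - p) * s ^ (p + σ - 1) := by
          rw [← Real.rpow_add hs]
          ring_nf

/-- Young's inequality with explicit constants; in the application `x` is the norm of the gradient
of the solution, `y` that of the cutoff `ψ`. Either `b y ≤ D ψ x / 2` and the product is absorbed,
or `x ≤ 2 b y / (D ψ)`, and after substitution only `y^p / ψ^(p-1) ≤ C` is left. -/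
theorem absorb_gradient {p x y b D ψ C : ℝ} (hp : 1 < p) (hx : 0 ≤ x) (hy : 0 ≤ y) (hb : 0 ≤ b)
    (hD : 0 < D) (hψ : 0 ≤ ψ) (hC : 0 ≤ C)
    (hyψ : y ^ p ≤ C * ψ ^ (p - 1)) :
    b * x ^ (p - 1) * y ≤ 1 / 2 * (D * ψ * x ^ p) + 2 ^ (p - 1) * C * (b ^ p * D ^ (1 - p)) := by
  have hp1 : 0 < p - 1 := by linarith
  rcases hψ.eq_or_lt with rfl | hψ0
  · rw [Real.zero_rpow hp1.ne', mul_zero] at hyψ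
    have hy0 : y = 0 := by
      by_contra hne
      have : 0 < y := lt_of_le_of_ne hy (Ne.symm hne)
      exact absurd hyψ (not_le.2 (Real.rpow_pos_of_pos this p))
    rw [hy0]
    simp only [mul_zero, zero_mul, zero_add]
    positivity
  · rcases le_or_gt (b * y) (1 / 2 * (D * ψ * x)) with h | h
    · have h1 : b * x ^ (p - 1) * y ≤ 1 / 2 * (D * ψ * x ^ p) := by
        calc b * x ^ (p - 1) * y = x ^ (p - 1) * (b * y) := by ring
          _ ≤ x ^ (p - 1) * (1 / 2 * (D * ψ * x)) := by gcongr
          _ = 1 / 2 * (D * ψ * (x ^ (p - 1) * x)) := by ring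
          _ = _ := by rw [rpow_sub_one_mul_self hx hp]
      have h2 : 0 ≤ 2 ^ (p - 1) * C * (b ^ p * D ^ (1 - p)) := by positivity
      linarith
    · have h1 : x ≤ 2 * (b * y) / (D * ψ) := by
        rw [le_div_iff₀ (by positivity)]
        linarith
      have h2 : b * x ^ (p - 1) * y ≤ 2 ^ (p - 1) * C * (b ^ p * D ^ (1 - p)) := by
        calc b * x ^ (p - 1) * y ≤ b * (2 * (b * y) / (D * ψ)) ^ (p - 1) * y := by gcongr
          _ = 2 ^ (p - 1) * (b ^ (p - 1) * b) * (y ^ (p - 1) * y) * (D ^ (p - 1))⁻¹ *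
              (ψ ^ (p - 1))⁻¹ := by
              rw [Real.div_rpow (by positivity) (by positivity),
                Real.mul_rpow (by positivity) (by positivity), Real.mul_rpow hb hy,
                Real.mul_rpow hD.le hψ]
              field_simp
          _ = 2 ^ (p - 1) * b ^ p * (D ^ (p - 1))⁻¹ * (y ^ p * (ψ ^ (p - 1))⁻¹) := by
              rw [rpow_sub_one_mul_self hb hp, rpow_sub_one_mul_self hy hp]
              ring
          _ ≤ 2 ^ (p - 1) * b ^ p * (D ^ (p - 1))⁻¹ * C := by
              gcongr
              rw [← div_eq_mul_inv]
              exact (div_le_iff₀ (Real.rpow_pos_of_pos hψ0 _)).2 hyψ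
          _ = _ := by
              rw [← Real.rpow_neg hD.le]
              ring_nf
      have h3 : 0 ≤ 1 / 2 * (D * ψ * x ^ p) := by positivity
      linarith

end Regularization

/-! ### Cutoff functions in time and space. -/

section Cutoff

variable {N : ℕ}

local notation "𝔼" => EuclideanSpace ℝ (Fin N)

theorem norm_gradient_eq (ψ : 𝔼 → ℝ) (x : 𝔼) : ‖gradient ψ x‖ = ‖fderiv ℝ ψ x‖ := by
  rw [gradient]
  exact (InnerProductSpace.toDual ℝ 𝔼).symm.norm_map _

/-- Spatial cutoff functions at scale `R`. -/
theorem exists_space_cutoff (N : ℕ) {p : ℝ} (hp : 1 < p) :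
    ∃ C : ℝ, 0 ≤ C ∧ ∀ R : ℝ, 1 ≤ R → ∃ ψ : EuclideanSpace ℝ (Fin N) → ℝ,
      ContDiff ℝ (⊤ : ℕ∞) ψ ∧ (∀ x, 0 ≤ ψ x) ∧ (∀ x, ψ x ≤ 1) ∧ (∀ x, ‖x‖ ≤ R → ψ x = 1) ∧
      tsupport ψ ⊆ Metric.closedBall 0 (2 * R) ∧
      (∀ x, ‖gradient ψ x‖ ^ p ≤ C * ψ x ^ (p - 1)) ∧ (∀ x, ‖gradient ψ x‖ ≤ C / R) := by
  obtain ⟨φ, hφi, hφo⟩ : ∃ φ : ContDiffBump (0 : EuclideanSpace ℝ (Fin N)),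
      φ.rIn = 1 ∧ φ.rOut = 2 := ⟨⟨1, 2, one_pos, one_lt_two⟩, rfl, rfl⟩
  -- A bump `φ ≤ 1` raised to a power `q ≥ p` satisfies `|∇φ^q|^p ≤ C φ^((q-1)p) ≤ C (φ^q)^(p-1)`,
  -- because `(q - 1) p ≥ q (p - 1)`.
  set q := ⌈p⌉₊ with hq
  have hqp : p ≤ q := Nat.le_ceil p
  have hq1 : 1 ≤ q := by
    have : (1 : ℝ) < q := hp.trans_le hqp
    exact_mod_cast this.le
  have hφs : ContDiff ℝ (⊤ : ℕ∞) φ := φ.contDiff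
  obtain ⟨C0, hC0⟩ : ∃ C0, ∀ x, ‖fderiv ℝ φ x‖ ≤ C0 :=
    (φ.hasCompactSupport.fderiv ℝ).exists_bound_of_continuous (hφs.continuous_fderiv (by simp))
  have hC00 : 0 ≤ C0 := (norm_nonneg _).trans (hC0 0)
  refine ⟨max ((q * C0) ^ p) (q * C0), le_max_of_le_right (by positivity), fun R hR => ?_⟩
  have hR0 : 0 < R := by linarith
  set ψ : EuclideanSpace ℝ (Fin N) → ℝ := fun x => φ (R⁻¹ • x) ^ q with hψ
  have hd : ∀ x, ‖gradient ψ x‖ ≤ q * φ (R⁻¹ • x) ^ (q - 1) * (C0 * R⁻¹) := by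
    intro x
    have e1 : HasFDerivAt (fun y : EuclideanSpace ℝ (Fin N) => φ (R⁻¹ • y))
        ((fderiv ℝ φ (R⁻¹ • x)).comp (R⁻¹ • ContinuousLinearMap.id ℝ _)) x :=
      ((hφs.differentiable (by simp) (R⁻¹ • x)).hasFDerivAt).comp x
        ((hasFDerivAt_id x).const_smul R⁻¹)
    have e2 := e1.pow q
    rw [norm_gradient_eq, show fderiv ℝ ψ x = _ from e2.fderiv, norm_smul]
    have e3 : ‖(fderiv ℝ φ (R⁻¹ • x)).comp (R⁻¹ • ContinuousLinearMap.id ℝ _)‖ ≤ C0 * R⁻¹ := by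
      rw [ContinuousLinearMap.comp_smul, ContinuousLinearMap.comp_id, norm_smul,
        Real.norm_of_nonneg (by positivity), mul_comm]
      exact mul_le_mul_of_nonneg_right (hC0 _) (by positivity)
    have e4 : ‖q • φ (R⁻¹ • x) ^ (q - 1)‖ = q * φ (R⁻¹ • x) ^ (q - 1) := by
      rw [nsmul_eq_mul, Real.norm_of_nonneg]
      have := φ.nonneg (x := R⁻¹ • x)
      positivity
    rw [e4]
    refine mul_le_mul_of_nonneg_left e3 ?_
    have := φ.nonneg (x := R⁻¹ • x)
    positivity
  have hR1 : R⁻¹ ≤ 1 := inv_le_one_of_one_le₀ hR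
  refine ⟨ψ, ?_, fun x => pow_nonneg φ.nonneg q, fun x => pow_le_one₀ φ.nonneg φ.le_one,
    fun x hx => ?_, ?_, fun x => ?_, fun x => ?_⟩
  · have h1 : ContDiff ℝ (⊤ : ℕ∞) fun x : EuclideanSpace ℝ (Fin N) => R⁻¹ • x :=
      contDiff_const_smul R⁻¹
    have h2 : ContDiff ℝ (⊤ : ℕ∞) fun x : EuclideanSpace ℝ (Fin N) => φ (R⁻¹ • x) := hφs.comp h1
    exact h2.pow q
  · have : φ (R⁻¹ • x) = 1 := φ.one_of_mem_closedBall (by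
      rw [mem_closedBall_zero_iff, norm_smul, Real.norm_of_nonneg (by positivity), hφi]
      exact (inv_mul_le_one₀ hR0).2 hx)
    simp [hψ, this]
  · refine closure_minimal (fun x hx => ?_) Metric.isClosed_closedBall
    have h1 : φ (R⁻¹ • x) ≠ 0 := fun h => hx (by simp [hψ, h]; omega)
    have h2 : R⁻¹ • x ∈ Function.support φ := h1
    rw [φ.support_eq, mem_ball_zero_iff, norm_smul, Real.norm_of_nonneg (by positivity)] at h2
    rw [mem_closedBall_zero_iff]
    have h3 : R⁻¹ * ‖x‖ < 2 := hφo ▸ h2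
    rw [inv_mul_lt_iff₀ hR0] at h3
    linarith
  · have h0 := φ.nonneg (x := R⁻¹ • x)
    have h1 := φ.le_one (x := R⁻¹ • x)
    have hqm : ((q - 1 : ℕ) : ℝ) = q - 1 := by rw [Nat.cast_sub hq1, Nat.cast_one]
    have h2 : ‖gradient ψ x‖ ≤ (q * C0) * φ (R⁻¹ • x) ^ (q - 1) := by
      refine (hd x).trans ?_
      have : C0 * R⁻¹ ≤ C0 := mul_le_of_le_one_right hC00 hR1
      calc _ ≤ q * φ (R⁻¹ • x) ^ (q - 1) * C0 := by gcongr
        _ = _ := by ring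
    calc ‖gradient ψ x‖ ^ p ≤ ((q * C0) * φ (R⁻¹ • x) ^ (q - 1)) ^ p := by gcongr
      _ = (q * C0) ^ p * (φ (R⁻¹ • x) ^ (q - 1)) ^ p :=
          Real.mul_rpow (by positivity) (by positivity)
      _ ≤ max ((q * C0) ^ p) (q * C0) * ψ x ^ (p - 1) := by
          gcongr
          · exact le_max_left _ _
          · simp only [hψ]
            rcases h0.eq_or_lt with h0 | h0
            · rw [← h0]
              rcases eq_or_ne q 1 with h | h
              · exfalso
                rw [h] at hqp
                norm_num at hqp
                linarith
              · rw [zero_pow (by omega), zero_pow (by omega), Real.zero_rpow (by linarith),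
                  Real.zero_rpow (by linarith)]
            · rw [← Real.rpow_natCast, ← Real.rpow_natCast, ← Real.rpow_mul h0.le,
                ← Real.rpow_mul h0.le]
              refine Real.rpow_le_rpow_of_exponent_ge h0 h1 ?_
              rw [hqm]
              nlinarith
  · have h1 := φ.le_one (x := R⁻¹ • x)
    have h0 := φ.nonneg (x := R⁻¹ • x)
    refine (hd x).trans ?_
    have h2 : φ (R⁻¹ • x) ^ (q - 1) ≤ 1 := pow_le_one₀ h0 h1
    calc q * φ (R⁻¹ • x) ^ (q - 1) * (C0 * R⁻¹) ≤ q * 1 * (C0 * R⁻¹) := by gcongr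
      _ = (q * C0) / R := by ring
      _ ≤ _ := by gcongr; exact le_max_right _ _

theorem exists_time_cutoff {a b : ℝ} (ha : 0 < a) (hab : a ≤ b) :
    ∃ ζ : ℝ → ℝ, ContDiff ℝ (⊤ : ℕ∞) ζ ∧ (∀ t, 0 ≤ ζ t) ∧ (∀ t, ζ t ≤ 1) ∧
      (∀ t ∈ Icc a b, ζ t = 1) ∧ tsupport ζ ⊆ Icc (a / 2) (b + a / 2) := by
  let φ : ContDiffBump ((a + b) / 2) := ⟨(b - a) / 2 + a / 4, (b - a) / 2 + a / 2, by linarith,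
    by linarith⟩
  refine ⟨φ, φ.contDiff, fun t => φ.nonneg, fun t => φ.le_one, fun t ht => ?_, ?_⟩
  · refine φ.one_of_mem_closedBall ?_
    rw [Metric.mem_closedBall, Real.dist_eq, abs_le]
    constructor <;> simp only [φ] <;> linarith [ht.1, ht.2]
  · rw [φ.tsupport_eq, Real.closedBall_eq_Icc]
    refine Icc_subset_Icc ?_ ?_ <;> simp only [φ] <;> linarith

/-- Products of a time cutoff and a space cutoff. -/
def prodTest (ζ : ℝ → ℝ) (ψ : 𝔼 → ℝ) (z : ℝ × 𝔼) : ℝ := ζ z.1 * ψ z.2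

variable {ζ : ℝ → ℝ} {ψ : EuclideanSpace ℝ (Fin N) → ℝ}

theorem timeDeriv_prodTest (hζ : Differentiable ℝ ζ) (z : ℝ × 𝔼) :
    timeDeriv (prodTest ζ ψ) z = deriv ζ z.1 * ψ z.2 :=
  ((hζ z.1).hasDerivAt.mul_const (ψ z.2)).deriv

theorem spaceGrad_prodTest (hψ : Differentiable ℝ ψ) (z : ℝ × 𝔼) :
    spaceGrad (prodTest ζ ψ) z = ζ z.1 • gradient ψ z.2 := by
  have : HasFDerivAt (fun y => prodTest ζ ψ (z.1, y)) (ζ z.1 • fderiv ℝ ψ z.2) z.2 :=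
    (hψ z.2).hasFDerivAt.const_mul (ζ z.1)
  rw [spaceGrad, gradient, this.fderiv, gradient, map_smul]

theorem tsupport_prodTest_subset {s : Set ℝ} {t : Set (EuclideanSpace ℝ (Fin N))}
    (hs : tsupport ζ ⊆ s) (ht : tsupport ψ ⊆ t) :
    tsupport (prodTest ζ ψ) ⊆ s ×ˢ t := by
  have h : tsupport (prodTest ζ ψ) ⊆ tsupport ζ ×ˢ tsupport ψ := by
    refine closure_minimal (fun z hz => ?_) ((isClosed_tsupport ζ).prod (isClosed_tsupport ψ))
    have h1 : ζ z.1 * ψ z.2 ≠ 0 := hz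
    exact ⟨subset_tsupport _ (left_ne_zero_of_mul h1), subset_tsupport _ (right_ne_zero_of_mul h1)⟩
  exact h.trans (prod_mono hs ht)

theorem isTest_prodTest (hζ : ContDiff ℝ (⊤ : ℕ∞) ζ) (hψ : ContDiff ℝ (⊤ : ℕ∞) ψ) {a b R : ℝ}
    (ha : 0 < a) (hζs : tsupport ζ ⊆ Icc a b) (hψs : tsupport ψ ⊆ Metric.closedBall 0 R) :
    IsTest (prodTest ζ ψ) where
  smooth := (hζ.comp contDiff_fst).mul (hψ.comp contDiff_snd)
  compact := (isCompact_Icc.prod (isCompact_closedBall 0 R)).of_isClosed_subset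
    (isClosed_tsupport _) (tsupport_prodTest_subset hζs hψs)
  support := fun _ hz => ha.trans_le (tsupport_prodTest_subset hζs hψs hz).1.1

end Cutoff

/-! ### Energy estimate and uniform integrability of the flux. -/

section Energy

variable {N : ℕ} {p m : ℝ} {g : ℝ → ℝ} {u : ℝ → EuclideanSpace ℝ (Fin N) → ℝ}
  {V : ℝ × EuclideanSpace ℝ (Fin N) → EuclideanSpace ℝ (Fin N)}
  {v : ℝ × EuclideanSpace ℝ (Fin N) → ℝ}

local notation "𝔼" => EuclideanSpace ℝ (Fin N)

theorem HasWeakTimeDeriv.locLp {y v : ℝ × 𝔼 → ℝ} (hv : HasWeakTimeDeriv y v) : LocLp 1 v :=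
  fun _ h1 h2 => memLp_one_iff_integrable.2 (hv.2.1.integrableOn_compact_subset h2 h1)

/-- The identity obtained by testing the equation with `b (u ^ κ) χ`. -/
theorem integral_power_test (hp : 1 < p) (hm : 0 < p + m - 3) (hg : ContinuousOn g (Ici 0))
    (h : IsInClass N p m g u V) (hv : HasWeakTimeDeriv (fun z => u z.1 z.2) v)
    (heq : ∀ η, IsTest η → weakForm p m g u V η = 0) {b B : ℝ → ℝ} (hb : ContDiff ℝ (⊤ : ℕ∞) b)
    (hB : ∀ s, HasDerivAt B (b (|s| ^ gradExponent p m)) s) {χ : ℝ × 𝔼 → ℝ} (hχ : IsTest χ) :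
    Integrable (fun z => (inner ℝ (flux p m (V z))
        ((deriv b (u z.1 z.2 ^ gradExponent p m) * χ z) • V z +
          b (u z.1 z.2 ^ gradExponent p m) • spaceGrad χ z) -
        B (u z.1 z.2) * timeDeriv χ z) * weight g z.2) ∧
    ∫ z, (inner ℝ (flux p m (V z)) ((deriv b (u z.1 z.2 ^ gradExponent p m) * χ z) • V z +
          b (u z.1 z.2 ^ gradExponent p m) • spaceGrad χ z) -
        B (u z.1 z.2) * timeDeriv χ z) * weight g z.2 = 0 := by
  have hκ := gradExponent_pos hp hm
  obtain ⟨η, hη, -, hlim⟩ := exists_test_approx h.weakGrad (h.locBdd_rpow hp hm) hp h.gradLp hb hχ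
  obtain ⟨i1, l1⟩ := hlim v (fun z => flux p m (V z)) hv.locLp (LocLp.flux hp hm h.gradLp)
    (weight g) (continuous_weight hg)
  have z1 := tendsto_nhds_unique l1 (tendsto_const_nhds.congr fun n => by
    rw [← weakForm_eq hg h hv (hη n), heq _ (hη n)])
  -- The absolute value makes the function continuous on the whole line, as the time chain rule
  -- requires; it disappears since `u ≥ 0` almost everywhere.
  have hbc : Continuous fun s : ℝ => b (|s| ^ gradExponent p m) :=
    hb.continuous.comp (continuous_abs.rpow_const fun _ => Or.inr hκ.le)
  obtain ⟨i2, z2⟩ := integral_time_chain hv h.locBdd hB hbc hχ (continuous_weight hg)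
  have hae : ∀ᵐ z : ℝ × 𝔼, (v z * (b (u z.1 z.2 ^ gradExponent p m) * χ z) +
        inner ℝ (flux p m (V z)) ((deriv b (u z.1 z.2 ^ gradExponent p m) * χ z) • V z +
          b (u z.1 z.2 ^ gradExponent p m) • spaceGrad χ z)) * weight g z.2 -
        (v z * (b (|u z.1 z.2| ^ gradExponent p m) * χ z) + B (u z.1 z.2) * timeDeriv χ z) *
          weight g z.2 =
      (inner ℝ (flux p m (V z)) ((deriv b (u z.1 z.2 ^ gradExponent p m) * χ z) • V z +
          b (u z.1 z.2 ^ gradExponent p m) • spaceGrad χ z) -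
        B (u z.1 z.2) * timeDeriv χ z) * weight g z.2 := by
    filter_upwards [h.ae_nonneg] with z hz
    by_cases hz0 : 0 < z.1
    · rw [abs_of_nonneg (hz hz0)]
      ring
    · have : χ z = 0 := image_eq_zero_of_notMem_tsupport fun hc => hz0 (hχ.support hc)
      rw [this]
      ring
  exact ⟨(i1.sub i2).congr hae, by rw [← integral_congr_ae hae, integral_sub i1 i2, z1, z2, sub_zero]⟩

theorem integrable_of_bdd_mul {K : Set (ℝ × 𝔼)} (hK : IsCompact K) {a k : ℝ × 𝔼 → ℝ} {C : ℝ}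
    (ha : AEStronglyMeasurable a (volume.restrict K)) (hC : ∀ᵐ z, z ∈ K → |a z| ≤ C)
    (hk : IntegrableOn k K) (h0 : ∀ z ∉ K, a z = 0) : Integrable fun z => a z * k z := by
  refine (integrableOn_iff_integrable_of_support_subset (s := K) fun z hz => ?_).1
    (Integrable.bdd_mul hk ha ((ae_restrict_iff' hK.measurableSet).2 hC))
  by_contra hzK
  exact hz (by simp [h0 z hzK])

theorem primitive_powReg_bound {σ δ κ M s : ℝ} (hσ0 : 0 < σ) (hσ1 : σ ≤ 1) (hκ : 0 < κ)
    (hs : 0 ≤ s) (hsM : s ≤ M) :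
    |∫ r in (0 : ℝ)..s, powReg σ δ (|r| ^ κ)| ≤ (M ^ κ) ^ σ * s := by
  have h1 : ∀ r ∈ Set.uIoc 0 s, ‖powReg σ δ (|r| ^ κ)‖ ≤ (M ^ κ) ^ σ := by
    intro r hr
    rw [uIoc_of_le hs] at hr
    have h2 : 0 ≤ |r| ^ κ := by positivity
    rw [Real.norm_of_nonneg (powReg_nonneg h2)]
    refine (powReg_le hσ0 hσ1 h2).trans ?_
    rw [abs_of_pos hr.1]
    have := hr.1.le
    gcongr
    exact hr.2.trans hsM
  have := intervalIntegral.norm_integral_le_of_norm_le_const h1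
  rwa [sub_zero, abs_of_nonneg hs] at this

/-- Local energy estimate, uniform in the size of the domain and in the regularization. -/
theorem energy_bound (hp : 1 < p) (hm : 0 < p + m - 3) (hg : ContinuousOn g (Ici 0))
    (h : IsInClass N p m g u V) (hv : HasWeakTimeDeriv (fun z => u z.1 z.2) v)
    (heq : ∀ η, IsTest η → weakForm p m g u V η = 0) {σ : ℝ} (hσ0 : 0 < σ) (hσ1 : σ ≤ 1)
    {a b : ℝ} (ha : 0 < a) (hab : a ≤ b) :
    ∃ C : ℝ, ∀ δ : ℝ, 0 < δ → ∀ R : ℝ, 1 ≤ R →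
      IntegrableOn (fun z : ℝ × 𝔼 => (((u z.1 z.2 ^ gradExponent p m) ^ 2 + δ ^ 2) ^ ((σ - 1) / 2) *
        ‖V z‖ ^ p) * weight g z.2) (Icc a b ×ˢ Metric.closedBall 0 R) ∧
      ∫ z in Icc a b ×ˢ Metric.closedBall 0 R,
        (((u z.1 z.2 ^ gradExponent p m) ^ 2 + δ ^ 2) ^ ((σ - 1) / 2) *
        ‖V z‖ ^ p) * weight g z.2 ≤ C := by
  set κ := gradExponent p m with hκdef
  have hκ : 0 < κ := gradExponent_pos hp hm
  set c := κ ^ (1 - p) with hc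
  have hc0 : 0 < c := by positivity
  -- Indeed `κ (p - 1) = k + 1`. Therefore the remainder `u^(κ(p+σ-1))` is at most a constant times
  -- `u`, for bounded `u`, and `u` is integrable against the weight.
  have hκp : 1 < κ * (p - 1) := by
    rw [hκdef, gradExponent, div_mul_cancel₀ _ (by linarith : p - 1 ≠ 0)]
    linarith
  obtain ⟨ζ, hζ, hζ0, hζ1, hζab, hζs⟩ := exists_time_cutoff ha hab
  obtain ⟨Cψ, hCψ, hcut⟩ := exists_space_cutoff N hp
  -- The time cutoff lives on `[a/2, b + a/2]` and the bound holds for times strictly after `T`,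
  -- hence `a / 4`.
  obtain ⟨M, hM0, hM⟩ := h.ae_bound (T := a / 4) (by linarith)
  have hζc : HasCompactSupport ζ := isCompact_Icc.of_isClosed_subset (isClosed_tsupport _) hζs
  obtain ⟨Z, hZ⟩ := hζc.deriv.exists_bound_of_continuous (hζ.continuous_deriv (by simp))
  have hZ0 : 0 ≤ Z := (norm_nonneg _).trans (hZ 0)
  set S : Set (ℝ × 𝔼) := Icc (a / 2) (b + a / 2) ×ˢ univ with hS
  have hSm : MeasurableSet S := measurableSet_Icc.prod MeasurableSet.univ
  have hstrip := h.integrableOn_strip hg (a := a / 2) (b := b + a / 2) (by linarith)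
  set e := κ * (p + σ - 1) - 1 with he
  have he0 : 0 ≤ e := by nlinarith
  set C1 := c * (2 ^ (p - 1) * Cψ * (σ ^ (1 - p) * M ^ e)) + Z * (M ^ κ) ^ σ with hC1
  have hC10 : 0 ≤ C1 := by positivity
  have hκs : 0 < c * σ / 2 := by positivity
  refine ⟨(c * σ / 2)⁻¹ * (C1 * ∫ z in S, u z.1 z.2 * weight g z.2), fun δ hδ R hR => ?_⟩
  obtain ⟨ψ, hψ, hψ0, hψ1, hψR, hψs, hψg, -⟩ := hcut R hR
  set χ := prodTest ζ ψ with hχdef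
  have hχ : IsTest χ := isTest_prodTest hζ hψ (by linarith) hζs hψs
  set K : Set (ℝ × 𝔼) := Icc (a / 2) (b + a / 2) ×ˢ Metric.closedBall 0 (2 * R)
  have hK : IsCompact K := isCompact_Icc.prod (isCompact_closedBall 0 (2 * R))
  have hKS : K ⊆ halfSpace N := fun z hz => lt_of_lt_of_le (by linarith : 0 < a / 2) hz.1.1
  have hχK : ∀ z ∉ K, χ z = 0 := fun z hz => image_eq_zero_of_notMem_tsupport fun hc =>
    hz (tsupport_prodTest_subset hζs hψs hc)
  have hbc : Continuous fun s : ℝ => powReg σ δ (|s| ^ κ) :=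
    (contDiff_powReg hδ).continuous.comp (continuous_abs.rpow_const fun _ => Or.inr hκ.le)
  obtain ⟨hI, hI0⟩ := integral_power_test (b := powReg σ δ)
    (B := fun s => ∫ r in (0 : ℝ)..s, powReg σ δ (|r| ^ κ)) hp hm hg h hv heq
    (contDiff_powReg hδ) (fun s => (hbc.integral_hasStrictDerivAt 0 s).hasDerivAt) hχ
  -- the coercive term
  set D : ℝ × 𝔼 → ℝ := fun z => ((u z.1 z.2 ^ κ) ^ 2 + δ ^ 2) ^ ((σ - 1) / 2) with hD
  have hD0 : ∀ z, 0 < D z := fun z => Real.rpow_pos_of_pos (sq_add_sq_pos hδ _) _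
  have hDb : ∀ z, D z ≤ (δ ^ 2) ^ ((σ - 1) / 2) := fun z =>
    Real.rpow_le_rpow_of_nonpos (by positivity) (by nlinarith [sq_nonneg (u z.1 z.2 ^ κ)])
      (by linarith)
  have hum : AEStronglyMeasurable (fun z : ℝ × 𝔼 => u z.1 z.2) (volume.restrict K) :=
    h.aestronglyMeasurable (a := a / 2) (by linarith) fun z hz => hz.1.1
  have hDm : AEStronglyMeasurable D (volume.restrict K) :=
    (((hum.aemeasurable.pow_const κ).pow_const 2).add_const _).pow_const _ |>.aestronglyMeasurable
  have hVp : IntegrableOn (fun z => ‖V z‖ ^ p * weight g z.2) K := by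
    have h1 := (h.gradLp K hK hKS).integrable_norm_rpow (by simp; linarith) ENNReal.ofReal_ne_top
    rw [ENNReal.toReal_ofReal (by linarith)] at h1
    exact IntegrableOn.mul_continuousOn h1
      ((continuous_weight hg).comp continuous_snd).continuousOn hK
  have hT1 : Integrable fun z => D z * χ z * (‖V z‖ ^ p * weight g z.2) := by
    refine integrable_of_bdd_mul hK (C := (δ ^ 2) ^ ((σ - 1) / 2) * 1)
      (hDm.mul hχ.smooth.continuous.aestronglyMeasurable) (ae_of_all _ fun z _ => ?_) hVp
      fun z hz => by rw [hχK z hz, mul_zero]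
    rw [abs_mul, abs_of_pos (hD0 z)]
    have h1 : |χ z| ≤ 1 := by
      change |ζ z.1 * ψ z.2| ≤ 1
      rw [abs_of_nonneg (mul_nonneg (hζ0 _) (hψ0 _))]
      exact mul_le_one₀ (hζ1 _) (hψ0 _) (hψ1 _)
    have := hDb z
    gcongr
  have hT2 : Integrable (S.indicator fun z : ℝ × 𝔼 => u z.1 z.2 * weight g z.2) :=
    (integrable_indicator_iff hSm).2 hstrip
  -- Half of the coercive term survives the absorption of the cutoff gradient. All the rest is
  -- bounded by `C1 u f` on the strip, which no longer sees `R` or `δ`.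
  have hpt : ∀ᵐ z : ℝ × 𝔼, c * σ / 2 * (D z * χ z * (‖V z‖ ^ p * weight g z.2)) -
      C1 * S.indicator (fun z : ℝ × 𝔼 => u z.1 z.2 * weight g z.2) z ≤
      (inner ℝ (flux p m (V z)) ((deriv (powReg σ δ) (u z.1 z.2 ^ κ) * χ z) • V z +
          powReg σ δ (u z.1 z.2 ^ κ) • spaceGrad χ z) -
        (∫ r in (0 : ℝ)..u z.1 z.2, powReg σ δ (|r| ^ κ)) * timeDeriv χ z) * weight g z.2 := by
    filter_upwards [h.ae_nonneg, hM] with z hz0 hzM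
    rw [spaceGrad_prodTest (hψ.differentiable (by simp)),
      timeDeriv_prodTest (hζ.differentiable (by simp))]
    by_cases hzS : z ∈ S
    · rw [indicator_of_mem hzS]
      have ht : a / 4 < z.1 := lt_of_lt_of_le (by linarith) hzS.1.1
      have hu0 : 0 ≤ u z.1 z.2 := hz0 (by linarith)
      have huM : u z.1 z.2 ≤ M := (le_abs_self _).trans (hzM ht)
      have hw0 : 0 ≤ u z.1 z.2 ^ κ := by positivity
      have hW := weight_pos (g := g) z.2
      set x := ‖V z‖
      set y := ‖gradient ψ z.2‖
      set β := powReg σ δ (u z.1 z.2 ^ κ) with hβ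
      have hβ0 : 0 ≤ β := powReg_nonneg hw0
      have hx : 0 ≤ x := norm_nonneg _
      have k1 : inner ℝ (flux p m (V z)) (V z) = c * x ^ p := inner_flux_self hp _
      have k2 : -(c * x ^ (p - 1) * y) ≤ inner ℝ (flux p m (V z)) (gradient ψ z.2) := by
        have := (abs_le.1 (abs_real_inner_le_norm (flux p m (V z)) (gradient ψ z.2))).1
        rwa [norm_flux hp hm] at this
      have k3 := absorb_gradient (D := σ * D z) hp hx (norm_nonneg (gradient ψ z.2)) hβ0
        (mul_pos hσ0 (hD0 z)) (hψ0 z.2) hCψ (hψg z.2)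
      have k4 : β ^ p * (σ * D z) ^ (1 - p) ≤ σ ^ (1 - p) * M ^ e * u z.1 z.2 := by
        refine (powReg_rpow_mul_le hp hσ0 hσ1 hδ hw0).trans ?_
        rw [mul_assoc]
        refine mul_le_mul_of_nonneg_left ?_ (by positivity)
        rw [← Real.rpow_mul hu0, show κ * (p + σ - 1) = e + 1 by rw [he]; ring]
        rcases hu0.eq_or_lt with h0 | h0
        · rw [← h0, Real.zero_rpow (by linarith)]
          simp
        · rw [Real.rpow_add_one h0.ne']
          gcongr
      have k5 : σ * D z ≤ deriv (powReg σ δ) (u z.1 z.2 ^ κ) := le_deriv_powReg hσ1 hδ _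
      have k6 := primitive_powReg_bound (δ := δ) hσ0 hσ1 hκ hu0 huM
      have k7 : (∫ r in (0 : ℝ)..u z.1 z.2, powReg σ δ (|r| ^ κ)) * (deriv ζ z.1 * ψ z.2) ≤
          Z * (M ^ κ) ^ σ * u z.1 z.2 := by
        refine (le_abs_self _).trans ?_
        rw [abs_mul, abs_mul, abs_of_nonneg (hψ0 _)]
        have := hZ z.1
        rw [Real.norm_eq_abs] at this
        calc _ ≤ ((M ^ κ) ^ σ * u z.1 z.2) * (Z * 1) := by
              have := hψ1 z.2
              have := hψ0 z.2
              gcongr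
          _ = _ := by ring
      have hζz := hζ0 z.1
      have hζz1 := hζ1 z.1
      have hxp : 0 ≤ x ^ p := by positivity
      have hψz := hψ0 z.2
      have hχz : χ z = ζ z.1 * ψ z.2 := rfl
      rw [inner_add_right, inner_smul_right, inner_smul_right, inner_smul_right, k1, hχz]
      have k8 : ζ z.1 * (β * (c * x ^ (p - 1) * y)) ≤
          ζ z.1 * (c * (1 / 2 * (σ * D z * ψ z.2 * x ^ p))) +
          c * (2 ^ (p - 1) * Cψ * (σ ^ (1 - p) * M ^ e)) * u z.1 z.2 := by
        have e1 : β * (c * x ^ (p - 1) * y) ≤ c * (1 / 2 * (σ * D z * ψ z.2 * x ^ p)) +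
            c * (2 ^ (p - 1) * Cψ * (σ ^ (1 - p) * M ^ e)) * u z.1 z.2 := by
          have e2 : 2 ^ (p - 1) * Cψ * (β ^ p * (σ * D z) ^ (1 - p)) ≤
              2 ^ (p - 1) * Cψ * (σ ^ (1 - p) * M ^ e * u z.1 z.2) :=
            mul_le_mul_of_nonneg_left k4 (by positivity)
          have e3 := mul_le_mul_of_nonneg_left (k3.trans (add_le_add_right e2 _)) hc0.le
          calc _ = c * (β * x ^ (p - 1) * y) := by ring
            _ ≤ _ := e3
            _ = _ := by ring
        have e4 : ζ z.1 * (c * (2 ^ (p - 1) * Cψ * (σ ^ (1 - p) * M ^ e)) * u z.1 z.2) ≤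
            c * (2 ^ (p - 1) * Cψ * (σ ^ (1 - p) * M ^ e)) * u z.1 z.2 :=
          mul_le_of_le_one_left (by positivity) hζz1
        have e5 := mul_le_mul_of_nonneg_left e1 hζz
        linarith
      have k9 : -(ζ z.1 * (β * (c * x ^ (p - 1) * y))) ≤
          β * (ζ z.1 * inner ℝ (flux p m (V z)) (gradient ψ z.2)) := by
        have := mul_le_mul_of_nonneg_left k2 (mul_nonneg hζz hβ0)
        calc _ = ζ z.1 * β * -(c * x ^ (p - 1) * y) := by ring
          _ ≤ _ := this
          _ = _ := by ring
      have k10 : σ * D z * (ζ z.1 * ψ z.2) * (c * x ^ p) ≤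
          deriv (powReg σ δ) (u z.1 z.2 ^ κ) * (ζ z.1 * ψ z.2) * (c * x ^ p) := by gcongr
      have key : c * σ / 2 * (D z * (ζ z.1 * ψ z.2) * x ^ p) - C1 * u z.1 z.2 ≤
          deriv (powReg σ δ) (u z.1 z.2 ^ κ) * (ζ z.1 * ψ z.2) * (c * x ^ p) +
          β * (ζ z.1 * inner ℝ (flux p m (V z)) (gradient ψ z.2)) -
          (∫ r in (0 : ℝ)..u z.1 z.2, powReg σ δ (|r| ^ κ)) * (deriv ζ z.1 * ψ z.2) := by
        rw [hC1]
        linarith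
      have := mul_le_mul_of_nonneg_right key hW.le
      calc _ = (c * σ / 2 * (D z * (ζ z.1 * ψ z.2) * x ^ p) - C1 * u z.1 z.2) * weight g z.2 := by
            ring
        _ ≤ _ := this
    · have hzt : z.1 ∉ tsupport ζ := fun hc => hzS ⟨hζs hc, mem_univ _⟩
      have e1 : ζ z.1 = 0 := image_eq_zero_of_notMem_tsupport hzt
      have e2 : deriv ζ z.1 = 0 := by
        by_contra hne
        exact hzt (support_deriv_subset hne)
      have e3 : χ z = 0 := by simp [hχdef, prodTest, e1]
      rw [indicator_of_notMem hzS, e1, e2, e3]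
      simp
  have hineq := integral_mono_ae ((hT1.const_mul (c * σ / 2)).sub (hT2.const_mul C1)) hI hpt
  have hsplit : ∫ z, (c * σ / 2 * (D z * χ z * (‖V z‖ ^ p * weight g z.2)) -
      C1 * S.indicator (fun z : ℝ × 𝔼 => u z.1 z.2 * weight g z.2) z) =
      c * σ / 2 * (∫ z, D z * χ z * (‖V z‖ ^ p * weight g z.2)) -
      C1 * ∫ z in S, u z.1 z.2 * weight g z.2 := by
    rw [integral_sub (hT1.const_mul _) (hT2.const_mul _), integral_const_mul, integral_const_mul,
      integral_indicator hSm]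
  have hineq2 := hineq.trans (le_of_eq hI0)
  have hmain : ∫ z, D z * χ z * (‖V z‖ ^ p * weight g z.2) ≤
      (c * σ / 2)⁻¹ * (C1 * ∫ z in S, u z.1 z.2 * weight g z.2) := by
    rw [le_inv_mul_iff₀ hκs]
    have : c * σ / 2 * (∫ z, D z * χ z * (‖V z‖ ^ p * weight g z.2)) -
      C1 * ∫ z in S, u z.1 z.2 * weight g z.2 ≤ 0 := hsplit ▸ hineq2
    linarith
  have hsm : MeasurableSet (Icc a b ×ˢ Metric.closedBall (0 : 𝔼) R) :=
    measurableSet_Icc.prod Metric.isClosed_closedBall.measurableSet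
  have hχ1 : ∀ z ∈ Icc a b ×ˢ Metric.closedBall (0 : 𝔼) R,
      D z * χ z * (‖V z‖ ^ p * weight g z.2) = D z * ‖V z‖ ^ p * weight g z.2 := by
    intro z hz
    have e1 : χ z = 1 := by
      simp only [hχdef, prodTest]
      rw [hζab z.1 hz.1, hψR z.2 (by simpa using hz.2), one_mul]
    rw [e1]
    ring
  refine ⟨hT1.integrableOn.congr_fun hχ1 hsm, ?_⟩
  rw [← setIntegral_congr_fun hsm hχ1]
  refine (setIntegral_le_integral hT1 (ae_of_all _ fun z => ?_)).trans hmain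
  have := (hD0 z).le
  have := weight_pos (g := g) z.2
  have : 0 ≤ χ z := mul_nonneg (hζ0 _) (hψ0 _)
  simp only [Pi.zero_apply]
  positivity

/-- The flux of a strong solution is integrable, uniformly on large balls, although the weighted
measure of these balls is unbounded. -/
theorem flux_bound (hp : 1 < p) (hm : 0 < p + m - 3) (hg : ContinuousOn g (Ici 0))
    (h : IsInClass N p m g u V) (hv : HasWeakTimeDeriv (fun z => u z.1 z.2) v)
    (heq : ∀ η, IsTest η → weakForm p m g u V η = 0) {a b : ℝ} (ha : 0 < a) (hab : a ≤ b) :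
    ∃ C : ℝ, ∀ R : ℝ, 1 ≤ R →
      IntegrableOn (fun z : ℝ × 𝔼 => ‖V z‖ ^ (p - 1) * weight g z.2)
        (Icc a b ×ˢ Metric.closedBall 0 R) ∧
      ∫ z in Icc a b ×ˢ Metric.closedBall 0 R, ‖V z‖ ^ (p - 1) * weight g z.2 ≤ C := by
  set κ := gradExponent p m with hκdef
  have hκ : 0 < κ := gradExponent_pos hp hm
  set k := p + m - 3 with hk
  -- This choice gives `κ e = 1` for `e = (1 - σ)(p - 1)`, so the lower order term `(u^κ)^e` of
  -- Young's inequality is exactly `u`.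
  set σ := k / (k + 1) with hσ
  have hσ0 : 0 < σ := by positivity
  have hσ1 : σ ≤ 1 := (div_le_one (by linarith)).2 (by linarith)
  set e := (1 - σ) * (p - 1) with he
  have heκ : κ * e = 1 := by
    have e1 : 1 - σ = 1 / (k + 1) := by
      rw [hσ]
      field_simp
      ring
    have h1 : k + 1 ≠ 0 := by linarith
    have h2 : p - 1 ≠ 0 := by linarith
    rw [he, e1, hκdef, gradExponent, show p + m - 2 = k + 1 by rw [hk]; ring]
    field_simp
  have he0 : 0 < e := by
    by_contra hneg
    nlinarith
  obtain ⟨C, hC⟩ := energy_bound hp hm hg h hv heq hσ0 hσ1 ha hab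
  have hstrip := h.integrableOn_strip hg (a := a) (b := b) ha
  refine ⟨C + (2 : ℝ) ^ e * ((∫ z in Icc a b ×ˢ univ, u z.1 z.2 * weight g z.2) + 1),
    fun R hR => ?_⟩
  set K : Set (ℝ × 𝔼) := Icc a b ×ˢ Metric.closedBall 0 R with hKdef
  have hK : IsCompact K := isCompact_Icc.prod (isCompact_closedBall 0 R)
  have hKS : K ⊆ halfSpace N := fun z hz => lt_of_lt_of_le ha hz.1.1
  have hwc : Continuous fun z : ℝ × 𝔼 => weight g z.2 := (continuous_weight hg).comp continuous_snd
  have hWi : IntegrableOn (fun z : ℝ × 𝔼 => weight g z.2) K := hwc.continuousOn.integrableOn_compact hK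
  set W := ∫ z in K, weight g z.2 with hW
  have hW0 : 0 ≤ W := setIntegral_nonneg hK.measurableSet fun z _ => (weight_pos z.2).le
  -- Here `δ` may depend on `R`, the energy estimate being uniform in `δ`. However large the
  -- weighted measure `W` of the cylinder is, the error `δ^e W` stays below `1`.
  obtain ⟨δ, hδ, hδW⟩ : ∃ δ : ℝ, 0 < δ ∧ δ ^ e * W ≤ 1 := by
    refine ⟨(W + 1)⁻¹ ^ e⁻¹, by positivity, ?_⟩
    rw [← Real.rpow_mul (by positivity), inv_mul_cancel₀ he0.ne', Real.rpow_one]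
    rw [inv_mul_le_one₀ (by positivity)]
    linarith
  obtain ⟨i1, hi1⟩ := hC δ hδ R hR
  have huK : IntegrableOn (fun z : ℝ × 𝔼 => u z.1 z.2 * weight g z.2) K :=
    hstrip.mono_set (prod_mono le_rfl (subset_univ _))
  have hpt : ∀ᵐ z : ℝ × 𝔼, z ∈ K → ‖V z‖ ^ (p - 1) * weight g z.2 ≤
      (((u z.1 z.2 ^ κ) ^ 2 + δ ^ 2) ^ ((σ - 1) / 2) * ‖V z‖ ^ p) * weight g z.2 +
      (2 : ℝ) ^ e * (u z.1 z.2 * weight g z.2 + δ ^ e * weight g z.2) := by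
    filter_upwards [h.ae_nonneg] with z hz hzK
    have hu0 : 0 ≤ u z.1 z.2 := hz (hKS hzK)
    have hw0 : 0 ≤ u z.1 z.2 ^ κ := by positivity
    set w := u z.1 z.2 ^ κ
    have hA := sq_add_sq_pos hδ w
    set A := w ^ 2 + δ ^ 2
    have hx : 0 ≤ ‖V z‖ := norm_nonneg _
    set x := ‖V z‖
    have hWz := weight_pos (g := g) z.2
    have hAe : A ^ ((1 - σ) / 2 * (p - 1)) ≤ (2 : ℝ) ^ e * (u z.1 z.2 + δ ^ e) := by
      have h1 : A ≤ (2 * max w δ) ^ 2 := by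
        have h2 := le_max_left w δ
        have h3 := le_max_right w δ
        have : w ^ 2 ≤ max w δ ^ 2 := pow_le_pow_left₀ hw0 h2 2
        have : δ ^ 2 ≤ max w δ ^ 2 := pow_le_pow_left₀ hδ.le h3 2
        nlinarith
      have hmax : 0 < max w δ := lt_max_of_lt_right hδ
      calc A ^ ((1 - σ) / 2 * (p - 1)) ≤ ((2 * max w δ) ^ 2) ^ ((1 - σ) / 2 * (p - 1)) :=
            Real.rpow_le_rpow hA.le h1 (by nlinarith)
        _ = (2 * max w δ) ^ e := by
            rw [← Real.rpow_natCast, ← Real.rpow_mul (by positivity), he]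
            congr 1
            push_cast
            ring
        _ = 2 ^ e * max w δ ^ e := Real.mul_rpow (by norm_num) hmax.le
        _ ≤ 2 ^ e * (u z.1 z.2 + δ ^ e) := by
            gcongr
            have hwe : w ^ e = u z.1 z.2 := by rw [← Real.rpow_mul hu0, heκ, Real.rpow_one]
            have hδe : 0 ≤ δ ^ e := by positivity
            rcases max_cases w δ with hmx | hmx <;> rw [hmx.1] <;> linarith
    -- If `A^((σ-1)/2) x ≥ 1`, one more factor `x` is paid by the first term; otherwise `x` itself
    -- is at most `A^((1-σ)/2)`.
    have hyoung : x ^ (p - 1) ≤ A ^ ((σ - 1) / 2) * x ^ p + A ^ ((1 - σ) / 2 * (p - 1)) := by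
      have hA1 : 0 < A ^ ((σ - 1) / 2) := Real.rpow_pos_of_pos hA _
      rcases le_or_gt 1 (A ^ ((σ - 1) / 2) * x) with h1 | h1
      · have : x ^ (p - 1) ≤ A ^ ((σ - 1) / 2) * x ^ p := by
          rw [← rpow_sub_one_mul_self hx hp]
          have := mul_le_mul_of_nonneg_right h1 (Real.rpow_nonneg hx (p - 1))
          linarith
        have : 0 ≤ A ^ ((1 - σ) / 2 * (p - 1)) := by positivity
        linarith
      · have h2 : x ≤ A ^ ((1 - σ) / 2) := by
          have h3 : A ^ ((1 - σ) / 2) = (A ^ ((σ - 1) / 2))⁻¹ := by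
            rw [← Real.rpow_neg hA.le]
            congr 1
            ring
          rw [h3, ← one_div, le_div_iff₀ hA1]
          linarith
        have h4 : x ^ (p - 1) ≤ A ^ ((1 - σ) / 2 * (p - 1)) := by
          rw [Real.rpow_mul hA.le]
          exact Real.rpow_le_rpow hx h2 (by linarith)
        have : 0 ≤ A ^ ((σ - 1) / 2) * x ^ p := by positivity
        linarith
    calc x ^ (p - 1) * weight g z.2
        ≤ (A ^ ((σ - 1) / 2) * x ^ p + (2 : ℝ) ^ e * (u z.1 z.2 + δ ^ e)) * weight g z.2 := by
          gcongr
          exact hyoung.trans (by linarith)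
      _ = _ := by ring
  have i2 : IntegrableOn (fun z : ℝ × 𝔼 => (2 : ℝ) ^ e * (u z.1 z.2 * weight g z.2 +
      δ ^ e * weight g z.2)) K := (huK.add (hWi.const_mul _)).const_mul _
  have hVm : AEStronglyMeasurable (fun z => ‖V z‖ ^ (p - 1) * weight g z.2) (volume.restrict K) :=
    ((h.gradLp K hK hKS).1.norm.aemeasurable.pow_const _).aestronglyMeasurable.mul
      hwc.aestronglyMeasurable
  have hptK := (ae_restrict_iff' hK.measurableSet).2 hpt
  have i3 : IntegrableOn (fun z : ℝ × 𝔼 => ‖V z‖ ^ (p - 1) * weight g z.2) K := by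
    refine (i1.add i2).mono' hVm ?_
    filter_upwards [hptK] with z hz
    rw [Real.norm_of_nonneg (mul_nonneg (by positivity) (weight_pos z.2).le)]
    exact hz
  refine ⟨i3, (integral_mono_ae i3 (i1.add i2) hptK).trans ?_⟩
  have hsplit : ∫ z in K, ((((u z.1 z.2 ^ κ) ^ 2 + δ ^ 2) ^ ((σ - 1) / 2) * ‖V z‖ ^ p) *
      weight g z.2 + (2 : ℝ) ^ e * (u z.1 z.2 * weight g z.2 + δ ^ e * weight g z.2)) =
      (∫ z in K, (((u z.1 z.2 ^ κ) ^ 2 + δ ^ 2) ^ ((σ - 1) / 2) * ‖V z‖ ^ p) * weight g z.2) +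
      (2 : ℝ) ^ e * ((∫ z in K, u z.1 z.2 * weight g z.2) + δ ^ e * W) := by
    rw [integral_add i1 i2, integral_const_mul, integral_add huK (hWi.const_mul _),
      integral_const_mul]
  refine (le_of_eq hsplit).trans ?_
  have huS : ∫ z in K, u z.1 z.2 * weight g z.2 ≤
      ∫ z in Icc a b ×ˢ univ, u z.1 z.2 * weight g z.2 := by
    refine setIntegral_mono_set hstrip ?_ (LE.le.eventuallyLE
      (prod_mono le_rfl (subset_univ _)))
    refine (ae_restrict_iff' (measurableSet_Icc.prod MeasurableSet.univ)).2 ?_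
    filter_upwards [h.ae_nonneg] with z hz hzS
    exact mul_nonneg (hz (ha.trans_le hzS.1.1)) (weight_pos z.2).le
  gcongr

end Energy

/-! ### Weakly nonincreasing functions starting from zero. -/

section WeakDecrease

/-- A nonnegative continuous function on `[0, ∞)` that vanishes at `0` and is nonincreasing in the
weak sense vanishes identically. -/
theorem eq_zero_of_weak_antitone {Y : ℝ → ℝ} (hY : Continuous Y) (hY0 : ∀ t, 0 ≤ Y t)
    (hzero : Y 0 = 0)
    (hw : ∀ ζ : ℝ → ℝ, ContDiff ℝ (⊤ : ℕ∞) ζ → (∀ t, 0 ≤ ζ t) →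
      ∀ a b, 0 < a → tsupport ζ ⊆ Icc a b → 0 ≤ ∫ t, deriv ζ t * Y t) {t₀ : ℝ} (ht₀ : 0 < t₀) :
    Y t₀ = 0 := by
  obtain ⟨φ, hφo⟩ : ∃ φ : ContDiffBump t₀, φ.rOut = t₀ / 2 :=
    ⟨⟨t₀ / 4, t₀ / 2, by linarith, by linarith⟩, rfl⟩
  set f : ℝ → ℝ := φ.normed volume with hf
  have hfc : Continuous f := φ.continuous_normed
  have hf0 : ∀ t, 0 ≤ f t := φ.nonneg_normed
  have hfs : ∀ t, t ∉ Ioo (t₀ / 2) (3 * t₀ / 2) → f t = 0 := by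
    intro t ht
    rw [← Function.notMem_support, φ.support_normed_eq, hφo, Real.ball_eq_Ioo]
    intro h
    exact ht ⟨by linarith [h.1], by linarith [h.2]⟩
  have hfi : Integrable f := φ.continuous_normed.integrable_of_hasCompactSupport
    φ.hasCompactSupport_normed
  have hfYc : Continuous fun t => f t * Y t := hfc.mul hY
  have hfYs : HasCompactSupport fun t => f t * Y t := φ.hasCompactSupport_normed.mul_right
  have hfYi : Integrable fun t => f t * Y t := hfYc.integrable_of_hasCompactSupport hfYs
  have hle : ∀ ε : ℝ, 0 < ε → ∫ t, f t * Y t ≤ ε := by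
    intro ε hε
    obtain ⟨δ, hδ, hδε⟩ := Metric.continuousAt_iff.1 (hY.continuousAt (x := 0)) ε hε
    -- The interval `(s, 3s)` that will carry `r` lies within `δ` of the origin, where `Y < ε`, and
    -- to the left of the support of `f`.
    set s := min (δ / 4) (t₀ / 8) with hs
    have hs0 : 0 < s := by positivity
    have hsδ : s ≤ δ / 4 := min_le_left _ _
    have hst : s ≤ t₀ / 8 := min_le_right _ _
    obtain ⟨ψ, hψo⟩ : ∃ ψ : ContDiffBump (2 * s), ψ.rOut = s :=
      ⟨⟨s / 2, s, by linarith, by linarith⟩, rfl⟩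
    set r : ℝ → ℝ := ψ.normed volume with hr
    have hrc : Continuous r := ψ.continuous_normed
    have hr0 : ∀ t, 0 ≤ r t := ψ.nonneg_normed
    have hrs : ∀ t, t ∉ Ioo s (3 * s) → r t = 0 := by
      intro t ht
      rw [← Function.notMem_support, ψ.support_normed_eq, hψo, Real.ball_eq_Ioo]
      intro h
      exact ht ⟨by linarith [h.1], by linarith [h.2]⟩
    have hri : Integrable r := ψ.continuous_normed.integrable_of_hasCompactSupport
      ψ.hasCompactSupport_normed
    -- This test function rises from `0` to `1` near the origin and descends near `t₀`, so it is
    -- nonnegative with compact support. The hypothesis becomes `∫ f Y ≤ ∫ r Y ≤ ε`.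
    set ζ : ℝ → ℝ := fun t => ∫ x in (0 : ℝ)..t, (r x - f x) with hζ
    have hd : ∀ t, HasDerivAt ζ (r t - f t) t := fun t =>
      ((hrc.sub hfc).integral_hasStrictDerivAt 0 t).hasDerivAt
    have hder : deriv ζ = fun t => r t - f t := funext fun t => (hd t).deriv
    have hsm : ContDiff ℝ (⊤ : ℕ∞) ζ := by
      rw [show (((⊤ : ℕ∞) : WithTop ℕ∞)) = ((⊤ : ℕ∞) : WithTop ℕ∞) from rfl, contDiff_infty_iff_deriv]
      refine ⟨fun t => (hd t).differentiableAt, ?_⟩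
      rw [hder]
      exact ψ.contDiff_normed.sub φ.contDiff_normed
    have hfull : ∀ (q : ℝ → ℝ) (c d t : ℝ), 0 ≤ c → Continuous q → (∀ x, x ∉ Ioo c d → q x = 0) →
        d ≤ t → 0 ≤ t → ∫ x in (0 : ℝ)..t, q x = ∫ x, q x := by
      intro q c d t hc hq hqs hdt ht
      rw [intervalIntegral.integral_of_le ht]
      refine setIntegral_eq_integral_of_forall_compl_eq_zero fun x hx => hqs x fun hx' => hx ?_
      exact ⟨hc.trans_lt hx'.1, hx'.2.le.trans hdt⟩
    have hsplit : ∀ t, ζ t = (∫ x in (0 : ℝ)..t, r x) - ∫ x in (0 : ℝ)..t, f x := fun t =>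
      intervalIntegral.integral_sub (hrc.intervalIntegrable _ _) (hfc.intervalIntegrable _ _)
    have hmon : ∀ (q : ℝ → ℝ) (t : ℝ), 0 ≤ t → (∀ x, 0 ≤ q x) → Integrable q →
        ∫ x in (0 : ℝ)..t, q x ≤ ∫ x, q x := by
      intro q t ht h0 hi
      rw [intervalIntegral.integral_of_le ht]
      exact setIntegral_le_integral hi (ae_of_all _ h0)
    have hleft : ∀ t, t ≤ s → ζ t = 0 := by
      intro t ht
      refine intervalIntegral.integral_zero_ae (ae_of_all _ fun x hx => ?_)
      have hxs : x ≤ s := by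
        rcases le_total 0 t with h | h
        · rw [uIoc_of_le h] at hx
          exact hx.2.trans ht
        · rw [uIoc_of_ge h] at hx
          exact hx.2.trans hs0.le
      rw [hrs x fun h => absurd h.1 (not_lt.2 hxs),
        hfs x fun h => absurd h.1 (not_lt.2 (by linarith)), sub_zero]
    have hright : ∀ t, 3 * t₀ / 2 ≤ t → ζ t = 0 := by
      intro t ht
      rw [hsplit, hfull r s (3 * s) t hs0.le hrc hrs (by linarith) (by linarith),
        hfull f (t₀ / 2) (3 * t₀ / 2) t (by linarith) hfc hfs ht (by linarith), hr, hf,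
        ψ.integral_normed, φ.integral_normed, sub_self]
    have hnn : ∀ t, 0 ≤ ζ t := by
      intro t
      rcases le_total t s with h | h
      · rw [hleft t h]
      · have ht0 : 0 ≤ t := hs0.le.trans h
        rw [hsplit]
        rcases le_total t (t₀ / 2) with h2 | h2
        · have : ∫ x in (0 : ℝ)..t, f x = 0 := by
            refine intervalIntegral.integral_zero_ae (ae_of_all _ fun x hx => hfs x fun h3 => ?_)
            rw [uIoc_of_le ht0] at hx
            linarith [hx.2, h3.1]
          rw [this, sub_zero]
          exact intervalIntegral.integral_nonneg ht0 fun x _ => hr0 x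
        · rw [hfull r s (3 * s) t hs0.le hrc hrs (by linarith) ht0, hr, ψ.integral_normed]
          have := hmon f t ht0 hf0 hfi
          rw [hf, φ.integral_normed] at this
          rw [hf]
          linarith
    have hsupp : tsupport ζ ⊆ Icc s (3 * t₀ / 2) := by
      refine closure_minimal (fun t ht => ⟨?_, ?_⟩) isClosed_Icc
      · by_contra h
        exact ht (hleft t (not_le.1 h).le)
      · by_contra h
        exact ht (hright t (not_le.1 h).le)
    have hmain := hw ζ hsm hnn s _ hs0 hsupp
    have hrYc : Continuous fun t => r t * Y t := hrc.mul hY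
    have hrYs : HasCompactSupport fun t => r t * Y t := ψ.hasCompactSupport_normed.mul_right
    have hrYi : Integrable fun t => r t * Y t := hrYc.integrable_of_hasCompactSupport hrYs
    have h1 : ∫ t, deriv ζ t * Y t = (∫ t, r t * Y t) - ∫ t, f t * Y t := by
      rw [← integral_sub hrYi hfYi, hder]
      simp only [sub_mul]
    have h2 : ∫ t, r t * Y t ≤ ε := by
      calc ∫ t, r t * Y t ≤ ∫ t, r t * ε := by
            refine integral_mono hrYi (hri.mul_const ε) fun t => ?_
            by_cases ht : t ∈ Ioo s (3 * s)
            · have : dist (Y t) (Y 0) < ε := hδε (by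
                rw [Real.dist_eq, sub_zero, abs_of_pos (hs0.trans ht.1)]
                linarith [ht.2])
              rw [hzero, Real.dist_eq, sub_zero] at this
              exact mul_le_mul_of_nonneg_left ((le_abs_self _).trans this.le) (hr0 t)
            · simp [hrs t ht]
        _ = ε := by rw [integral_mul_const, hr, ψ.integral_normed, one_mul]
    linarith
  have hz : ∫ t, f t * Y t = 0 := le_antisymm (le_of_forall_pos_le_add fun ε hε => by
    simpa using hle ε hε) (integral_nonneg fun t => mul_nonneg (hf0 t) (hY0 t))
  have h3 := (hfYc.integral_pos_of_hasCompactSupport_nonneg_nonzero hfYs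
    (fun t => mul_nonneg (hf0 t) (hY0 t)) (x := t₀)).mt (by rw [hz]; simp)
  have h4 : f t₀ * Y t₀ = 0 := by
    by_contra h
    exact h3 h
  have h5 : f t₀ ≠ 0 := by
    have : t₀ ∈ Function.support f := by
      rw [hf, φ.support_normed_eq]
      exact Metric.mem_ball_self φ.rOut_pos
    exact this
  exact (mul_eq_zero.1 h4).resolve_left h5

end WeakDecrease

/-! ### The localized comparison inequality. -/

section Comparison

variable {N : ℕ} {p m : ℝ} {g : ℝ → ℝ}

local notation "𝔼" => EuclideanSpace ℝ (Fin N)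

theorem HasWeakTimeDeriv.sub {y₁ y₂ v₁ v₂ : ℝ × 𝔼 → ℝ} (h₁ : HasWeakTimeDeriv y₁ v₁)
    (h₂ : HasWeakTimeDeriv y₂ v₂) : HasWeakTimeDeriv (fun z => y₁ z - y₂ z) fun z => v₁ z - v₂ z := by
  have hi : ∀ {k c : ℝ × 𝔼 → ℝ} {η : ℝ × 𝔼 → ℝ}, LocallyIntegrableOn k (halfSpace N) →
      IsTest η → Continuous c → (∀ z ∉ tsupport η, c z = 0) → Integrable fun z => k z * c z := by
    intro k c η hk hη hc h0
    refine (integrableOn_iff_integrable_of_support_subset (s := tsupport η) fun z hz => ?_).1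
      ((hk.integrableOn_compact_subset hη.support hη.compact).mul_continuousOn hc.continuousOn
        hη.compact)
    by_contra hzK
    exact hz (by simp [h0 z hzK])
  refine ⟨h₁.1.sub h₂.1, h₁.2.1.sub h₂.2.1, fun η hη => ?_⟩
  have t0 : ∀ z ∉ tsupport η, timeDeriv η z = 0 := fun z hz => timeDeriv_eq_zero_of_notMem hz
  have e0 : ∀ z ∉ tsupport η, η z = 0 := fun z hz => image_eq_zero_of_notMem_tsupport hz
  have a1 := hi h₁.1 hη hη.continuous_timeDeriv t0
  have a2 := hi h₂.1 hη hη.continuous_timeDeriv t0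
  have b1 := hi h₁.2.1 hη hη.smooth.continuous e0
  have b2 := hi h₂.2.1 hη hη.smooth.continuous e0
  have c1 := h₁.2.2 η hη
  have c2 := h₂.2.2 η hη
  simp only [mul_comm (η _)] at c1 c2 ⊢
  simp only [sub_mul]
  rw [integral_sub a1 a2, integral_sub b1 b2, c1, c2]
  ring

theorem HasWeakSpaceGrad.sub {w₁ w₂ : ℝ × 𝔼 → ℝ} {V₁ V₂ : ℝ × 𝔼 → 𝔼}
    (h₁ : HasWeakSpaceGrad w₁ V₁) (h₂ : HasWeakSpaceGrad w₂ V₂) :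
    HasWeakSpaceGrad (fun z => w₁ z - w₂ z) fun z => V₁ z - V₂ z := by
  have hi : ∀ {F : Type} [NormedAddCommGroup F] [NormedSpace ℝ F] {c : ℝ × 𝔼 → ℝ}
      {k : ℝ × 𝔼 → F} {η : ℝ × 𝔼 → ℝ}, LocallyIntegrableOn k (halfSpace N) →
      IsTest η → Continuous c → (∀ z ∉ tsupport η, c z = 0) → Integrable fun z => c z • k z := by
    intro F _ _ c k η hk hη hc h0
    refine (integrableOn_iff_integrable_of_support_subset (s := tsupport η) fun z hz => ?_).1
      ((hk.integrableOn_compact_subset hη.support hη.compact).continuousOn_smul hc.continuousOn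
        hη.compact)
    by_contra hzK
    exact hz (by simp [h0 z hzK])
  have hj : ∀ {k : ℝ × 𝔼 → ℝ} {η : ℝ × 𝔼 → ℝ}, LocallyIntegrableOn k (halfSpace N) →
      IsTest η → Integrable fun z => k z • spaceGrad η z := by
    intro k η hk hη
    refine (integrableOn_iff_integrable_of_support_subset (s := tsupport η) fun z hz => ?_).1
      ((hk.integrableOn_compact_subset hη.support hη.compact).smul_continuousOn
        hη.continuous_spaceGrad.continuousOn hη.compact)
    by_contra hzK
    exact hz (by simp [spaceGrad_eq_zero_of_notMem hzK])
  refine ⟨h₁.1.sub h₂.1, h₁.2.1.sub h₂.2.1, fun η hη => ?_⟩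
  have e0 : ∀ z ∉ tsupport η, η z = 0 := fun z hz => image_eq_zero_of_notMem_tsupport hz
  simp only [sub_smul, smul_sub]
  rw [integral_sub (hj h₁.1 hη) (hj h₂.1 hη),
    integral_sub (hi h₁.2.1 hη hη.smooth.continuous e0) (hi h₂.2.1 hη hη.smooth.continuous e0),
    h₁.2.2 η hη, h₂.2.2 η hη]
  abel

theorem LocBdd.sub {w₁ w₂ : ℝ × 𝔼 → ℝ} (h₁ : LocBdd w₁) (h₂ : LocBdd w₂) :
    LocBdd fun z => w₁ z - w₂ z := by
  intro K hK hKS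
  obtain ⟨C₁, hC₁⟩ := h₁ K hK hKS
  obtain ⟨C₂, hC₂⟩ := h₂ K hK hKS
  refine ⟨C₁ + C₂, ?_⟩
  filter_upwards [hC₁, hC₂] with z h1 h2 hz
  exact (abs_sub _ _).trans (add_le_add (h1 hz) (h2 hz))

theorem LocLp.sub {F : Type*} [NormedAddCommGroup F] {q : ENNReal} {V₁ V₂ : ℝ × 𝔼 → F}
    (h₁ : LocLp q V₁) (h₂ : LocLp q V₂) : LocLp q fun z => V₁ z - V₂ z :=
  fun K hK hKS => (h₁ K hK hKS).sub (h₂ K hK hKS)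

/-- Smooth approximations of the Heaviside function. -/
def heaviside (n : ℕ) (s : ℝ) : ℝ := Real.smoothTransition ((n + 1) * s)

theorem contDiff_heaviside (n : ℕ) : ContDiff ℝ (⊤ : ℕ∞) (heaviside n) :=
  Real.smoothTransition.contDiff.comp (contDiff_const.mul contDiff_id)

theorem heaviside_nonneg (n : ℕ) (s : ℝ) : 0 ≤ heaviside n s := Real.smoothTransition.nonneg _

theorem heaviside_le_one (n : ℕ) (s : ℝ) : heaviside n s ≤ 1 := Real.smoothTransition.le_one _

theorem heaviside_of_nonpos (n : ℕ) {s : ℝ} (hs : s ≤ 0) : heaviside n s = 0 :=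
  Real.smoothTransition.zero_of_nonpos (mul_nonpos_of_nonneg_of_nonpos (by positivity) hs)

theorem deriv_heaviside_nonneg (n : ℕ) (s : ℝ) : 0 ≤ deriv (heaviside n) s :=
  Monotone.deriv_nonneg (Real.smoothTransition.monotone.comp
    (monotone_id.const_mul (by positivity : (0 : ℝ) ≤ n + 1)))

theorem tendsto_heaviside (s : ℝ) :
    Tendsto (fun n => heaviside n s) atTop (𝓝 (if 0 < s then 1 else 0)) := by
  split_ifs with hs
  · refine tendsto_const_nhds.congr' ?_
    obtain ⟨n₀, hn₀⟩ := exists_nat_one_div_lt hs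
    filter_upwards [eventually_ge_atTop n₀] with n hn
    refine (Real.smoothTransition.one_of_one_le ?_).symm
    rw [div_lt_iff₀ (by positivity)] at hn₀
    have : (n₀ : ℝ) ≤ n := by exact_mod_cast hn
    nlinarith
  · exact tendsto_const_nhds.congr fun n => (heaviside_of_nonpos n (not_lt.1 hs)).symm

theorem abs_primitive_heaviside_le (n : ℕ) (s : ℝ) : |∫ r in (0 : ℝ)..s, heaviside n r| ≤ |s| := by
  have := intervalIntegral.norm_integral_le_of_norm_le_const (a := 0) (b := s) (C := 1)
    (f := heaviside n) fun r _ => by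
      rw [Real.norm_of_nonneg (heaviside_nonneg n r)]
      exact heaviside_le_one n r
  simpa using this

theorem tendsto_primitive_heaviside (s : ℝ) :
    Tendsto (fun n => ∫ r in (0 : ℝ)..s, heaviside n r) atTop (𝓝 (max s 0)) := by
  rcases le_or_gt s 0 with hs | hs
  · rw [max_eq_right hs]
    refine tendsto_const_nhds.congr fun n => (intervalIntegral.integral_zero_ae
      (ae_of_all _ fun r hr => ?_)).symm
    rw [uIoc_of_ge hs] at hr
    exact heaviside_of_nonpos n hr.2
  · rw [max_eq_left hs.le]
    have h1 : Tendsto (fun n => ∫ r in (0 : ℝ)..s, heaviside n r) atTop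
        (𝓝 (∫ _ in (0 : ℝ)..s, (1 : ℝ))) := by
      refine intervalIntegral.tendsto_integral_filter_of_dominated_convergence (fun _ => 1)
        (Eventually.of_forall fun n => (contDiff_heaviside n).continuous.aestronglyMeasurable)
        (Eventually.of_forall fun n => ae_of_all _ fun r _ => ?_)
        intervalIntegrable_const (ae_of_all _ fun r hr => ?_)
      · rw [Real.norm_of_nonneg (heaviside_nonneg n r)]
        exact heaviside_le_one n r
      · rw [uIoc_of_le hs.le] at hr
        have := tendsto_heaviside r
        rwa [if_pos hr.1] at this
    simpa using h1

variable {u₁ u₂ : ℝ → EuclideanSpace ℝ (Fin N) → ℝ}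
  {V₁ V₂ : ℝ × EuclideanSpace ℝ (Fin N) → EuclideanSpace ℝ (Fin N)}
  {v₁ v₂ : ℝ × EuclideanSpace ℝ (Fin N) → ℝ}

theorem weakForm_sub (hp : 1 < p) (hm : 0 < p + m - 3) (hg : ContinuousOn g (Ici 0))
    (h₁ : IsInClass N p m g u₁ V₁) (hv₁ : HasWeakTimeDeriv (fun z => u₁ z.1 z.2) v₁)
    (h₂ : IsInClass N p m g u₂ V₂) (hv₂ : HasWeakTimeDeriv (fun z => u₂ z.1 z.2) v₂)
    {η : ℝ × 𝔼 → ℝ} (hη : IsTest η) :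
    ∫ z, ((v₂ z - v₁ z) * η z +
      inner ℝ (flux p m (V₂ z) - flux p m (V₁ z)) (spaceGrad η z)) * weight g z.2 =
      weakForm p m g u₂ V₂ η - weakForm p m g u₁ V₁ η := by
  -- Only the integrability statement is used, with `b = 1`: it allows the two integrals to be
  -- subtracted.
  obtain ⟨η', hη', hη0', hlim⟩ := exists_test_approx h₁.weakGrad (h₁.locBdd_rpow hp hm) hp h₁.gradLp
    (contDiff_const (c := (1 : ℝ))) hη
  have i1 := (hlim v₁ _ hv₁.locLp (LocLp.flux hp hm h₁.gradLp) (weight g)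
    (continuous_weight hg)).1
  have i2 := (hlim v₂ _ hv₂.locLp (LocLp.flux hp hm h₂.gradLp) (weight g)
    (continuous_weight hg)).1
  simp only [one_mul, deriv_const, zero_mul, zero_smul, zero_add, one_smul] at i1 i2
  rw [weakForm_eq hg h₁ hv₁ hη, weakForm_eq hg h₂ hv₂ hη, ← integral_sub i2 i1]
  refine integral_congr_ae (ae_of_all _ fun z => ?_)
  simp only [inner_sub_left]
  ring

/-- The difference of the relations is tested with `heaviside n (u₁^κ - u₂^κ) χ`. Monotonicity of
the flux discards the term containing the derivative of `heaviside n`. Letting `n → ∞` leaves `∫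
1_{u₁ > u₂} χ (u₁ - u₂)_t f` bounded by the cutoff term, and the left side is an integral of the
time derivative of `(u₁ - u₂)_+`. -/
theorem comparison_test (hp : 1 < p) (hm : 0 < p + m - 3) (hg : ContinuousOn g (Ici 0))
    (h₁ : IsInClass N p m g u₁ V₁) (hv₁ : HasWeakTimeDeriv (fun z => u₁ z.1 z.2) v₁)
    (heq : ∀ η, IsTest η → weakForm p m g u₁ V₁ η = 0)
    (h₂ : IsInClass N p m g u₂ V₂) (hv₂ : HasWeakTimeDeriv (fun z => u₂ z.1 z.2) v₂)
    (hge : ∀ η, IsTest η → (∀ z, 0 ≤ η z) → 0 ≤ weakForm p m g u₂ V₂ η)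
    {χ : ℝ × 𝔼 → ℝ} (hχ : IsTest χ) (hχ0 : ∀ z, 0 ≤ χ z) :
    0 ≤ (∫ z, max (u₁ z.1 z.2 - u₂ z.1 z.2) 0 * (timeDeriv χ z * weight g z.2)) +
      ∫ z, ‖spaceGrad χ z‖ * (‖flux p m (V₁ z) - flux p m (V₂ z)‖ * weight g z.2) := by
  have hκ := gradExponent_pos hp hm
  set κ := gradExponent p m with hκdef
  set K := tsupport χ
  have hK : IsCompact K := hχ.compact
  have hKS : K ⊆ halfSpace N := hχ.support
  have hwc : Continuous fun z : ℝ × 𝔼 => weight g z.2 := (continuous_weight hg).comp continuous_snd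
  have hχK : ∀ z ∉ K, χ z = 0 := fun z hz => image_eq_zero_of_notMem_tsupport hz
  have hF1 := LocLp.flux hp hm h₁.gradLp
  have hF2 := LocLp.flux hp hm h₂.gradLp
  set W : ℝ × 𝔼 → ℝ := fun z => u₁ z.1 z.2 ^ κ - u₂ z.1 z.2 ^ κ with hW
  have hWm : AEStronglyMeasurable W (volume.restrict K) :=
    ((h₁.weakGrad.1.sub h₂.weakGrad.1).integrableOn_compact_subset hKS hK).1
  have hbW := (h₁.locBdd_rpow hp hm).sub (h₂.locBdd_rpow hp hm)
  -- the boundary term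
  have hQ : Integrable fun z => ‖spaceGrad χ z‖ *
      (‖flux p m (V₁ z) - flux p m (V₂ z)‖ * weight g z.2) := by
    obtain ⟨C, hC⟩ := hK.exists_bound_of_continuousOn hχ.continuous_spaceGrad.norm.continuousOn
    refine integrable_of_bdd_mul hK hχ.continuous_spaceGrad.norm.aestronglyMeasurable
      (ae_of_all _ hC) ?_ fun z hz => by rw [spaceGrad_eq_zero_of_notMem hz, norm_zero]
    have hpq : p.HolderConjugate (p / (p - 1)) := Real.HolderConjugate.conjExponent hp
    have hfin : IsFiniteMeasure ((volume : Measure (ℝ × 𝔼)).restrict K) :=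
      ⟨by rw [Measure.restrict_apply_univ]; exact hK.measure_lt_top⟩
    have := ((hF1.sub hF2) K hK hKS).integrable (by simpa using hpq.symm.lt.le)
    exact IntegrableOn.mul_continuousOn this.norm hwc.continuousOn hK
  set Q := ∫ z, ‖spaceGrad χ z‖ * (‖flux p m (V₁ z) - flux p m (V₂ z)‖ * weight g z.2)
  set k : ℝ × 𝔼 → ℝ := fun z => χ z * ((v₁ z - v₂ z) * weight g z.2) with hk
  have hki : Integrable k := by
    obtain ⟨C, hC⟩ := hK.exists_bound_of_continuousOn hχ.smooth.continuous.continuousOn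
    refine integrable_of_bdd_mul hK hχ.smooth.continuous.aestronglyMeasurable
      (ae_of_all _ hC) ?_ hχK
    exact IntegrableOn.mul_continuousOn (memLp_one_iff_integrable.1
      ((hv₁.locLp.sub hv₂.locLp) K hK hKS)) hwc.continuousOn hK
  have hkK : ∀ z ∉ K, k z = 0 := fun z hz => by simp [hk, hχK z hz]
  have hbk : ∀ (b : ℝ → ℝ) (w : ℝ × 𝔼 → ℝ), Measurable b → (∀ s, |b s| ≤ 1) →
      AEStronglyMeasurable w (volume.restrict K) → Integrable fun z => b (w z) * k z := by
    intro b w hb hb1 hw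
    refine (integrableOn_iff_integrable_of_support_subset (s := K) fun z hz => ?_).1
      (Integrable.bdd_mul (c := 1) hki.integrableOn
        (hb.comp_aemeasurable hw.aemeasurable).aestronglyMeasurable (ae_of_all _ fun z => hb1 _))
    by_contra hzK
    exact hz (by simp [hkK z hzK])
  have habs : ∀ n s, |heaviside n s| ≤ 1 := fun n s => by
    rw [abs_of_nonneg (heaviside_nonneg n s)]
    exact heaviside_le_one n s
  have hlimk : ∀ w : ℝ × 𝔼 → ℝ, AEStronglyMeasurable w (volume.restrict K) →
      Tendsto (fun n => ∫ z, heaviside n (w z) * k z) atTop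
        (𝓝 (∫ z, (if 0 < w z then 1 else 0) * k z)) := by
    intro w hw
    refine tendsto_integral_of_dominated_convergence (fun z => |k z|)
      (fun n => (hbk _ _ (contDiff_heaviside n).continuous.measurable (habs n) hw).1) hki.abs
      (fun n => ae_of_all _ fun z => ?_) (ae_of_all _ fun z => ?_)
    · rw [Real.norm_eq_abs, abs_mul]
      exact mul_le_of_le_one_left (abs_nonneg _) (habs _ _)
    · exact (tendsto_heaviside _).mul_const _
  -- testing the difference of the two relations
  have hstep : ∀ n : ℕ, ∫ z, heaviside n (W z) * k z ≤ Q := by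
    intro n
    obtain ⟨η, hη, hη0, hlim⟩ := exists_test_approx (h₁.weakGrad.sub h₂.weakGrad) hbW hp
      (LocLp.sub (show LocLp _ V₁ from h₁.gradLp) (show LocLp _ V₂ from h₂.gradLp)) (contDiff_heaviside n) hχ
    obtain ⟨hi, hl⟩ := hlim _ _ (hv₂.locLp.sub hv₁.locLp) (hF2.sub hF1) (weight g)
      (continuous_weight hg)
    have h0 := ge_of_tendsto' hl fun j => by
      rw [weakForm_sub hp hm hg h₁ hv₁ h₂ hv₂ (hη j), heq _ (hη j), sub_zero]
      exact hge _ (hη j) (hη0 (heaviside_nonneg n) hχ0 j)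
    have hki' := hbk _ W (contDiff_heaviside n).continuous.measurable (habs n) hWm
    -- The monotone term is dropped and `0 ≤ heaviside n ≤ 1` bounds the cutoff term, independently
    -- of `n`.
    have hle := integral_mono hi (hQ.sub hki') fun z => by
      have e1 := inner_flux_sub_nonneg (m := m) hp hm (V₁ z) (V₂ z)
      have e2 : -inner ℝ (flux p m (V₁ z) - flux p m (V₂ z)) (spaceGrad χ z) ≤
          ‖spaceGrad χ z‖ * ‖flux p m (V₁ z) - flux p m (V₂ z)‖ := by
        rw [mul_comm]
        exact (neg_le_abs _).trans (abs_real_inner_le_norm _ _)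
      have e3 := deriv_heaviside_nonneg n (W z)
      have e4 := heaviside_nonneg n (W z)
      have e5 := heaviside_le_one n (W z)
      have e6 := hχ0 z
      have e7 := weight_pos (g := g) z.2
      have e8 : 0 ≤ ‖spaceGrad χ z‖ * ‖flux p m (V₁ z) - flux p m (V₂ z)‖ := by positivity
      have e9 : heaviside n (W z) * -inner ℝ (flux p m (V₁ z) - flux p m (V₂ z)) (spaceGrad χ z) ≤
          ‖spaceGrad χ z‖ * ‖flux p m (V₁ z) - flux p m (V₂ z)‖ :=
        (mul_le_mul_of_nonneg_left e2 e4).trans (mul_le_of_le_one_left e8 e5)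
      have e10 : 0 ≤ deriv (heaviside n) (W z) * χ z *
          inner ℝ (flux p m (V₁ z) - flux p m (V₂ z)) (V₁ z - V₂ z) := by positivity
      have e11 : inner ℝ (flux p m (V₂ z) - flux p m (V₁ z))
          ((deriv (heaviside n) (W z) * χ z) • (V₁ z - V₂ z) +
            heaviside n (W z) • spaceGrad χ z) =
          -(deriv (heaviside n) (W z) * χ z *
            inner ℝ (flux p m (V₁ z) - flux p m (V₂ z)) (V₁ z - V₂ z)) +
          heaviside n (W z) * -inner ℝ (flux p m (V₁ z) - flux p m (V₂ z)) (spaceGrad χ z) := by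
        rw [← neg_sub (flux p m (V₁ z)), inner_neg_left, inner_add_right, inner_smul_right,
          inner_smul_right]
        ring
      change ((v₂ z - v₁ z) * (heaviside n (W z) * χ z) +
        inner ℝ (flux p m (V₂ z) - flux p m (V₁ z))
          ((deriv (heaviside n) (W z) * χ z) • (V₁ z - V₂ z) +
            heaviside n (W z) • spaceGrad χ z)) * weight g z.2 ≤
        ‖spaceGrad χ z‖ * (‖flux p m (V₁ z) - flux p m (V₂ z)‖ * weight g z.2) -
          heaviside n (W z) * (χ z * ((v₁ z - v₂ z) * weight g z.2))
      rw [e11]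
      nlinarith [mul_le_mul_of_nonneg_right (add_le_add (neg_nonpos.2 e10) e9) e7.le]
    have h1 := h0.trans hle
    rw [show (∫ z, ((fun z => ‖spaceGrad χ z‖ *
      (‖flux p m (V₁ z) - flux p m (V₂ z)‖ * weight g z.2)) - fun z => heaviside n (W z) * k z) z) =
      Q - ∫ z, heaviside n (W z) * k z from integral_sub hQ hki'] at h1
    linarith
  have hlimit : ∫ z, (if 0 < W z then 1 else 0) * k z ≤ Q := le_of_tendsto' (hlimk W hWm) hstep
  -- the time derivative of the positive part
  set y : ℝ × 𝔼 → ℝ := fun z => u₁ z.1 z.2 - u₂ z.1 z.2 with hy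
  have hyb : LocBdd y := h₁.locBdd.sub h₂.locBdd
  have hyd := hv₁.sub hv₂
  have hym : AEStronglyMeasurable y (volume.restrict K) :=
    (hyd.1.integrableOn_compact_subset hKS hK).1
  obtain ⟨My, hMy⟩ := hyb K hK hKS
  have htc : Continuous fun z : ℝ × 𝔼 => timeDeriv χ z * weight g z.2 :=
    hχ.continuous_timeDeriv.mul hwc
  have htK : ∀ z ∉ K, timeDeriv χ z * weight g z.2 = 0 := fun z hz => by
    rw [timeDeriv_eq_zero_of_notMem hz, zero_mul]
  have hti : Integrable fun z : ℝ × 𝔼 => timeDeriv χ z * weight g z.2 :=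
    htc.integrable_of_hasCompactSupport (HasCompactSupport.intro hK htK)
  have hBy : ∀ B : ℝ → ℝ, Measurable B → (∀ s, |B s| ≤ |s|) →
      Integrable fun z => B (y z) * (timeDeriv χ z * weight g z.2) := by
    intro B hB hB1
    refine (integrableOn_iff_integrable_of_support_subset (s := K) fun z hz => ?_).1
      (Integrable.bdd_mul (c := My) hti.integrableOn
        (hB.comp_aemeasurable hym.aemeasurable).aestronglyMeasurable
        ((ae_restrict_iff' hK.measurableSet).2 (hMy.mono fun z hz hzK => (hB1 _).trans (hz hzK))))
    by_contra hzK
    exact hz (by simp only [htK z hzK, mul_zero])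
  have hBd : ∀ n s, HasDerivAt (fun s => ∫ r in (0 : ℝ)..s, heaviside n r) (heaviside n s) s :=
    fun n s => ((contDiff_heaviside n).continuous.integral_hasStrictDerivAt 0 s).hasDerivAt
  have hBm : ∀ n, Measurable fun s => ∫ r in (0 : ℝ)..s, heaviside n r := fun n =>
    (continuous_iff_continuousAt.2 fun s => (hBd n s).continuousAt).measurable
  have htime : ∀ n : ℕ, ∫ z, heaviside n (y z) * k z =
      -∫ z, (∫ r in (0 : ℝ)..y z, heaviside n r) * (timeDeriv χ z * weight g z.2) := by
    intro n
    have h0 := (integral_time_chain hyd hyb (hBd n) (contDiff_heaviside n).continuous hχ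
      (continuous_weight hg)).2
    rw [eq_neg_iff_add_eq_zero, ← integral_add
      (hbk _ _ (contDiff_heaviside n).continuous.measurable (habs n) hym)
      (hBy _ (hBm n) (abs_primitive_heaviside_le n))]
    refine Eq.trans (integral_congr_ae (ae_of_all _ fun z => ?_)) h0
    simp only [hk, hy]
    ring
  have hlimt : Tendsto (fun n => ∫ z, (∫ r in (0 : ℝ)..y z, heaviside n r) *
      (timeDeriv χ z * weight g z.2)) atTop
      (𝓝 (∫ z, max (y z) 0 * (timeDeriv χ z * weight g z.2))) := by
    refine tendsto_integral_of_dominated_convergence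
      (fun z => |y z * (timeDeriv χ z * weight g z.2)|)
      (fun n => (hBy _ (hBm n) (abs_primitive_heaviside_le n)).1)
      (hBy id measurable_id fun _ => le_rfl).abs
      (fun n => ae_of_all _ fun z => ?_) (ae_of_all _ fun z => ?_)
    · rw [Real.norm_eq_abs, abs_mul, abs_mul (y z)]
      exact mul_le_mul_of_nonneg_right (abs_primitive_heaviside_le _ _) (abs_nonneg _)
    · exact (tendsto_primitive_heaviside _).mul_const _
  have hfin := tendsto_nhds_unique (hlimk y hym) ((hlimt.neg).congr fun n => (htime n).symm)
  -- The difference `W` of the powers is what has a weak space gradient; the difference `y` is what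
  -- has a weak time derivative. Strict monotonicity of the power identifies their signs.
  have hsame : ∫ z, (if 0 < W z then 1 else 0) * k z = ∫ z, (if 0 < y z then 1 else 0) * k z := by
    refine integral_congr_ae ?_
    filter_upwards [h₁.ae_nonneg, h₂.ae_nonneg] with z hz1 hz2
    by_cases hzK : z ∈ K
    · have a1 := hz1 (hKS hzK)
      have a2 := hz2 (hKS hzK)
      have : 0 < W z ↔ 0 < y z := by
        rw [hW, hy, sub_pos, sub_pos]
        exact Real.rpow_lt_rpow_iff a2 a1 hκ
      simp only [this]
    · rw [hkK z hzK, mul_zero, mul_zero]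
  rw [hsame, hfin] at hlimit
  linarith

end Comparison

/-! ### Comparison in the whole space. -/

section ComparisonTheorem

variable {N : ℕ} {p m : ℝ} {g : ℝ → ℝ}

local notation "𝔼" => EuclideanSpace ℝ (Fin N)

variable {u u₁ u₂ : ℝ → EuclideanSpace ℝ (Fin N) → ℝ}
  {V V₁ V₂ : ℝ × EuclideanSpace ℝ (Fin N) → EuclideanSpace ℝ (Fin N)}
  {v₁ v₂ : ℝ × EuclideanSpace ℝ (Fin N) → ℝ}

theorem IsInClass.tendsto_integral_abs_sub (hg : ContinuousOn g (Ici 0))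
    (h : IsInClass N p m g u V) {t : ℝ} (ht : 0 ≤ t) :
    Tendsto (fun s => ∫ x, |u s x * weight g x - u t x * weight g x|) (𝓝[Ici 0] t) (𝓝 0) := by
  have h1 := (ENNReal.tendsto_toReal ENNReal.zero_ne_top).comp (h.continuousL1 t ht)
  rw [ENNReal.toReal_zero] at h1
  refine h1.congr' ?_
  filter_upwards [self_mem_nhdsWithin] with s hs
  have hi := (h.integrable_slice hg hs).sub (h.integrable_slice hg ht)
  have := integral_norm_eq_lintegral_enorm hi.1
  simp only [Pi.sub_apply, Real.norm_eq_abs] at this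
  rw [this, Function.comp_apply, eLpNorm_weightMeasure hg]
  congr 1
  refine lintegral_congr fun x => ?_
  rw [Pi.sub_apply, sub_mul]

theorem continuousOn_integral_posPart_sub (hg : ContinuousOn g (Ici 0))
    (h₁ : IsInClass N p m g u₁ V₁) (h₂ : IsInClass N p m g u₂ V₂) :
    ContinuousOn (fun t => ∫ x, max (u₁ t x - u₂ t x) 0 * weight g x) (Ici 0) := by
  have hmax : ∀ t (x : 𝔼), max (u₁ t x - u₂ t x) 0 * weight g x =
      max (u₁ t x * weight g x - u₂ t x * weight g x) 0 := fun t x => by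
    rw [max_mul_of_nonneg _ _ (weight_pos x).le, zero_mul, sub_mul]
  simp only [hmax]
  intro t ht
  have hlim := (h₁.tendsto_integral_abs_sub hg ht).add (h₂.tendsto_integral_abs_sub hg ht)
  rw [add_zero] at hlim
  rw [ContinuousWithinAt, tendsto_iff_dist_tendsto_zero]
  refine squeeze_zero' (Eventually.of_forall fun _ => dist_nonneg) ?_ hlim
  filter_upwards [self_mem_nhdsWithin] with s hs
  have a1 := h₁.integrable_slice hg hs
  have a2 := h₂.integrable_slice hg hs
  have b1 := h₁.integrable_slice hg ht
  have b2 := h₂.integrable_slice hg ht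
  have i1 : Integrable fun x => max (u₁ s x * weight g x - u₂ s x * weight g x) 0 :=
    (a1.sub a2).pos_part
  have i2 : Integrable fun x => max (u₁ t x * weight g x - u₂ t x * weight g x) 0 :=
    (b1.sub b2).pos_part
  have i3 : Integrable fun x => |u₁ s x * weight g x - u₁ t x * weight g x| := (a1.sub b1).abs
  have i4 : Integrable fun x => |u₂ s x * weight g x - u₂ t x * weight g x| := (a2.sub b2).abs
  rw [Real.dist_eq, ← integral_sub i1 i2, ← integral_add i3 i4]
  refine (abs_integral_le_integral_abs).trans (integral_mono (i1.sub i2).abs (i3.add i4) fun x => ?_)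
  refine (abs_max_sub_max_le_abs _ _ _).trans ?_
  rw [show u₁ s x * weight g x - u₂ s x * weight g x - (u₁ t x * weight g x - u₂ t x * weight g x) =
    (u₁ s x * weight g x - u₁ t x * weight g x) -
      (u₂ s x * weight g x - u₂ t x * weight g x) by ring]
  exact abs_sub _ _

/-- The comparison principle for a solution and a supersolution whose support is bounded, locally
uniformly in time. -/
theorem comparison (hp : 1 < p) (hm : 0 < p + m - 3) (hg : ContinuousOn g (Ici 0))
    (h₁ : IsInClass N p m g u₁ V₁) (hv₁ : HasWeakTimeDeriv (fun z => u₁ z.1 z.2) v₁)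
    (heq : ∀ η, IsTest η → weakForm p m g u₁ V₁ η = 0)
    (h₂ : IsInClass N p m g u₂ V₂) (hv₂ : HasWeakTimeDeriv (fun z => u₂ z.1 z.2) v₂)
    (hge : ∀ η, IsTest η → (∀ z, 0 ≤ η z) → 0 ≤ weakForm p m g u₂ V₂ η)
    (hV₂ : ∀ b : ℝ, ∃ R : ℝ, ∀ z, 0 < z.1 → z.1 ≤ b → R ≤ ‖z.2‖ → V₂ z = 0)
    (h0 : ∀ᵐ x, u₁ 0 x ≤ u₂ 0 x) {t : ℝ} (ht : 0 < t) : ∀ᵐ x, u₁ t x ≤ u₂ t x := by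
  set Y : ℝ → ℝ := fun t => ∫ x, max (u₁ t x - u₂ t x) 0 * weight g x with hY
  have hYc := continuousOn_integral_posPart_sub hg h₁ h₂
  -- Constant extension to negative times, since the lemma on weak decrease concerns functions
  -- continuous on the line.
  have hext : Continuous fun t => Y (max t 0) :=
    hYc.comp_continuous (by fun_prop) fun t => le_max_right t 0
  have hnn : ∀ t (x : 𝔼), 0 ≤ max (u₁ t x - u₂ t x) 0 * weight g x := fun t x =>
    mul_nonneg (le_max_right _ _) (weight_pos x).le
  have hY0 : Y (max 0 0) = 0 := by
    rw [max_self]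
    refine integral_eq_zero_of_ae ?_
    filter_upwards [h0] with x hx
    rw [max_eq_right (by linarith), zero_mul, Pi.zero_apply]
  have key : Y (max t 0) = 0 := by
    refine eq_zero_of_weak_antitone hext (fun t => integral_nonneg fun x => hnn _ x) hY0
      (fun ζ hζ hζ0 a b ha hζs => ?_) ht
    have hζd : Differentiable ℝ ζ := hζ.differentiable (by simp)
    have hζ' : ∀ s, s ∉ Icc a b → deriv ζ s = 0 := fun s hs =>
      image_eq_zero_of_notMem_tsupport fun h => hs (hζs (tsupport_deriv_subset h))
    have hζz : ∀ s, s ∉ Icc a b → ζ s = 0 := fun s hs =>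
      image_eq_zero_of_notMem_tsupport fun h => hs (hζs h)
    have hζ'c : Continuous (deriv ζ) := hζ.continuous_deriv (by simp)
    obtain ⟨D, hD⟩ := (isCompact_Icc (a := a) (b := b)).exists_bound_of_continuousOn
      hζ'c.continuousOn
    obtain ⟨D₀, hD₀⟩ := (isCompact_Icc (a := a) (b := b)).exists_bound_of_continuousOn
      hζd.continuous.continuousOn
    set P : ℝ × 𝔼 → ℝ := fun z => deriv ζ z.1 * (max (u₁ z.1 z.2 - u₂ z.1 z.2) 0 * weight g z.2)
      with hP
    have hPz : ∀ z, z ∉ Icc a b ×ˢ (univ : Set 𝔼) → P z = 0 := fun z hz => by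
      simp only [hP]
      rw [hζ' _ fun h => hz ⟨h, mem_univ _⟩, zero_mul]
    have hstrip : MeasurableSet (Icc a b ×ˢ (univ : Set 𝔼)) := measurableSet_Icc.prod .univ
    have hPi : Integrable P := by
      refine (integrableOn_iff_integrable_of_support_subset (s := Icc a b ×ˢ (univ : Set 𝔼))
        fun z hz => ?_).1 ?_
      · by_contra h
        exact hz (hPz z h)
      · have hi := ((h₁.integrableOn_strip (b := b) hg ha).sub
          (h₂.integrableOn_strip (b := b) hg ha)).pos_part
        refine (Integrable.bdd_mul (c := D) hi (f := fun z : ℝ × 𝔼 => deriv ζ z.1)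
          (hζ'c.comp continuous_fst).aestronglyMeasurable
          ((ae_restrict_iff' hstrip).2 (ae_of_all _ fun z hz => hD _ hz.1))).congr
          (ae_of_all _ fun z => ?_)
        simp only [hP, Pi.sub_apply]
        rw [max_mul_of_nonneg _ _ (weight_pos z.2).le, zero_mul, sub_mul]
    have hfub : ∫ s, deriv ζ s * Y (max s 0) = ∫ z, P z := by
      rw [Measure.volume_eq_prod, integral_prod _ (by rwa [← Measure.volume_eq_prod])]
      refine integral_congr_ae (ae_of_all _ fun s => ?_)
      simp only [hP, hY]
      rw [integral_const_mul]
      by_cases hs : s ∈ Icc a b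
      · rw [max_eq_left (ha.le.trans hs.1)]
      · rw [hζ' s hs, zero_mul, zero_mul]
    rw [hfub]
    obtain ⟨C, hC, hcut⟩ := exists_space_cutoff N hp
    have hR : ∀ n : ℕ, (1 : ℝ) ≤ n + 1 := fun n => by simp
    choose ψ hψs hψ0 hψ1 hψR hψt _ hψg using fun n : ℕ => hcut (n + 1) (hR n)
    have hψd : ∀ n, Differentiable ℝ (ψ n) := fun n => (hψs n).differentiable (by simp)
    have hlimA : Tendsto (fun n => ∫ z, ψ n z.2 * P z) atTop (𝓝 (∫ z, P z)) := by
      refine tendsto_integral_of_dominated_convergence (fun z => |P z|)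
        (fun n => (((hψs n).continuous.comp continuous_snd).aestronglyMeasurable.mul hPi.1))
        hPi.abs (fun n => ae_of_all _ fun z => ?_) (ae_of_all _ fun z => ?_)
      · rw [Real.norm_eq_abs, abs_mul, abs_of_nonneg (hψ0 n _)]
        exact mul_le_of_le_one_left (abs_nonneg _) (hψ1 n _)
      · refine tendsto_const_nhds.congr' ?_
        filter_upwards [eventually_ge_atTop ⌈‖z.2‖⌉₊] with n hn
        rw [hψR n z.2 ((Nat.le_ceil _).trans (by
          have : ((⌈‖z.2‖⌉₊ : ℕ) : ℝ) ≤ n := by exact_mod_cast hn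
          linarith)), one_mul]
    obtain ⟨R₀, hR₀⟩ := hV₂ b
    by_cases hab : a ≤ b
    swap
    · have : ∀ z, P z = 0 := fun z => hPz z fun h => hab (h.1.1.trans h.1.2)
      simp [this]
    -- The gradient of the cutoff lives in the annulus between the radii `n + 1` and `2(n + 1)`,
    -- where `V₂ = 0` for large `n`. With `‖∇ψ n‖ ≤ C / (n + 1)` and the flux of `u₁` bounded in
    -- `L^1`, the boundary term is `O(1/n)`.
    obtain ⟨c, hc⟩ := flux_bound hp hm hg h₁ hv₁ heq ha hab
    set q := gradExponent p m ^ (1 - p) with hq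
    have hq0 : 0 ≤ q := Real.rpow_nonneg (gradExponent_pos hp hm).le _
    have hD₀0 : 0 ≤ D₀ := (norm_nonneg _).trans (hD₀ a ⟨le_rfl, hab⟩)
    have hlimB : Tendsto (fun n : ℕ => (D₀ * C * q * c) / ((n : ℝ) + 1)) atTop (𝓝 0) :=
      tendsto_const_nhds.div_atTop (tendsto_atTop_add_const_right _ _ tendsto_natCast_atTop_atTop)
    have hsum := hlimA.add hlimB
    rw [add_zero] at hsum
    refine ge_of_tendsto hsum ?_
    filter_upwards [eventually_ge_atTop ⌈R₀⌉₊] with n hn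
    have hnR : R₀ ≤ (n : ℝ) + 1 := by
      have : ((⌈R₀⌉₊ : ℕ) : ℝ) ≤ n := by exact_mod_cast hn
      linarith [Nat.le_ceil R₀]
    have hn1 : (0 : ℝ) < n + 1 := by positivity
    have hmain := comparison_test hp hm hg h₁ hv₁ heq h₂ hv₂ hge
      (isTest_prodTest hζ (hψs n) ha hζs (hψt n)) fun z => mul_nonneg (hζ0 _) (hψ0 n _)
    refine hmain.trans (add_le_add (le_of_eq (integral_congr_ae (ae_of_all _ fun z => ?_))) ?_)
    · simp only [hP]
      rw [timeDeriv_prodTest hζd]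
      ring
    set S := Icc a b ×ˢ Metric.closedBall (0 : 𝔼) (2 * (n + 1)) with hS
    have hSm : MeasurableSet S := measurableSet_Icc.prod Metric.isClosed_closedBall.measurableSet
    obtain ⟨hi, hle⟩ := hc (2 * (n + 1)) (by linarith [hR n])
    calc ∫ z, ‖spaceGrad (prodTest ζ (ψ n)) z‖ *
          (‖flux p m (V₁ z) - flux p m (V₂ z)‖ * weight g z.2)
        ≤ ∫ z, S.indicator (fun z => (D₀ * (C / (n + 1)) * q) *
            (‖V₁ z‖ ^ (p - 1) * weight g z.2)) z := by
          refine integral_mono_of_nonneg (ae_of_all _ fun z => ?_)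
            ((integrable_indicator_iff hSm).2 (hi.const_mul _)) (ae_of_all _ fun z => ?_)
          · have := (weight_pos (g := g) z.2).le
            simp only [Pi.zero_apply]
            positivity
          · have hwp := (weight_pos (g := g) z.2).le
            simp only
            rw [spaceGrad_prodTest (hψd n), norm_smul]
            by_cases hzt : z.1 ∈ Icc a b
            swap
            · rw [hζz _ hzt, norm_zero, zero_mul, zero_mul]
              exact indicator_nonneg (fun z _ => by
                have := (weight_pos (g := g) z.2).le
                positivity) z
            by_cases hzx : ‖z.2‖ ≤ 2 * ((n : ℝ) + 1)
            swap
            · have : gradient (ψ n) z.2 = 0 := by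
                have h1 : z.2 ∉ tsupport (ψ n) := fun h => hzx (by simpa using hψt n h)
                have h2 : fderiv ℝ (ψ n) z.2 = 0 := by
                  by_contra h3
                  exact h1 (support_fderiv_subset ℝ h3)
                rw [gradient, h2, map_zero]
              rw [this, norm_zero, mul_zero, zero_mul]
              exact indicator_nonneg (fun z _ => by
                have := (weight_pos (g := g) z.2).le
                positivity) z
            have hzS : z ∈ S := ⟨hzt, by simpa using hzx⟩
            rw [indicator_of_mem hzS]
            by_cases hlt : ‖z.2‖ < (n : ℝ) + 1
            · have : gradient (ψ n) z.2 = 0 := by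
                have h1 : ψ n =ᶠ[𝓝 z.2] fun _ => (1 : ℝ) := by
                  filter_upwards [(isOpen_lt continuous_norm continuous_const).mem_nhds hlt]
                    with y hy
                  exact hψR n y (le_of_lt hy)
                rw [gradient, h1.fderiv_eq, fderiv_fun_const, Pi.zero_apply, map_zero]
              rw [this, norm_zero, mul_zero, zero_mul]
              positivity
            · have hV : V₂ z = 0 := hR₀ z (ha.trans_le hzt.1) hzt.2 (hnR.trans (not_lt.1 hlt))
              rw [hV, flux_zero hp hm, sub_zero, norm_flux hp hm, ← hq]
              have e1 := hD₀ z.1 hzt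
              have e2 := hψg n z.2
              calc ‖ζ z.1‖ * ‖gradient (ψ n) z.2‖ * (q * ‖V₁ z‖ ^ (p - 1) * weight g z.2)
                  ≤ D₀ * (C / (n + 1)) * (q * ‖V₁ z‖ ^ (p - 1) * weight g z.2) := by
                    gcongr
                _ = _ := by ring
      _ = (D₀ * (C / (n + 1)) * q) * ∫ z in S, ‖V₁ z‖ ^ (p - 1) * weight g z.2 := by
          rw [integral_indicator hSm, integral_const_mul]
      _ ≤ (D₀ * (C / (n + 1)) * q) * c := by gcongr
      _ = _ := by field_simp
  rw [max_eq_left ht.le] at key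
  have hi : Integrable fun x => max (u₁ t x - u₂ t x) 0 * weight g x := by
    refine ((h₁.integrable_slice hg ht.le).sub (h₂.integrable_slice hg ht.le)).pos_part.congr
      (ae_of_all _ fun x => ?_)
    simp only [Pi.sub_apply]
    rw [max_mul_of_nonneg _ _ (weight_pos x).le, zero_mul, sub_mul]
  filter_upwards [(integral_eq_zero_iff_of_nonneg (fun x => hnn t x) hi).1 key] with x hx
  have h3 : max (u₁ t x - u₂ t x) 0 = 0 :=
    (mul_eq_zero.1 (by simpa using hx)).resolve_right (weight_pos x).ne'
  linarith [le_max_left (u₁ t x - u₂ t x) 0]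

end ComparisonTheorem

/-! ### Functions of power-like growth, their inverses, and `G`. -/

section Powerlike

/-- A lower bound for the logarithmic derivative gives a lower bound for the growth. -/
theorem mul_rpow_le_of_le_deriv {φ φ' : ℝ → ℝ} {α : ℝ}
    (hd : ∀ s, 0 < s → HasDerivAt φ (φ' s) s) (hα : ∀ s, 0 < s → α * (φ s / s) ≤ φ' s) {s r : ℝ}
    (hs : 0 < s) (hsr : s ≤ r) : φ s * (r / s) ^ α ≤ φ r := by
  have hr : 0 < r := hs.trans_le hsr
  have hder : ∀ x, 0 < x → HasDerivAt (fun x => φ x * x ^ (-α))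
      (φ' x * x ^ (-α) + φ x * (-α * x ^ (-α - 1))) x := fun x hx =>
    (hd x hx).mul (Real.hasDerivAt_rpow_const (Or.inl hx.ne'))
  have hmono : MonotoneOn (fun x => φ x * x ^ (-α)) (Ioi 0) := by
    refine monotoneOn_of_deriv_nonneg (convex_Ioi 0)
      (fun x hx => (hder x hx).continuousAt.continuousWithinAt)
      (fun x hx => (hder x (interior_subset hx)).differentiableAt.differentiableWithinAt)
      fun x hx => ?_
    have hx : 0 < x := interior_subset hx
    rw [(hder x hx).deriv, Real.rpow_sub_one hx.ne']
    have h1 : φ' x * x ^ (-α) + φ x * (-α * (x ^ (-α) / x)) =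
        (φ' x - α * (φ x / x)) * x ^ (-α) := by ring
    rw [h1]
    exact mul_nonneg (sub_nonneg.2 (hα x hx)) (Real.rpow_nonneg hx.le _)
  have h2 := hmono hs hr hsr
  simp only [Real.rpow_neg hs.le, Real.rpow_neg hr.le, ← div_eq_mul_inv] at h2
  rw [Real.div_rpow hr.le hs.le, mul_div_assoc']
  have a1 := Real.rpow_pos_of_pos hs α
  have a2 := Real.rpow_pos_of_pos hr α
  rw [div_le_div_iff₀ a1 a2] at h2
  rw [div_le_iff₀ a1]
  exact h2

/-- An upper bound for the logarithmic derivative gives an upper bound for the growth. -/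
theorem le_mul_rpow_of_deriv_le {φ φ' : ℝ → ℝ} {α : ℝ}
    (hd : ∀ s, 0 < s → HasDerivAt φ (φ' s) s) (hα : ∀ s, 0 < s → φ' s ≤ α * (φ s / s)) {s r : ℝ}
    (hs : 0 < s) (hsr : s ≤ r) : φ r ≤ φ s * (r / s) ^ α := by
  have := mul_rpow_le_of_le_deriv (φ := fun x => -φ x) (φ' := fun x => -φ' x) (α := α)
    (fun x hx => (hd x hx).neg) (fun x hx => by
      have := hα x hx
      rw [neg_div, mul_neg]
      linarith) hs hsr
  linarith

variable {α₁ α₂ : ℝ} {φ g : ℝ → ℝ}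

namespace IsPowerlike

theorem hasDerivAt (h : IsPowerlike α₁ α₂ φ) {s : ℝ} (hs : 0 < s) :
    HasDerivAt φ (deriv φ s) s :=
  ((h.contDiffOn.differentiableOn (by simp)).differentiableAt (Ioi_mem_nhds hs)).hasDerivAt

theorem mul_rpow_le (h : IsPowerlike α₁ α₂ φ) {s r : ℝ} (hs : 0 < s) (hsr : s ≤ r) :
    φ s * (r / s) ^ α₁ ≤ φ r :=
  mul_rpow_le_of_le_deriv (fun _ hx => h.hasDerivAt hx) h.lower hs hsr

theorem le_mul_rpow (h : IsPowerlike α₁ α₂ φ) {s r : ℝ} (hs : 0 < s) (hsr : s ≤ r) :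
    φ r ≤ φ s * (r / s) ^ α₂ :=
  le_mul_rpow_of_deriv_le (fun _ hx => h.hasDerivAt hx) h.upper hs hsr

theorem deriv_pos (h : IsPowerlike α₁ α₂ φ) (hα : 0 < α₁) {s : ℝ} (hs : 0 < s) :
    0 < deriv φ s :=
  (mul_pos hα (div_pos (h.pos s hs) hs)).trans_le (h.lower s hs)

theorem strictMonoOn (h : IsPowerlike α₁ α₂ φ) (hα : 0 < α₁) : StrictMonoOn φ (Ici 0) :=
  strictMonoOn_of_deriv_pos (convex_Ici 0) h.continuousOn fun x hx => by
    rw [interior_Ici] at hx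
    exact h.deriv_pos hα hx

theorem nonneg (h : IsPowerlike α₁ α₂ φ) {s : ℝ} (hs : 0 ≤ s) : 0 ≤ φ s := by
  rcases hs.eq_or_lt with rfl | hs
  · rw [h.map_zero]
  · exact (h.pos s hs).le

theorem tendsto_atTop (h : IsPowerlike α₁ α₂ φ) (hα : 0 < α₁) : Tendsto φ atTop atTop := by
  refine tendsto_atTop_mono' atTop ?_
    ((tendsto_rpow_atTop hα).const_mul_atTop (h.pos 1 one_pos))
  filter_upwards [eventually_ge_atTop 1] with r hr
  simpa using h.mul_rpow_le one_pos hr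

theorem exists_eq (h : IsPowerlike α₁ α₂ φ) (hα : 0 < α₁) {y : ℝ} (hy : 0 ≤ y) :
    ∃ r ∈ Ici (0 : ℝ), φ r = y := by
  obtain ⟨R, hR⟩ := ((h.tendsto_atTop hα).eventually_ge_atTop y).and
    (eventually_ge_atTop 0) |>.exists
  obtain ⟨r, hr, hry⟩ := intermediate_value_Icc hR.2 (h.continuousOn.mono Icc_subset_Ici_self)
    ⟨by rwa [h.map_zero], hR.1⟩
  exact ⟨r, hr.1, hry⟩

theorem inv_nonneg (h : IsPowerlike α₁ α₂ φ) (hα : 0 < α₁) {y : ℝ} (hy : 0 ≤ y) :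
    0 ≤ inv φ y :=
  Function.invFunOn_mem (h.exists_eq hα hy)

theorem apply_inv (h : IsPowerlike α₁ α₂ φ) (hα : 0 < α₁) {y : ℝ} (hy : 0 ≤ y) :
    φ (inv φ y) = y :=
  Function.invFunOn_eq (h.exists_eq hα hy)

theorem inv_apply (h : IsPowerlike α₁ α₂ φ) (hα : 0 < α₁) {r : ℝ} (hr : 0 ≤ r) :
    inv φ (φ r) = r :=
  (h.strictMonoOn hα).injOn.leftInvOn_invFunOn hr

theorem lt_iff (h : IsPowerlike α₁ α₂ φ) (hα : 0 < α₁) {r s : ℝ} (hr : 0 ≤ r) (hs : 0 ≤ s) :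
    φ r < φ s ↔ r < s :=
  (h.strictMonoOn hα).lt_iff_lt hr hs

theorem le_iff (h : IsPowerlike α₁ α₂ φ) (hα : 0 < α₁) {r s : ℝ} (hr : 0 ≤ r) (hs : 0 ≤ s) :
    φ r ≤ φ s ↔ r ≤ s :=
  (h.strictMonoOn hα).le_iff_le hr hs

theorem inv_pos (h : IsPowerlike α₁ α₂ φ) (hα : 0 < α₁) {y : ℝ} (hy : 0 < y) : 0 < inv φ y := by
  rw [← h.lt_iff hα le_rfl (h.inv_nonneg hα hy.le), h.map_zero, h.apply_inv hα hy.le]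
  exact hy

theorem strictMonoOn_inv (h : IsPowerlike α₁ α₂ φ) (hα : 0 < α₁) :
    StrictMonoOn (inv φ) (Ici 0) := fun x hx y hy hxy => by
  rwa [← h.lt_iff hα (h.inv_nonneg hα hx) (h.inv_nonneg hα hy), h.apply_inv hα hx,
    h.apply_inv hα hy]

theorem continuousAt_inv (h : IsPowerlike α₁ α₂ φ) (hα : 0 < α₁) {y : ℝ} (hy : 0 < y) :
    ContinuousAt (inv φ) y := by
  refine (h.strictMonoOn_inv hα).continuousAt_of_image_mem_nhds (Ici_mem_nhds hy)
    (mem_of_superset (Ici_mem_nhds (h.inv_pos hα hy)) fun r hr => ?_)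
  exact ⟨φ r, h.nonneg hr, h.inv_apply hα hr⟩

theorem hasDerivAt_inv (h : IsPowerlike α₁ α₂ φ) (hα : 0 < α₁) {y : ℝ} (hy : 0 < y) :
    HasDerivAt (inv φ) (deriv φ (inv φ y))⁻¹ y := by
  refine HasDerivAt.of_local_left_inverse (h.continuousAt_inv hα hy)
    (h.hasDerivAt (h.inv_pos hα hy)) (h.deriv_pos hα (h.inv_pos hα hy)).ne' ?_
  filter_upwards [Ioi_mem_nhds hy] with x hx using h.apply_inv hα (le_of_lt hx)

/-- The derivative may be unbounded at `0`; its integrability follows from its sign and the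
continuity of `φ` up to `0`. -/
theorem intervalIntegrable_deriv (h : IsPowerlike α₁ α₂ φ) (hα : 0 < α₁) {r : ℝ} (hr : 0 ≤ r) :
    IntervalIntegrable (deriv φ) volume 0 r := by
  rw [intervalIntegrable_iff_integrableOn_Ioc_of_le hr]
  exact intervalIntegral.integrableOn_deriv_of_nonneg (h.continuousOn.mono Icc_subset_Ici_self)
    (fun x hx => h.hasDerivAt hx.1) fun x hx => (h.deriv_pos hα hx.1).le

theorem integral_deriv (h : IsPowerlike α₁ α₂ φ) (hα : 0 < α₁) {r : ℝ} (hr : 0 ≤ r) :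
    ∫ s in (0 : ℝ)..r, deriv φ s = φ r := by
  rw [intervalIntegral.integral_eq_sub_of_hasDerivAt_of_le hr
    (h.continuousOn.mono Icc_subset_Ici_self) (fun x hx => h.hasDerivAt hx.1)
    (h.intervalIntegrable_deriv hα hr), h.map_zero, sub_zero]

theorem continuousOn_div (h : IsPowerlike α₁ α₂ φ) : ContinuousOn (fun s => φ s / s) (Ioi 0) :=
  (h.continuousOn.mono Ioi_subset_Ici_self).div continuousOn_id fun _ hs => ne_of_gt hs

theorem intervalIntegrable_div (h : IsPowerlike α₁ α₂ φ) (hα : 0 < α₁) {r : ℝ} (hr : 0 ≤ r) :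
    IntervalIntegrable (fun s => φ s / s) volume 0 r := by
  have h1 := (h.intervalIntegrable_deriv hα hr).const_mul α₁⁻¹
  rw [intervalIntegrable_iff_integrableOn_Ioc_of_le hr] at h1 ⊢
  refine h1.mono' ((h.continuousOn_div.mono fun s hs => hs.1).aestronglyMeasurable
    measurableSet_Ioc) ((ae_restrict_iff' measurableSet_Ioc).2 (ae_of_all _ fun s hs => ?_))
  rw [Real.norm_of_nonneg (div_nonneg (h.nonneg hs.1.le) hs.1.le), inv_mul_eq_div,
    le_div_iff₀ hα, mul_comm]
  exact h.lower s hs.1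

theorem mul_bigG_le (h : IsPowerlike α₁ α₂ g) (hα : 0 < α₁) {r : ℝ} (hr : 0 ≤ r) :
    α₁ * bigG g r ≤ g r := by
  rw [← h.integral_deriv hα hr, bigG, ← intervalIntegral.integral_const_mul]
  exact intervalIntegral.integral_mono_on_of_le_Ioo hr
    ((h.intervalIntegrable_div hα hr).const_mul _) (h.intervalIntegrable_deriv hα hr)
    fun s hs => h.lower s hs.1

theorem le_mul_bigG (h : IsPowerlike α₁ α₂ g) (hα : 0 < α₁) {r : ℝ} (hr : 0 ≤ r) :
    g r ≤ α₂ * bigG g r := by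
  rw [← h.integral_deriv hα hr, bigG, ← intervalIntegral.integral_const_mul]
  exact intervalIntegral.integral_mono_on_of_le_Ioo hr (h.intervalIntegrable_deriv hα hr)
    ((h.intervalIntegrable_div hα hr).const_mul _) fun s hs => h.upper s hs.1

theorem bigG_zero : bigG g 0 = 0 := intervalIntegral.integral_same

theorem hasDerivAt_bigG (h : IsPowerlike α₁ α₂ g) (hα : 0 < α₁) {r : ℝ} (hr : 0 < r) :
    HasDerivAt (bigG g) (g r / r) r :=
  intervalIntegral.integral_hasDerivAt_right (h.intervalIntegrable_div hα hr.le)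
    (h.continuousOn_div.stronglyMeasurableAtFilter isOpen_Ioi r hr)
    (h.continuousOn_div.continuousAt (Ioi_mem_nhds hr))

theorem deriv_bigG (h : IsPowerlike α₁ α₂ g) (hα : 0 < α₁) {r : ℝ} (hr : 0 < r) :
    deriv (bigG g) r = g r / r :=
  (h.hasDerivAt_bigG hα hr).deriv

theorem bigG_nonneg (h : IsPowerlike α₁ α₂ g) {r : ℝ} (hr : 0 ≤ r) : 0 ≤ bigG g r :=
  intervalIntegral.integral_nonneg hr fun _ hs => div_nonneg (h.nonneg hs.1) hs.1

theorem bigG_pos (h : IsPowerlike α₁ α₂ g) (hα : 0 < α₁) {r : ℝ} (hr : 0 < r) : 0 < bigG g r := by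
  refine (h.bigG_nonneg hr.le).lt_of_ne fun h0 => ?_
  have := h.le_mul_bigG hα hr.le
  rw [← h0, mul_zero] at this
  linarith [h.pos r hr]

/-- Since `G' = g / r`, the growth conditions for `G` are exactly `α₁ G ≤ g ≤ α₂ G`. All growth and
inversion lemmas thus apply to `G` with the same exponents. -/
theorem bigG_isPowerlike (h : IsPowerlike α₁ α₂ g) (hα : 0 < α₁) :
    IsPowerlike α₁ α₂ (bigG g) where
  continuousOn := by
    intro r hr
    rcases (mem_Ici.1 hr).eq_or_lt with rfl | hr
    · have h1 : Tendsto (fun r => α₁⁻¹ * g r) (𝓝[Ici 0] 0) (𝓝 0) := by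
        have := (h.continuousOn 0 (by simp)).tendsto.const_mul α₁⁻¹
        rwa [h.map_zero, mul_zero] at this
      rw [ContinuousWithinAt, bigG_zero]
      refine squeeze_zero' ?_ ?_ h1
      · filter_upwards [self_mem_nhdsWithin] with r hr using h.bigG_nonneg hr
      · filter_upwards [self_mem_nhdsWithin] with r hr
        rw [inv_mul_eq_div, le_div_iff₀ hα, mul_comm]
        exact h.mul_bigG_le hα hr
    · exact (h.hasDerivAt_bigG hα hr).continuousAt.continuousWithinAt
  contDiffOn := by
    rw [show ((1 : WithTop ℕ∞)) = 0 + 1 by simp, contDiffOn_succ_iff_deriv_of_isOpen isOpen_Ioi]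
    refine ⟨fun r hr => (h.hasDerivAt_bigG hα hr).differentiableAt.differentiableWithinAt,
      by simp, ?_⟩
    rw [contDiffOn_zero]
    exact h.continuousOn_div.congr fun r hr => h.deriv_bigG hα hr
  map_zero := bigG_zero
  pos := fun _ => h.bigG_pos hα
  lower := fun r hr => by
    rw [h.deriv_bigG hα hr, mul_div_assoc']
    exact div_le_div_of_nonneg_right (h.mul_bigG_le hα hr.le) hr.le
  upper := fun r hr => by
    rw [h.deriv_bigG hα hr, mul_div_assoc']
    exact div_le_div_of_nonneg_right (h.le_mul_bigG hα hr.le) hr.le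

end IsPowerlike

end Powerlike

/-! ### From classical to weak derivatives. -/

section ClassicalToWeak

variable {N : ℕ}

local notation "𝔼" => EuclideanSpace ℝ (Fin N)

theorem integrable_of_continuousOn_of_isCompact {X F : Type*} [TopologicalSpace X]
    [MeasurableSpace X] [OpensMeasurableSpace X] [T2Space X] {μ : Measure X}
    [IsFiniteMeasureOnCompacts μ] [NormedAddCommGroup F] {f : X → F} {K : Set X}
    (hK : IsCompact K) (hf : ContinuousOn f K) (h0 : ∀ z ∉ K, f z = 0) : Integrable f μ := by
  refine (integrableOn_iff_integrable_of_support_subset (s := K) fun z hz => ?_).1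
    (hf.integrableOn_compact hK)
  by_contra h
  exact hz (h0 z h)

/-- Fubini in time, then integration by parts on each time slice in an arbitrary direction `e`; no
time derivative of `w` is involved. -/
theorem hasWeakSpaceGrad_of_hasFDerivAt {w : ℝ × 𝔼 → ℝ} {V : ℝ × 𝔼 → 𝔼}
    (hw : ContinuousOn w (halfSpace N)) (hV : ContinuousOn V (halfSpace N))
    (hd : ∀ t, 0 < t → ∀ x, HasFDerivAt (fun y => w (t, y)) (innerSL ℝ (V (t, x))) x) :
    HasWeakSpaceGrad w V := by
  have hS : MeasurableSet (halfSpace N) := isOpen_halfSpace.measurableSet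
  refine ⟨hw.locallyIntegrableOn hS, hV.locallyIntegrableOn hS, fun η hη => ?_⟩
  set K := tsupport η with hKdef
  have hK : IsCompact K := hη.compact
  have hKS : K ⊆ halfSpace N := hη.support
  have hη0 : ∀ z ∉ K, η z = 0 := fun z hz => image_eq_zero_of_notMem_tsupport hz
  have hfd : Continuous (fderiv ℝ η) := hη.smooth.continuous_fderiv (by simp)
  have hfd0 : ∀ z ∉ K, fderiv ℝ η z = 0 := fun z hz =>
    image_eq_zero_of_notMem_tsupport fun h => hz (tsupport_fderiv_subset ℝ h)
  have i1 : Integrable fun z => w z • spaceGrad η z :=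
    integrable_of_continuousOn_of_isCompact hK
      ((hw.mono hKS).smul hη.continuous_spaceGrad.continuousOn) fun z hz => by
        rw [spaceGrad_eq_zero_of_notMem hz, smul_zero]
  have i2 : Integrable fun z => η z • V z :=
    integrable_of_continuousOn_of_isCompact hK
      (hη.smooth.continuous.continuousOn.smul (hV.mono hKS)) fun z hz => by rw [hη0 z hz, zero_smul]
  refine ext_inner_left ℝ fun e => ?_
  rw [inner_neg_right, ← integral_inner i1, ← integral_inner i2]
  have j1 : Integrable fun z => inner ℝ e (w z • spaceGrad η z) := i1.const_inner e
  have j2 : Integrable fun z => inner ℝ e (η z • V z) := i2.const_inner e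
  rw [Measure.volume_eq_prod] at j1 j2 ⊢
  rw [integral_prod _ j1, integral_prod _ j2, ← integral_neg]
  refine integral_congr_ae (ae_of_all _ fun t => ?_)
  simp only
  have e1 : ∀ x, inner ℝ e (w (t, x) • spaceGrad η (t, x)) =
      w (t, x) * fderiv ℝ η (t, x) (0, e) := fun x => by
    rw [inner_smul_right, real_inner_comm, inner_spaceGrad hη.differentiable.differentiableAt]
  have e2 : ∀ x, inner ℝ e (η (t, x) • V (t, x)) = inner ℝ (V (t, x)) e * η (t, x) := fun x => by
    rw [inner_smul_right, real_inner_comm, mul_comm]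
  simp only [e1, e2]
  rcases le_or_gt t 0 with ht | ht
  · have hz : ∀ x : 𝔼, (t, x) ∉ K := fun x h => absurd (hKS h) (not_lt.2 ht)
    simp [hη0 _ (hz _), hfd0 _ (hz _)]
  have hslice : ∀ x : 𝔼, HasFDerivAt (fun y => η (t, y))
      ((fderiv ℝ η (t, x)).comp (ContinuousLinearMap.inr ℝ ℝ 𝔼)) x := fun x =>
    (hη.differentiable (t, x)).hasFDerivAt.comp x (hasFDerivAt_prodMk_right t x)
  have hK' : IsCompact (Prod.snd '' K) := hK.image continuous_snd
  have hz : ∀ x ∉ Prod.snd '' K, (t, x) ∉ K := fun x hx h => hx ⟨_, h, rfl⟩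
  have hpair : Continuous fun x : 𝔼 => (t, x) := by fun_prop
  have hwc : Continuous fun x => w (t, x) :=
    hw.comp_continuous hpair fun x => ht
  have hVc : Continuous fun x => V (t, x) :=
    hV.comp_continuous hpair fun x => ht
  have hηc : Continuous fun x => η (t, x) := hη.smooth.continuous.comp hpair
  have hfc : Continuous fun x => fderiv ℝ η (t, x) (0, e) :=
    (hfd.comp hpair).clm_apply continuous_const
  have main := integral_mul_fderiv_eq_neg_fderiv_mul_of_integrable (μ := (volume : Measure 𝔼))
    (f := fun x => w (t, x)) (g := fun x => η (t, x)) (v := e) ?_ ?_ ?_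
    (fun x _ => (hd t ht x).differentiableAt) (fun x _ => (hslice x).differentiableAt)
  · simp only [fun x => (hd t ht x).fderiv, fun x => (hslice x).fderiv] at main
    simpa [integral_neg] using main
  · simp only [fun x => (hd t ht x).fderiv]
    exact integrable_of_continuousOn_of_isCompact hK'
      ((hVc.inner continuous_const).mul hηc).continuousOn fun x hx => by
        rw [hη0 _ (hz x hx), mul_zero]
  · simp only [fun x => (hslice x).fderiv]
    exact integrable_of_continuousOn_of_isCompact hK' (hwc.mul hfc).continuousOn fun x hx => by
      simp [hfd0 _ (hz x hx)]
  · exact integrable_of_continuousOn_of_isCompact hK' (hwc.mul hηc).continuousOn fun x hx => by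
      rw [hη0 _ (hz x hx), mul_zero]

/-- A function that is continuous, and differentiable in time away from countably many times for
each point of space, is weakly differentiable as soon as the derivative is integrable. -/
theorem hasWeakTimeDeriv_of_hasDerivAt {w v : ℝ × 𝔼 → ℝ} (hw : ContinuousOn w (halfSpace N))
    (hv : LocallyIntegrableOn v (halfSpace N))
    (hd : ∀ x, ∃ S : Set ℝ, S.Countable ∧ ∀ t, 0 < t → t ∉ S →
      HasDerivAt (fun s => w (s, x)) (v (t, x)) t) : HasWeakTimeDeriv w v := by
  have hS : MeasurableSet (halfSpace N) := isOpen_halfSpace.measurableSet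
  refine ⟨hw.locallyIntegrableOn hS, hv, fun η hη => ?_⟩
  set K := tsupport η with hKdef
  have hK : IsCompact K := hη.compact
  have hKS : K ⊆ halfSpace N := hη.support
  have hη0 : ∀ z ∉ K, η z = 0 := fun z hz => image_eq_zero_of_notMem_tsupport hz
  have i1 : Integrable fun z => w z * timeDeriv η z :=
    integrable_of_continuousOn_of_isCompact hK
      ((hw.mono hKS).mul hη.continuous_timeDeriv.continuousOn) fun z hz => by
        rw [timeDeriv_eq_zero_of_notMem hz, mul_zero]
  have i2 : Integrable fun z => η z * v z := by
    obtain ⟨C, hC⟩ := hK.exists_bound_of_continuousOn hη.smooth.continuous.continuousOn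
    exact integrable_of_bdd_mul hK hη.smooth.continuous.aestronglyMeasurable (ae_of_all _ hC)
      (hv.integrableOn_compact_subset hKS hK) hη0
  have i3 := i1.add i2
  suffices h : ∫ z, ((fun z => w z * timeDeriv η z) + fun z => η z * v z) z = 0 by
    have h' := integral_add i1 i2
    simp only [Pi.add_apply] at h
    linarith
  rw [Measure.volume_eq_prod] at i3 ⊢
  rw [integral_prod_symm _ i3]
  refine integral_eq_zero_of_ae ?_
  filter_upwards [i3.prod_left_ae] with x hx
  simp only [Pi.add_apply, Pi.zero_apply] at hx ⊢
  obtain ⟨T, hT, hKT⟩ := exists_time_lt_of_isCompact hK hKS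
  obtain ⟨b, hb⟩ := (hK.image continuous_fst).bddAbove
  set B := max b T + 1 with hB
  have hTB : T ≤ B := by linarith [le_max_right b T]
  have hout : ∀ t, t ∉ Ioo T B → (t, x) ∉ K := fun t ht h => ht ⟨hKT _ h, by
    linarith [hb ⟨_, h, rfl⟩, le_max_left b T]⟩
  have hz : ∀ t, t ∉ Ioo T B → w (t, x) * timeDeriv η (t, x) + η (t, x) * v (t, x) = 0 := by
    intro t ht
    rw [timeDeriv_eq_zero_of_notMem (hout t ht), hη0 _ (hout t ht)]
    ring
  obtain ⟨S, hSc, hSd⟩ := hd x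
  have hηd : ∀ t, HasDerivAt (fun s => η (s, x)) (timeDeriv η (t, x)) t := fun t =>
    (hasDerivAt_slice (z := (t, x)) hη.differentiable.differentiableAt).differentiableAt.hasDerivAt
  -- The fundamental theorem of calculus tolerates countably many exceptional times if the
  -- derivative is integrable, which Fubini provides for almost every `x`.
  have key := integral_eq_of_hasDerivAt_off_countable_of_le (fun t => w (t, x) * η (t, x))
    (fun t => w (t, x) * timeDeriv η (t, x) + η (t, x) * v (t, x)) hTB hSc
    ((hw.comp (f := fun t : ℝ => (t, x)) (by fun_prop) fun t ht => hT.trans_le ht.1).mul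
      (continuous_iff_continuousAt.2 fun t => (hηd t).continuousAt).continuousOn)
    (fun t ht => ((hSd t (hT.trans ht.1.1) ht.2).mul (hηd t)).congr_deriv (by ring))
    hx.intervalIntegrable
  rw [hη0 _ (hout B (by simp)), hη0 _ (hout T (by simp)), mul_zero, mul_zero, sub_zero,
    intervalIntegral.integral_of_le hTB] at key
  rw [← key]
  exact (setIntegral_eq_integral_of_forall_compl_eq_zero fun t ht =>
    hz t fun h => ht (Ioo_subset_Ioc_self h)).symm

end ClassicalToWeak

/-! ### Radial functions and integration along rays. -/

section Radial

variable {N : ℕ}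

local notation "𝔼" => EuclideanSpace ℝ (Fin N)

/-- At the corner `y = 0` the derivative is the limit of the neighbouring derivatives, which is zero
because `σ > 1`. -/
theorem hasDerivAt_posPart_rpow {σ : ℝ} (hσ : 1 < σ) (y : ℝ) :
    HasDerivAt (fun y : ℝ => (max y 0) ^ σ) (σ * (max y 0) ^ (σ - 1)) y := by
  have hc : ∀ {τ : ℝ}, 0 < τ → Continuous fun y : ℝ => (max y 0) ^ τ := fun hτ =>
    (continuous_id.max continuous_const).rpow_const fun _ => Or.inr hτ.le
  have hne : ∀ y : ℝ, y ≠ 0 →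
      HasDerivAt (fun y : ℝ => (max y 0) ^ σ) (σ * (max y 0) ^ (σ - 1)) y := by
    intro y hy
    rcases hy.lt_or_gt with hy | hy
    · rw [max_eq_right hy.le, Real.zero_rpow (by linarith), mul_zero]
      refine (hasDerivAt_const y (0 : ℝ)).congr_of_eventuallyEq ?_
      filter_upwards [Iio_mem_nhds hy] with z hz
      rw [max_eq_right (le_of_lt hz), Real.zero_rpow (by linarith)]
    · rw [max_eq_left hy.le]
      refine (Real.hasDerivAt_rpow_const (Or.inl hy.ne')).congr_of_eventuallyEq ?_
      filter_upwards [Ioi_mem_nhds hy] with z hz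
      rw [max_eq_left (le_of_lt hz)]
  rcases eq_or_ne y 0 with rfl | hy
  · exact hasDerivAt_of_hasDerivAt_of_ne (fun y hy => hne y hy) (hc (by linarith)).continuousAt
      ((hc (by linarith : 0 < σ - 1)).const_mul σ).continuousAt
  · exact hne y hy

/-- The radial vector field of magnitude `q |x|`. -/
def radialField (q : ℝ → ℝ) (x : 𝔼) : 𝔼 := (q ‖x‖ / ‖x‖) • x

theorem norm_radialField {q : ℝ → ℝ} (h0 : q 0 = 0) (x : 𝔼) : ‖radialField q x‖ = |q ‖x‖| := by
  rw [radialField, norm_smul, Real.norm_eq_abs, abs_div, abs_norm]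
  rcases eq_or_ne x 0 with rfl | hx
  · simp [h0]
  · have := norm_pos_iff.2 hx
    field_simp

theorem continuous_radialField {q : ℝ → ℝ} (hq : ContinuousOn q (Ici 0)) (h0 : q 0 = 0) :
    Continuous (radialField q : 𝔼 → 𝔼) := by
  have hqn : Continuous fun x : 𝔼 => q ‖x‖ := hq.comp_continuous continuous_norm fun x =>
    norm_nonneg x
  refine continuous_iff_continuousAt.2 fun x => ?_
  rcases eq_or_ne x 0 with rfl | hx
  · rw [ContinuousAt, show radialField q (0 : 𝔼) = 0 by simp [radialField]]
    rw [tendsto_zero_iff_norm_tendsto_zero]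
    simp only [norm_radialField h0]
    have := hqn.abs.tendsto (0 : 𝔼)
    simpa [h0] using this
  · exact (hqn.continuousAt.div continuous_norm.continuousAt (norm_ne_zero_iff.2 hx)).smul
      continuousAt_id

/-- The condition `h' 0 = 0` is what makes the function differentiable at the origin: the one-sided
derivative of `h` vanishes, so `h ‖x‖ - h 0` is `o(‖x‖)`. -/
theorem hasFDerivAt_comp_norm {h h' : ℝ → ℝ} (hc : ContinuousOn h (Ici 0))
    (hc' : ContinuousOn h' (Ici 0)) (hd : ∀ r, 0 < r → HasDerivAt h (h' r) r) (h0 : h' 0 = 0)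
    (x : 𝔼) : HasFDerivAt (fun x : 𝔼 => h ‖x‖) (innerSL ℝ (radialField h' x)) x := by
  rcases eq_or_ne x 0 with rfl | hx
  · have h1 : HasDerivWithinAt h 0 (Ici 0) 0 := by
      refine hasDerivWithinAt_Ici_of_tendsto_deriv (s := Ioi 0)
        (fun r hr => (hd r hr).differentiableAt.differentiableWithinAt)
        ((hc 0 (by simp)).mono Ioi_subset_Ici_self) self_mem_nhdsWithin ?_
      have := ((hc' 0 (by simp)).mono Ioi_subset_Ici_self).tendsto
      rw [h0] at this
      refine this.congr' ?_
      filter_upwards [self_mem_nhdsWithin] with r hr using (hd r hr).deriv.symm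
    have h2 : Tendsto (fun x : 𝔼 => ‖x‖) (𝓝 0) (𝓝[Ici 0] 0) :=
      tendsto_nhdsWithin_iff.2 ⟨by simpa using (continuous_norm (E := 𝔼)).tendsto 0,
        Eventually.of_forall fun x => norm_nonneg x⟩
    have h3 := (hasDerivWithinAt_iff_isLittleO.1 h1).comp_tendsto h2
    refine HasFDerivAt.of_isLittleO ?_
    refine (h3.congr' (g₂ := fun x : 𝔼 => ‖x - 0‖) ?_ ?_).of_norm_right
    · exact Eventually.of_forall fun x => by simp [radialField]
    · exact Eventually.of_forall fun x => by simp
  · have hx' := norm_pos_iff.2 hx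
    have h1 := (hasStrictFDerivAt_norm_sq x).hasFDerivAt.sqrt (by positivity)
    simp only [Real.sqrt_sq (norm_nonneg _)] at h1
    refine ((hd ‖x‖ hx').comp_hasFDerivAt x h1).congr_fderiv ?_
    ext y
    simp only [radialField, smul_apply, innerSL_apply_apply, inner_smul_left,
      smul_eq_mul, nsmul_eq_mul]
    simp
    field_simp

/-- An integral over space is nonnegative if the integrals along rays are. -/
theorem integral_nonneg_of_rays (hN : 0 < N) {Φ : 𝔼 → ℝ}
    (h : ∀ ω : 𝔼, ‖ω‖ = 1 → 0 ≤ ∫ r in Ioi (0 : ℝ), r ^ (N - 1) * Φ (r • ω)) :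
    0 ≤ ∫ x, Φ x := by
  have : NeZero N := ⟨hN.ne'⟩
  -- A non-integrable function has integral zero by convention, so only the integrable case needs
  -- polar coordinates.
  by_cases hi : Integrable Φ
  swap
  · rw [integral_undef hi]
  have e1 : ∫ x, Φ x = ∫ x : ({(0)}ᶜ : Set 𝔼), Φ x ∂((volume : Measure 𝔼).comap (↑)) := by
    rw [integral_subtype_comap (measurableSet_singleton _).compl fun x => Φ x,
      restrict_compl_singleton]
  have mp := (volume : Measure 𝔼).measurePreserving_homeomorphUnitSphereProd
  have emb := (homeomorphUnitSphereProd 𝔼).measurableEmbedding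
  have e2 := mp.integral_comp emb (fun z => Φ (z.2.1 • z.1.1))
  have e3 : ∀ x : ({(0)}ᶜ : Set 𝔼), ((homeomorphUnitSphereProd 𝔼 x).2 : ℝ) •
      ((homeomorphUnitSphereProd 𝔼 x).1 : 𝔼) = x := fun x => by
    have hx : ‖(x : 𝔼)‖ ≠ 0 := norm_ne_zero_iff.2 x.2
    simpa using smul_inv_smul₀ hx (x : 𝔼)
  simp only [e3] at e2
  rw [e1, e2]
  have hi2 : Integrable (fun z : Metric.sphere (0 : 𝔼) 1 × Ioi (0 : ℝ) => Φ (z.2.1 • z.1.1))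
      ((volume : Measure 𝔼).toSphere.prod
        (Measure.volumeIoiPow (Module.finrank ℝ 𝔼 - 1))) := by
    rw [← mp.integrable_comp_emb emb]
    simp only [Function.comp_def, e3]
    refine (integrableOn_iff_comap_subtypeVal (measurableSet_singleton _).compl).1 ?_
    exact hi.integrableOn
  rw [integral_prod _ hi2]
  refine integral_nonneg fun ω => ?_
  have e4 : ∫ r : Ioi (0 : ℝ), Φ (r.1 • ω.1) ∂(Measure.volumeIoiPow (Module.finrank ℝ 𝔼 - 1)) =
      ∫ r in Ioi (0 : ℝ), r ^ (N - 1) * Φ (r • ω.1) := by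
    simp only [Measure.volumeIoiPow, ENNReal.ofReal]
    rw [integral_withDensity_eq_integral_smul,
      integral_subtype_comap measurableSet_Ioi
        fun a => Real.toNNReal (a ^ (Module.finrank ℝ 𝔼 - 1)) • Φ (a • ω.1),
      setIntegral_congr_fun measurableSet_Ioi fun x hx => ?_]
    · simp only [finrank_euclideanSpace, Fintype.card_fin]
      rw [NNReal.smul_def, Real.coe_toNNReal _ (pow_nonneg hx.out.le _), smul_eq_mul]
    · exact (measurable_subtype_coe.pow_const _).real_toNNReal
  simp only [e4]
  exact h ω.1 (by simp)

end Radial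

/-! ### Radial profiles and integrability at the front. -/

section Profile

/-- A strictly increasing radial profile `h` with derivative `h'`. -/
structure IsProfile (h h' : ℝ → ℝ) : Prop where
  continuousOn : ContinuousOn h (Ici 0)
  continuousOn' : ContinuousOn h' (Ici 0)
  hasDerivAt : ∀ r, 0 < r → HasDerivAt h (h' r) r
  zero : h' 0 = 0
  pos : ∀ r, 0 < r → 0 < h' r
  nonneg : 0 ≤ h 0
  tendsto : Tendsto h atTop atTop

variable {h h' : ℝ → ℝ}

theorem IsProfile.strictMonoOn (hh : IsProfile h h') : StrictMonoOn h (Ici 0) :=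
  strictMonoOn_of_deriv_pos (convex_Ici 0) hh.continuousOn fun x hx => by
    rw [interior_Ici] at hx
    rw [(hh.hasDerivAt x hx).deriv]
    exact hh.pos x hx

theorem IsProfile.nonneg' (hh : IsProfile h h') {r : ℝ} (hr : 0 ≤ r) : 0 ≤ h r :=
  hh.nonneg.trans (hh.strictMonoOn.monotoneOn (by simp) hr hr)

theorem IsProfile.exists_eq (hh : IsProfile h h') {r₁ α : ℝ} (hr₁ : 0 ≤ r₁) (hα : h r₁ < α) :
    ∃ ρ, r₁ < ρ ∧ h ρ = α := by
  obtain ⟨R, hR⟩ := ((hh.tendsto.eventually_ge_atTop α).and (eventually_ge_atTop r₁)).exists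
  obtain ⟨ρ, hρ, hρα⟩ := intermediate_value_Icc hR.2
    (hh.continuousOn.mono fun x hx => hr₁.trans hx.1) ⟨hα.le, hR.1⟩
  exact ⟨ρ, hρ.1.lt_of_ne (by rintro rfl; exact hα.ne hρα), hρα⟩

/-- Uniform integrability of `(α - h r)_+ ^ (s - 1)` near the zero of `α - h`. -/
theorem IsProfile.exists_integral_le (hh : IsProfile h h') {s : ℝ} (hs : 0 < s) (n : ℕ)
    {r₁ α₀ α₁ : ℝ} (hr₁ : 0 < r₁) (hα₀ : h r₁ < α₀) (hα : α₀ ≤ α₁) :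
    ∃ C : ℝ, ∀ α ∈ Icc α₀ α₁,
      IntegrableOn (fun r => r ^ n * if h r < α then (α - h r) ^ (s - 1) else 0) (Ioi 0) ∧
      ∫ r in Ioi 0, r ^ n * (if h r < α then (α - h r) ^ (s - 1) else 0) ≤ C := by
  -- For every `α` in the range the zero of `α - h` lies in `(r₁, R]`. There `h' ≥ c > 0`, so `(α -
  -- h)^(s-1)` is dominated by the exact derivative `(α - h)^(s-1) h' / c`; below `r₁` the gap stays
  -- at least `α₀ - h r₁`.
  obtain ⟨R, hR, hRα⟩ := hh.exists_eq hr₁.le (hα₀.trans_le hα)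
  have hR0 : 0 < R := hr₁.trans hR
  obtain ⟨x₀, hx₀, hmin⟩ := (isCompact_Icc (a := r₁) (b := R)).exists_isMinOn
    (nonempty_Icc.2 hR.le) (hh.continuousOn'.mono fun x hx => hr₁.le.trans hx.1)
  set c := h' x₀ with hc
  have hc0 : 0 < c := hh.pos x₀ (hr₁.trans_le hx₀.1)
  -- Two terms, because `s - 1` may have either sign.
  set B := (α₀ - h r₁) ^ (s - 1) + α₁ ^ (s - 1) with hB
  have hα₀r : 0 < α₀ - h r₁ := by linarith
  have hα₁0 : 0 < α₁ := (hh.nonneg' hr₁.le).trans_lt (hα₀.trans_le hα)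
  refine ⟨R ^ n * B * r₁ + R ^ n / c * (α₁ ^ s / s), fun α hαI => ?_⟩
  obtain ⟨ρ, hρ, hρα⟩ := hh.exists_eq hr₁.le (hα₀.trans_le hαI.1)
  have hρR : ρ ≤ R := by
    rw [← hh.strictMonoOn.le_iff_le (hr₁.trans hρ).le hR0.le, hρα, hRα]
    exact hαI.2
  set F : ℝ → ℝ := fun r => r ^ n * if h r < α then (α - h r) ^ (s - 1) else 0 with hF
  have hlt : ∀ r, 0 ≤ r → (h r < α ↔ r < ρ) := fun r hr => by
    rw [← hρα]
    exact hh.strictMonoOn.lt_iff_lt hr (hr₁.trans hρ).le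
  have hFin : ∀ r, 0 ≤ r → r < ρ → F r = r ^ n * (α - h r) ^ (s - 1) := fun r hr hrρ => by
    simp only [hF, if_pos ((hlt r hr).2 hrρ)]
  have hFout : ∀ r, 0 ≤ r → ρ ≤ r → F r = 0 := fun r hr hrρ => by
    simp only [hF, if_neg (mt (hlt r hr).1 (not_lt.2 hrρ)), mul_zero]
  have hcont : ContinuousOn (fun r => r ^ n * (α - h r) ^ (s - 1)) (Ico 0 ρ) :=
    (continuousOn_pow n).mul ((continuousOn_const.sub
      (hh.continuousOn.mono fun x hx => hx.1)).rpow_const fun x hx =>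
        Or.inl (sub_pos.2 ((hlt x hx.1).2 hx.2)).ne')
  have hmeas : ∀ a b, 0 ≤ a → b ≤ ρ → AEStronglyMeasurable F (volume.restrict (Ioo a b)) := by
    intro a b ha hb
    exact ((hcont.mono fun x hx => ⟨ha.trans hx.1.le, hx.2.trans_le hb⟩).congr fun x hx =>
      hFin x (ha.trans hx.1.le) (hx.2.trans_le hb)).aestronglyMeasurable measurableSet_Ioo
  -- the region near the origin
  have hb1 : ∀ r ∈ Ioo 0 r₁, ‖F r‖ ≤ R ^ n * B := by
    intro r hr
    have h1 : h r < h r₁ := hh.strictMonoOn hr.1.le hr₁.le hr.2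
    have h2 : α₀ - h r₁ ≤ α - h r := by linarith [hαI.1]
    have h3 : α - h r ≤ α₁ := by linarith [hαI.2, hh.nonneg' hr.1.le]
    have h4 : 0 < α - h r := hα₀r.trans_le h2
    rw [hFin r hr.1.le (hr.2.trans hρ), norm_mul, norm_pow, Real.norm_of_nonneg hr.1.le,
      Real.norm_of_nonneg (Real.rpow_nonneg h4.le _)]
    refine mul_le_mul (pow_le_pow_left₀ hr.1.le (hr.2.trans hR).le n) ?_
      (Real.rpow_nonneg h4.le _) (by positivity)
    rcases le_total 0 (s - 1) with hs1 | hs1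
    · exact (Real.rpow_le_rpow h4.le h3 hs1).trans (by
        have := Real.rpow_nonneg hα₀r.le (s - 1)
        linarith)
    · exact (Real.rpow_le_rpow_of_nonpos hα₀r h2 hs1).trans (by
        have := Real.rpow_nonneg hα₁0.le (s - 1)
        linarith)
  have i1 : IntegrableOn F (Ioo 0 r₁) :=
    (integrableOn_const (C := R ^ n * B) measure_Ioo_lt_top.ne).mono' (hmeas 0 r₁ le_rfl hρ.le)
      ((ae_restrict_iff' measurableSet_Ioo).2 (ae_of_all _ hb1))
  have b1 : ∫ r in Ioo 0 r₁, F r ≤ R ^ n * B * r₁ := by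
    have := norm_setIntegral_le_of_norm_le_const (μ := volume) measure_Ioo_lt_top hb1
    rw [Real.volume_real_Ioo_of_le hr₁.le, sub_zero] at this
    exact (le_abs_self _).trans this
  -- the region near the zero
  have hder : ∀ r ∈ Ioo r₁ ρ, HasDerivAt (fun r => -((α - h r) ^ s / s))
      ((α - h r) ^ (s - 1) * h' r) r := by
    intro r hr
    have hpos : 0 < α - h r := sub_pos.2 ((hlt r (hr₁.trans hr.1).le).2 hr.2)
    have := (((hh.hasDerivAt r (hr₁.trans hr.1)).const_sub α).rpow_const
      (p := s) (Or.inl hpos.ne')).div_const s |>.neg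
    refine this.congr_deriv ?_
    field_simp
  have hFc : ContinuousOn (fun r => -((α - h r) ^ s / s)) (Icc r₁ ρ) :=
    (((continuousOn_const.sub (hh.continuousOn.mono fun x hx => hr₁.le.trans hx.1)).rpow_const
      fun x hx => Or.inr hs.le).div_const s).neg
  have hd0 : ∀ r ∈ Ioo r₁ ρ, 0 ≤ (α - h r) ^ (s - 1) * h' r := fun r hr =>
    mul_nonneg (Real.rpow_nonneg (sub_pos.2 ((hlt r (hr₁.trans hr.1).le).2 hr.2)).le _)
      (hh.pos r (hr₁.trans hr.1)).le
  have i2' := intervalIntegral.integrableOn_deriv_of_nonneg hFc hder hd0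
  have e2 := intervalIntegral.integral_eq_sub_of_hasDerivAt_of_le hρ.le hFc hder
    ((intervalIntegrable_iff_integrableOn_Ioc_of_le hρ.le).2 i2')
  rw [hρα, sub_self, Real.zero_rpow hs.ne', zero_div, neg_zero, zero_sub, neg_neg,
    intervalIntegral.integral_of_le hρ.le, integral_Ioc_eq_integral_Ioo] at e2
  have hb2 : ∀ r ∈ Ioo r₁ ρ, ‖F r‖ ≤ R ^ n / c * ((α - h r) ^ (s - 1) * h' r) := by
    intro r hr
    have hr0 : 0 < r := hr₁.trans hr.1
    have hpos : 0 < α - h r := sub_pos.2 ((hlt r hr0.le).2 hr.2)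
    have hcr : c ≤ h' r := hmin ⟨hr.1.le, hr.2.le.trans hρR⟩
    rw [hFin r hr0.le hr.2, norm_mul, norm_pow, Real.norm_of_nonneg hr0.le,
      Real.norm_of_nonneg (Real.rpow_nonneg hpos.le _)]
    have hA := Real.rpow_nonneg hpos.le (s - 1)
    have h1 : r ^ n ≤ R ^ n := pow_le_pow_left₀ hr0.le (hr.2.le.trans hρR) n
    calc r ^ n * (α - h r) ^ (s - 1) ≤ R ^ n * ((α - h r) ^ (s - 1) * (h' r / c)) := by
          refine mul_le_mul h1 (le_mul_of_one_le_right hA ((one_le_div hc0).2 hcr)) hA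
            (by positivity)
      _ = _ := by ring
  have i2'' : IntegrableOn (fun r => R ^ n / c * ((α - h r) ^ (s - 1) * h' r)) (Ioo r₁ ρ) :=
    (i2'.mono_set Ioo_subset_Ioc_self).const_mul _
  have i2 : IntegrableOn F (Ioo r₁ ρ) := i2''.mono' (hmeas r₁ ρ hr₁.le le_rfl)
    ((ae_restrict_iff' measurableSet_Ioo).2 (ae_of_all _ hb2))
  have b2 : ∫ r in Ioo r₁ ρ, F r ≤ R ^ n / c * (α₁ ^ s / s) := by
    calc ∫ r in Ioo r₁ ρ, F r
        ≤ ∫ r in Ioo r₁ ρ, R ^ n / c * ((α - h r) ^ (s - 1) * h' r) :=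
          setIntegral_mono_on i2 i2'' measurableSet_Ioo fun r hr => (le_abs_self _).trans (hb2 r hr)
      _ = R ^ n / c * ((α - h r₁) ^ s / s) := by rw [integral_const_mul, e2]
      _ ≤ R ^ n / c * (α₁ ^ s / s) := by
          have h1 : 0 ≤ α - h r₁ := by linarith [hαI.1]
          have h2 : α - h r₁ ≤ α₁ := by linarith [hαI.2, hh.nonneg' hr₁.le]
          gcongr
  have hunion : Ioc 0 r₁ ∪ Ioc r₁ ρ = Ioc 0 ρ := Ioc_union_Ioc_eq_Ioc hr₁.le hρ.le
  have i1c : IntegrableOn F (Ioc 0 r₁) := (integrableOn_Ioc_iff_integrableOn_Ioo).2 i1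
  have i2c : IntegrableOn F (Ioc r₁ ρ) := (integrableOn_Ioc_iff_integrableOn_Ioo).2 i2
  have i3 : IntegrableOn F (Ioc 0 ρ) := hunion ▸ i1c.union i2c
  have hz : ∀ r ∈ Ioi 0 \ Ioc 0 ρ, F r = 0 := fun r hr =>
    hFout r (le_of_lt hr.1) (not_lt.1 fun h => hr.2 ⟨hr.1, h.le⟩)
  refine ⟨i3.of_forall_sdiff_eq_zero measurableSet_Ioi hz, ?_⟩
  rw [setIntegral_eq_of_subset_of_forall_sdiff_eq_zero measurableSet_Ioi Ioc_subset_Ioi_self hz,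
    ← hunion, setIntegral_union (Ioc_disjoint_Ioc_of_le le_rfl) measurableSet_Ioc i1c i2c,
    integral_Ioc_eq_integral_Ioo, integral_Ioc_eq_integral_Ioo]
  exact add_le_add b1 b2

end Profile

/-! ### Radial barriers: regularity in space. -/

section RadialBarrier

variable {N : ℕ}

local notation "𝔼" => EuclideanSpace ℝ (Fin N)

/-- The radial function `C (t + t₀)^(-1/k) (a(t) - h(|x|))_+^s`. -/
def radialBarrier (k s C t₀ : ℝ) (a h : ℝ → ℝ) (t : ℝ) (x : 𝔼) : ℝ :=
  C / (t + t₀) ^ (1 / k) * (max (a t - h ‖x‖) 0) ^ s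

/-- The hypotheses on the ingredients of `radialBarrier`: `a'` and `h'` are the derivatives of
`a` and `h`. -/
structure IsBarrierData (k s C t₀ : ℝ) (a a' h h' : ℝ → ℝ) : Prop where
  k_pos : 0 < k
  s_pos : 0 < s
  C_pos : 0 < C
  one_lt : 1 < t₀
  profile : IsProfile h h'
  hasDerivAt : ∀ t, 0 ≤ t → HasDerivAt a (a' t) t
  continuousOn' : ContinuousOn a' (Ici 0)
  pos' : ∀ t, 0 ≤ t → 0 < a' t
  front : h 0 < a 0
  bdd : ∃ B, ∀ t, 0 ≤ t → C / (t + t₀) ^ (1 / k) * a t ^ s ≤ B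

/-- The set where `radialBarrier` is positive, for positive times. -/
def positivitySet (N : ℕ) (a h : ℝ → ℝ) : Set (ℝ × EuclideanSpace ℝ (Fin N)) :=
  {z | 0 < z.1 ∧ h ‖z.2‖ < a z.1}

/-- The time derivative of `radialBarrier`. -/
def barrierTimeDeriv (k s C t₀ : ℝ) (a a' h : ℝ → ℝ) : ℝ × 𝔼 → ℝ :=
  (positivitySet N a h).indicator fun z => C / (z.1 + t₀) ^ (1 / k) *
    (s * (a z.1 - h ‖z.2‖) ^ (s - 1) * a' z.1 - (a z.1 - h ‖z.2‖) ^ s / (k * (z.1 + t₀)))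

/-- The spatial gradient of the power `κ` of `radialBarrier`. -/
def barrierGrad (k s C t₀ κ : ℝ) (a h h' : ℝ → ℝ) (z : ℝ × 𝔼) : 𝔼 :=
  -((C / (z.1 + t₀) ^ (1 / k)) ^ κ * (s * κ * (max (a z.1 - h ‖z.2‖) 0) ^ (s * κ - 1))) •
    radialField h' z.2

namespace IsBarrierData

variable {k s C t₀ : ℝ} {a a' h h' : ℝ → ℝ}

theorem continuousOn (H : IsBarrierData k s C t₀ a a' h h') : ContinuousOn a (Ici 0) :=
  fun t ht => (H.hasDerivAt t ht).continuousAt.continuousWithinAt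

theorem strictMonoOn (H : IsBarrierData k s C t₀ a a' h h') : StrictMonoOn a (Ici 0) :=
  strictMonoOn_of_deriv_pos (convex_Ici 0) H.continuousOn fun x hx => by
    have hx : 0 ≤ x := interior_subset hx
    rw [(H.hasDerivAt x hx).deriv]
    exact H.pos' x hx

theorem continuousOn_gap (H : IsBarrierData k s C t₀ a a' h h') :
    ContinuousOn (fun z : ℝ × 𝔼 => a z.1 - h ‖z.2‖) (Ici 0 ×ˢ univ) :=
  (H.continuousOn.comp continuousOn_fst fun _ hz => hz.1).sub
    (H.profile.continuousOn.comp continuousOn_snd.norm fun z _ => norm_nonneg z.2)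

theorem coef_pos (H : IsBarrierData k s C t₀ a a' h h') {t : ℝ} (ht : 0 ≤ t) :
    0 < C / (t + t₀) ^ (1 / k) :=
  div_pos H.C_pos (Real.rpow_pos_of_pos (by linarith [H.one_lt]) _)

theorem hasDerivAt_coef (H : IsBarrierData k s C t₀ a a' h h') {t : ℝ} (ht : 0 ≤ t) :
    HasDerivAt (fun t => C / (t + t₀) ^ (1 / k))
      (-(C / (t + t₀) ^ (1 / k) / (k * (t + t₀)))) t := by
  have hT : 0 < t + t₀ := by linarith [H.one_lt]
  have hT' := Real.rpow_pos_of_pos hT (1 / k)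
  have hk := H.k_pos
  have h1 := ((hasDerivAt_id t).add_const t₀).rpow_const (p := 1 / k) (Or.inl hT.ne')
  refine ((h1.fun_inv hT'.ne').const_mul C |>.congr_deriv ?_)
  simp only [id, one_mul]
  rw [Real.rpow_sub_one hT.ne']
  field_simp

theorem continuousOn_coef (H : IsBarrierData k s C t₀ a a' h h') :
    ContinuousOn (fun z : ℝ × 𝔼 => C / (z.1 + t₀) ^ (1 / k)) (Ici 0 ×ˢ univ) :=
  ContinuousOn.comp (g := fun t => C / (t + t₀) ^ (1 / k)) (t := Ici 0)
    (fun _ ht => (H.hasDerivAt_coef ht).continuousAt.continuousWithinAt)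
    continuousOn_fst fun _ hz => hz.1

theorem continuousOn_posPart_rpow (H : IsBarrierData k s C t₀ a a' h h') {σ : ℝ} (hσ : 0 ≤ σ) :
    ContinuousOn (fun z : ℝ × 𝔼 => (max (a z.1 - h ‖z.2‖) 0) ^ σ) (Ici 0 ×ˢ univ) :=
  ((continuous_id.max continuous_const).comp_continuousOn H.continuousOn_gap).rpow_const fun _ _ => Or.inr hσ

theorem continuousOn_barrier (H : IsBarrierData k s C t₀ a a' h h') :
    ContinuousOn (fun z : ℝ × 𝔼 => radialBarrier k s C t₀ a h z.1 z.2) (Ici 0 ×ˢ univ) :=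
  H.continuousOn_coef.mul (H.continuousOn_posPart_rpow H.s_pos.le)

theorem barrier_nonneg (H : IsBarrierData k s C t₀ a a' h h') {t : ℝ} (ht : 0 ≤ t) (x : 𝔼) :
    0 ≤ radialBarrier k s C t₀ a h t x :=
  mul_nonneg (H.coef_pos ht).le (Real.rpow_nonneg (le_max_right _ _) _)

theorem a_pos (H : IsBarrierData k s C t₀ a a' h h') {t : ℝ} (ht : 0 ≤ t) : 0 < a t :=
  (H.profile.nonneg.trans_lt H.front).trans_le
    (H.strictMonoOn.monotoneOn (by simp) ht ht)

theorem barrier_le (H : IsBarrierData k s C t₀ a a' h h') :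
    ∃ B, 0 ≤ B ∧ ∀ t, 0 ≤ t → (∀ x : 𝔼, radialBarrier k s C t₀ a h t x ≤ B) ∧
      C / (t + t₀) ^ (1 / k) * a t ^ s ≤ B := by
  obtain ⟨B, hB⟩ := H.bdd
  have h0 : 0 ≤ B := (mul_pos (H.coef_pos le_rfl)
    (Real.rpow_pos_of_pos (H.a_pos le_rfl) s)).le.trans (hB 0 le_rfl)
  refine ⟨B, h0, fun t ht => ⟨fun x => le_trans ?_ (hB t ht), hB t ht⟩⟩
  refine mul_le_mul_of_nonneg_left (Real.rpow_le_rpow (le_max_right _ _) ?_ H.s_pos.le)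
    (H.coef_pos ht).le
  exact max_le (by linarith [H.profile.nonneg' (norm_nonneg x)]) (H.a_pos ht).le

/-- The front only advances, so the support at time `b` contains all earlier ones. This gives a
common ball for dominated convergence and for the boundary term of the comparison. -/
theorem exists_radius (H : IsBarrierData k s C t₀ a a' h h') (b : ℝ) :
    ∃ R, 0 < R ∧ ∀ t, 0 ≤ t → t ≤ b → ∀ r, R ≤ r → a t ≤ h r := by
  obtain ⟨R, hR⟩ := ((H.profile.tendsto.eventually_ge_atTop (a b)).and
    (eventually_gt_atTop 0)).exists
  refine ⟨R, hR.2, fun t ht htb r hr => ?_⟩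
  have h1 := H.strictMonoOn.monotoneOn ht (ht.trans htb) htb
  have h2 := H.profile.strictMonoOn.monotoneOn hR.2.le (hR.2.le.trans hr) hr
  linarith [hR.1]

theorem barrier_eq_zero (H : IsBarrierData k s C t₀ a a' h h') {t : ℝ} {x : 𝔼}
    (hx : a t ≤ h ‖x‖) : radialBarrier k s C t₀ a h t x = 0 := by
  rw [radialBarrier, max_eq_right (by linarith), Real.zero_rpow H.s_pos.ne', mul_zero]

theorem continuous_slice (H : IsBarrierData k s C t₀ a a' h h') {t : ℝ} (ht : 0 ≤ t) :
    Continuous (radialBarrier k s C t₀ a h t : 𝔼 → ℝ) :=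
  H.continuousOn_barrier.comp_continuous (f := fun x : 𝔼 => (t, x)) (by fun_prop)
    fun x => ⟨ht, mem_univ _⟩

variable {p m : ℝ} {g : ℝ → ℝ}

theorem memL1 (H : IsBarrierData k s C t₀ a a' h h') (hg : ContinuousOn g (Ici 0)) {t : ℝ}
    (ht : 0 ≤ t) : MemLp (radialBarrier k s C t₀ a h t) 1 (weightMeasure N g) := by
  rw [integrable_mul_weight_iff hg]
  obtain ⟨R, hR, hRt⟩ := H.exists_radius t
  refine integrable_of_continuousOn_of_isCompact (isCompact_closedBall (0 : 𝔼) R)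
    ((H.continuous_slice ht).mul (continuous_weight hg)).continuousOn fun x hx => ?_
  rw [Metric.mem_closedBall, dist_zero_right, not_le] at hx
  rw [H.barrier_eq_zero (hRt t ht le_rfl _ hx.le), zero_mul]

theorem continuousL1 (H : IsBarrierData k s C t₀ a a' h h') (hg : ContinuousOn g (Ici 0)) {t : ℝ}
    (ht : 0 ≤ t) :
    Tendsto (fun τ => eLpNorm (radialBarrier k s C t₀ a h τ - radialBarrier k s C t₀ a h t) 1
      (weightMeasure N g)) (𝓝[Ici 0] t) (𝓝 0) := by
  simp only [eLpNorm_weightMeasure hg]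
  obtain ⟨R, hR, hRt⟩ := H.exists_radius (t + 1)
  obtain ⟨B, hB0, hB⟩ := H.barrier_le (N := N)
  have hev : ∀ᶠ τ in 𝓝[Ici 0] t, 0 ≤ τ ∧ τ ≤ t + 1 := by
    filter_upwards [self_mem_nhdsWithin, mem_nhdsWithin_of_mem_nhds (Iic_mem_nhds (lt_add_one t))]
      with τ h1 h2 using ⟨h1, h2⟩
  rw [show (0 : ENNReal) = ∫⁻ _ : 𝔼, 0 by simp]
  refine tendsto_lintegral_filter_of_dominated_convergence
    ((Metric.closedBall (0 : 𝔼) R).indicator fun x => ‖B * weight g x‖ₑ) ?_ ?_ ?_ ?_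
  · filter_upwards [hev] with τ hτ
    exact (((H.continuous_slice hτ.1).sub (H.continuous_slice ht)).mul
      (continuous_weight hg)).enorm.measurable
  · filter_upwards [hev] with τ hτ
    refine ae_of_all _ fun x => ?_
    by_cases hx : x ∈ Metric.closedBall (0 : 𝔼) R
    · rw [indicator_of_mem hx]
      refine enorm_le_iff_norm_le.2 ?_
      rw [norm_mul, norm_mul]
      refine mul_le_mul_of_nonneg_right ?_ (norm_nonneg _)
      rw [Real.norm_of_nonneg hB0, Real.norm_eq_abs, Pi.sub_apply, abs_le]
      have b1 := H.barrier_nonneg hτ.1 x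
      have b2 := H.barrier_nonneg ht x
      have b3 := (hB τ hτ.1).1 x
      have b4 := (hB t ht).1 x
      constructor <;> linarith
    · rw [indicator_of_notMem hx]
      rw [Metric.mem_closedBall, dist_zero_right, not_le] at hx
      rw [Pi.sub_apply, H.barrier_eq_zero (hRt τ hτ.1 hτ.2 _ hx.le),
        H.barrier_eq_zero (hRt t ht (by linarith) _ hx.le)]
      simp
  · rw [lintegral_indicator Metric.isClosed_closedBall.measurableSet]
    exact ((continuous_const.mul (continuous_weight hg)).continuousOn.integrableOn_compact
      (isCompact_closedBall (0 : 𝔼) R)).2.ne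
  · refine ae_of_all _ fun x => ?_
    have h1 : ContinuousOn (fun τ => radialBarrier k s C t₀ a h τ x) (Ici 0) :=
      H.continuousOn_barrier.comp (f := fun τ : ℝ => (τ, x)) (by fun_prop)
        fun τ hτ => ⟨hτ, mem_univ _⟩
    have h2 := (((h1 t ht).tendsto.sub_const (radialBarrier k s C t₀ a h t x)).mul_const
      (weight g x)).enorm
    simpa using h2

theorem memLinfty (H : IsBarrierData k s C t₀ a a' h h') {T : ℝ} (hT : 0 < T) :
    MemLp (fun z : ℝ × 𝔼 => radialBarrier k s C t₀ a h z.1 z.2) ⊤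
      (volume.restrict {z | T < z.1}) := by
  obtain ⟨B, hB0, hB⟩ := H.barrier_le (N := N)
  have hS : MeasurableSet {z : ℝ × 𝔼 | T < z.1} :=
    (isOpen_lt continuous_const continuous_fst).measurableSet
  refine memLp_top_of_bound ((H.continuousOn_barrier.mono fun z hz =>
    ⟨(hT.trans hz).le, mem_univ _⟩).aestronglyMeasurable hS) B
    ((ae_restrict_iff' hS).2 (ae_of_all _ fun z hz => ?_))
  have hz0 : 0 ≤ z.1 := (hT.trans hz).le
  rw [Real.norm_of_nonneg (H.barrier_nonneg hz0 _)]
  exact (hB z.1 hz0).1 z.2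

theorem continuousOn_grad (H : IsBarrierData k s C t₀ a a' h h') {κ : ℝ} (hσ : 1 < s * κ) :
    ContinuousOn (barrierGrad k s C t₀ κ a h h' : ℝ × 𝔼 → 𝔼) (Ici 0 ×ˢ univ) :=
  (((H.continuousOn_coef.rpow_const fun z hz => Or.inl (H.coef_pos hz.1).ne').mul
    ((H.continuousOn_posPart_rpow (by linarith)).const_mul (s * κ))).neg).smul
    ((continuous_radialField H.profile.continuousOn' H.profile.zero).comp
      continuous_snd).continuousOn

theorem barrier_rpow (H : IsBarrierData k s C t₀ a a' h h') (κ : ℝ) {t : ℝ} (ht : 0 ≤ t) (x : 𝔼) :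
    radialBarrier k s C t₀ a h t x ^ κ =
      (C / (t + t₀) ^ (1 / k)) ^ κ * (max (a t - h ‖x‖) 0) ^ (s * κ) := by
  rw [radialBarrier, Real.mul_rpow (H.coef_pos ht).le (Real.rpow_nonneg (le_max_right _ _) _),
    ← Real.rpow_mul (le_max_right _ _)]

/-- The power `κ` raises the exponent of the gap from `s` to `s κ > 1`, so `u^κ` is continuously
differentiable in `x` across the front even if `u` is not. -/
theorem hasWeakSpaceGrad (H : IsBarrierData k s C t₀ a a' h h') {κ : ℝ} (hσ : 1 < s * κ) :
    HasWeakSpaceGrad (fun z : ℝ × 𝔼 => radialBarrier k s C t₀ a h z.1 z.2 ^ κ)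
      (barrierGrad k s C t₀ κ a h h') := by
  have hsub : halfSpace N ⊆ Ici 0 ×ˢ univ := fun z hz => ⟨mem_Ici.2 (le_of_lt (show 0 < z.1 from hz)), mem_univ _⟩
  have hκ : 0 < κ := (pos_iff_pos_of_mul_pos (by linarith)).1 H.s_pos
  refine hasWeakSpaceGrad_of_hasFDerivAt
    ((H.continuousOn_barrier.rpow_const fun _ _ => Or.inr hκ.le).mono hsub)
    ((H.continuousOn_grad hσ).mono hsub) fun t ht x => ?_
  simp only [H.barrier_rpow κ ht.le]
  have h1 := hasFDerivAt_comp_norm H.profile.continuousOn H.profile.continuousOn'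
    H.profile.hasDerivAt H.profile.zero x
  have h2 := ((hasDerivAt_posPart_rpow hσ (a t - h ‖x‖)).comp_hasFDerivAt x
    (h1.const_sub (a t))).const_mul ((C / (t + t₀) ^ (1 / k)) ^ κ)
  refine h2.congr_fderiv ?_
  ext y
  simp only [barrierGrad, smul_apply, innerSL_apply_apply, inner_smul_left, neg_apply, smul_eq_mul]
  simp
  ring

theorem isInClass (H : IsBarrierData k s C t₀ a a' h h') (hg : ContinuousOn g (Ici 0))
    (hσ : 1 < s * gradExponent p m) :
    IsInClass N p m g (radialBarrier k s C t₀ a h)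
      (barrierGrad k s C t₀ (gradExponent p m) a h h') where
  nonneg := fun _ ht => ae_of_all _ fun x => H.barrier_nonneg ht x
  memL1 := fun _ ht => H.memL1 hg ht
  continuousL1 := fun _ ht => H.continuousL1 hg ht
  memLinfty := fun _ hT => H.memLinfty hT
  weakGrad := H.hasWeakSpaceGrad hσ
  gradLp := fun K hK hKS => by
    have hc : ContinuousOn (barrierGrad k s C t₀ (gradExponent p m) a h h') K :=
      (H.continuousOn_grad hσ).mono fun z hz =>
        ⟨mem_Ici.2 (le_of_lt (show 0 < z.1 from hKS hz)), mem_univ _⟩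
    obtain ⟨c, hc'⟩ := hK.exists_bound_of_continuousOn hc
    have : IsFiniteMeasure ((volume : Measure (ℝ × 𝔼)).restrict K) :=
      ⟨by rw [Measure.restrict_apply_univ]; exact hK.measure_lt_top⟩
    exact MemLp.of_bound (hc.aestronglyMeasurable hK.measurableSet) c
      ((ae_restrict_iff' hK.measurableSet).2 (ae_of_all _ hc'))

theorem grad_eq_zero (hσ : 1 < s * gradExponent p m) {z : ℝ × 𝔼}
    (hz : a z.1 ≤ h ‖z.2‖) : barrierGrad k s C t₀ (gradExponent p m) a h h' z = 0 := by
  rw [barrierGrad, max_eq_right (by linarith), Real.zero_rpow (by linarith)]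
  simp

end IsBarrierData

end RadialBarrier

/-! ### Radial barriers: the time derivative. -/

section RadialTime

variable {N : ℕ}

local notation "𝔼" => EuclideanSpace ℝ (Fin N)

namespace IsBarrierData

variable {k s C t₀ : ℝ} {a a' h h' : ℝ → ℝ} {p m : ℝ} {g : ℝ → ℝ}

theorem isOpen_positivitySet (H : IsBarrierData k s C t₀ a a' h h') :
    IsOpen (positivitySet N a h) := by
  have h1 : ContinuousOn (fun z : ℝ × 𝔼 => a z.1 - h ‖z.2‖) (halfSpace N) :=
    H.continuousOn_gap.mono fun z hz => ⟨mem_Ici.2 (le_of_lt (show 0 < z.1 from hz)), mem_univ _⟩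
  have h2 := h1.isOpen_inter_preimage isOpen_halfSpace isOpen_Ioi (t := Ioi 0)
  convert h2 using 1
  ext z
  simp [positivitySet, halfSpace]

theorem aestronglyMeasurable_timeDeriv (H : IsBarrierData k s C t₀ a a' h h') :
    AEStronglyMeasurable (barrierTimeDeriv k s C t₀ a a' h : ℝ × 𝔼 → ℝ) volume := by
  have hO := (H.isOpen_positivitySet (N := N)).measurableSet
  rw [barrierTimeDeriv, aestronglyMeasurable_indicator_iff hO]
  have hsub : positivitySet N a h ⊆ Ici 0 ×ˢ univ := fun z hz =>
    ⟨mem_Ici.2 hz.1.le, mem_univ _⟩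
  have hgap := (H.continuousOn_gap (N := N)).mono hsub
  have hne : ∀ z ∈ positivitySet N a h, a z.1 - h ‖z.2‖ ≠ 0 ∨ 0 ≤ s - 1 := fun z hz =>
    Or.inl (sub_pos.2 hz.2).ne'
  have ha' : ContinuousOn (fun z : ℝ × 𝔼 => a' z.1) (positivitySet N a h) :=
    H.continuousOn'.comp continuousOn_fst fun z hz => (hsub hz).1
  refine ContinuousOn.aestronglyMeasurable ?_ hO
  refine (H.continuousOn_coef.mono hsub).mul ((((hgap.rpow_const hne).const_mul s).mul ha').sub
    ((hgap.rpow_const fun z hz => Or.inr H.s_pos.le).div (by fun_prop) fun z hz => ?_))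
  have h1 := H.k_pos
  have h2 := H.one_lt
  have h3 := hz.1
  positivity

/-- The factor `(a - h)^(s-1)` is singular at the front when `s < 1` and is kept apart; the rest is
bounded on a fixed ball. -/
theorem enorm_timeDeriv_le (H : IsBarrierData k s C t₀ a a' h h') (b : ℝ) :
    ∃ D R : ℝ, 0 ≤ D ∧ 0 < R ∧ ∀ t, 0 < t → t ≤ b → ∀ x : 𝔼,
      ‖barrierTimeDeriv k s C t₀ a a' h (t, x)‖ ≤
        D * (if h ‖x‖ < a t then (a t - h ‖x‖) ^ (s - 1) else 0) +
          (Metric.closedBall (0 : 𝔼) R).indicator (fun _ => D) x := by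
  obtain ⟨R, hR, hRt⟩ := H.exists_radius b
  obtain ⟨B, hB0, hB⟩ := H.barrier_le (N := N)
  have hc : ContinuousOn (fun t => C / (t + t₀) ^ (1 / k) * (s * a' t)) (Icc 0 b) :=
    (ContinuousOn.mul (fun t ht => (H.hasDerivAt_coef ht).continuousAt.continuousWithinAt)
      (H.continuousOn'.const_mul s)).mono Icc_subset_Ici_self
  obtain ⟨D, hD⟩ := isCompact_Icc.exists_bound_of_continuousOn hc
  have hk := H.k_pos
  have hs := H.s_pos
  have hB' : 0 ≤ B / k := by positivity
  refine ⟨max D 0 + B / k, R, by positivity, hR, fun t ht htb x => ?_⟩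
  by_cases hx : h ‖x‖ < a t
  swap
  · rw [barrierTimeDeriv, indicator_of_notMem (fun hz => hx hz.2), if_neg hx, norm_zero, mul_zero,
      zero_add]
    exact indicator_nonneg (fun _ _ => by positivity) x
  have hxR : x ∈ Metric.closedBall (0 : 𝔼) R := by
    rw [Metric.mem_closedBall, dist_zero_right]
    by_contra hcon
    exact absurd hx (not_lt.2 (hRt t ht.le htb _ (not_le.1 hcon).le))
  rw [barrierTimeDeriv, indicator_of_mem (show (t, x) ∈ positivitySet N a h from ⟨ht, hx⟩),
    if_pos hx, indicator_of_mem hxR]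
  have hA : 0 < a t - h ‖x‖ := sub_pos.2 hx
  have hA1 := Real.rpow_nonneg hA.le (s - 1)
  have hcoef := H.coef_pos ht.le
  have ha' := H.pos' t ht.le
  have hT : 1 ≤ t + t₀ := by linarith [H.one_lt]
  have e1 : C / (t + t₀) ^ (1 / k) * (s * a' t) ≤ max D 0 + B / k :=
    ((le_abs_self _).trans (hD t ⟨ht.le, htb⟩)).trans (by linarith [le_max_left D 0])
  have e2 : C / (t + t₀) ^ (1 / k) * (a t - h ‖x‖) ^ s ≤ B := by
    have := (hB t ht.le).1 x
    rwa [radialBarrier, max_eq_left hA.le] at this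
  have e3 : 0 ≤ (a t - h ‖x‖) ^ s := Real.rpow_nonneg hA.le _
  have e4 : C / (t + t₀) ^ (1 / k) * ((a t - h ‖x‖) ^ s / (k * (t + t₀))) ≤ max D 0 + B / k := by
    rw [mul_div_assoc', div_le_iff₀ (by positivity)]
    have e5 : B / k * (k * 1) ≤ (max D 0 + B / k) * (k * (t + t₀)) :=
      mul_le_mul (by linarith [le_max_right D 0]) (by gcongr) (by positivity) (by positivity)
    rw [mul_one, div_mul_cancel₀ _ hk.ne'] at e5
    exact e2.trans e5
  rw [mul_sub]
  refine (norm_sub_le _ _).trans (add_le_add ?_ ?_)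
  · rw [Real.norm_of_nonneg (by positivity)]
    calc _ = C / (t + t₀) ^ (1 / k) * (s * a' t) * (a t - h ‖x‖) ^ (s - 1) := by ring
      _ ≤ _ := mul_le_mul_of_nonneg_right e1 hA1
  · rw [Real.norm_of_nonneg (by positivity)]
    exact e4

/-- In polar coordinates the singular factor is controlled by `IsProfile.exists_integral_le`,
uniformly for heights in `[a 0, a b]`. The strict inequality `h 0 < a 0` provides the radius `r₁`
below every front. -/
theorem lintegral_timeDeriv_le (H : IsBarrierData k s C t₀ a a' h h') (hN : 0 < N) (b : ℝ) :
    ∃ D : NNReal, ∀ t, 0 < t → t ≤ b →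
      ∫⁻ x : 𝔼, ‖barrierTimeDeriv k s C t₀ a a' h (t, x)‖ₑ ≤ D := by
  have : NeZero N := ⟨hN.ne'⟩
  rcases lt_or_ge b 0 with hb | hb
  · exact ⟨0, fun t ht htb => absurd (ht.trans_le htb) (not_lt.2 hb.le)⟩
  obtain ⟨D, R, hD, hR, hbd⟩ := H.enorm_timeDeriv_le (N := N) b
  have hfr : ∀ᶠ r in 𝓝[Ioi 0] 0, h r < a 0 :=
    ((H.profile.continuousOn 0 (by simp)).mono Ioi_subset_Ici_self).eventually_lt_const H.front
  obtain ⟨r₁, hr₁a, hr₁⟩ := (hfr.and self_mem_nhdsWithin).exists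
  have hmono : ∀ t, 0 ≤ t → t ≤ b → a t ∈ Icc (a 0) (a b) := fun t ht htb =>
    ⟨H.strictMonoOn.monotoneOn (by simp) ht ht, H.strictMonoOn.monotoneOn ht (ht.trans htb) htb⟩
  obtain ⟨c, hc⟩ := H.profile.exists_integral_le H.s_pos (N - 1) hr₁ hr₁a (hmono b hb le_rfl).1
  set W := D * (N * ((volume : Measure 𝔼).real (Metric.ball 0 1) * c)) +
    D * (volume : Measure 𝔼).real (Metric.closedBall 0 R) with hW
  refine ⟨W.toNNReal, fun t ht htb => ?_⟩
  obtain ⟨hi, hle⟩ := hc (a t) (hmono t ht.le htb)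
  set F : ℝ → ℝ := fun r => if h r < a t then (a t - h r) ^ (s - 1) else 0 with hF
  have hi' : Integrable (fun x : 𝔼 => F ‖x‖) := by
    rw [integrable_fun_norm_addHaar]
    simpa [hF] using hi
  have hie := integral_fun_norm_addHaar (volume : Measure 𝔼) F
  have hF0 : ∀ r, 0 ≤ F r := fun r => by
    simp only [hF]
    split_ifs with hr
    · exact Real.rpow_nonneg (sub_pos.2 hr).le _
    · exact le_rfl
  have hball : MeasurableSet (Metric.closedBall (0 : 𝔼) R) := Metric.isClosed_closedBall.measurableSet
  have hi2 : Integrable ((Metric.closedBall (0 : 𝔼) R).indicator fun _ => D) :=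
    (integrable_indicator_iff hball).2 (integrableOn_const measure_closedBall_lt_top.ne)
  have hi3 := (hi'.const_mul D).add hi2
  calc ∫⁻ x : 𝔼, ‖barrierTimeDeriv k s C t₀ a a' h (t, x)‖ₑ
      ≤ ∫⁻ x : 𝔼, ENNReal.ofReal (D * F ‖x‖ + (Metric.closedBall (0 : 𝔼) R).indicator
          (fun _ => D) x) := by
        refine lintegral_mono fun x => ?_
        rw [← ofReal_norm]
        exact ENNReal.ofReal_le_ofReal (hbd t ht htb x)
    _ = ENNReal.ofReal (∫ x : 𝔼, (D * F ‖x‖ + (Metric.closedBall (0 : 𝔼) R).indicator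
          (fun _ => D) x)) := by
        refine (ofReal_integral_eq_lintegral_ofReal hi3 (ae_of_all _ fun x => ?_)).symm
        exact add_nonneg (mul_nonneg hD (hF0 _)) (indicator_nonneg (fun _ _ => hD) x)
    _ ≤ ENNReal.ofReal W := by
        refine ENNReal.ofReal_le_ofReal ?_
        rw [integral_add (hi'.const_mul D) hi2, integral_const_mul, hie, integral_indicator hball,
          setIntegral_const, hW]
        simp only [finrank_euclideanSpace, Fintype.card_fin, nsmul_eq_mul, smul_eq_mul]
        rw [mul_comm _ D]
        gcongr
    _ = _ := rfl

theorem locallyIntegrableOn_timeDeriv (H : IsBarrierData k s C t₀ a a' h h') (hN : 0 < N) :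
    LocallyIntegrableOn (barrierTimeDeriv k s C t₀ a a' h : ℝ × 𝔼 → ℝ) (halfSpace N) := by
  rw [locallyIntegrableOn_iff isOpen_halfSpace.isLocallyClosed]
  intro K hKS hK
  obtain ⟨b, hb⟩ := (hK.image continuous_fst).bddAbove
  obtain ⟨D, hD⟩ := H.lintegral_timeDeriv_le hN b
  have hm := H.aestronglyMeasurable_timeDeriv (N := N)
  have hsub : K ⊆ Ioc 0 b ×ˢ univ := fun z hz => ⟨⟨hKS hz, hb ⟨z, hz, rfl⟩⟩, mem_univ _⟩
  refine IntegrableOn.mono_set ⟨hm.restrict, ?_⟩ hsub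
  rw [HasFiniteIntegral]
  have hprod : (volume.restrict (Ioc 0 b ×ˢ univ) : Measure (ℝ × 𝔼)) =
      (volume.restrict (Ioc 0 b)).prod volume := by
    rw [Measure.volume_eq_prod, ← Measure.prod_restrict, Measure.restrict_univ]
  have hm' := hm.restrict (s := Ioc 0 b ×ˢ univ)
  rw [hprod] at hm' ⊢
  rw [lintegral_prod _ hm'.enorm]
  calc ∫⁻ t in Ioc 0 b, ∫⁻ x, ‖barrierTimeDeriv k s C t₀ a a' h (t, x)‖ₑ
      ≤ ∫⁻ t in Ioc 0 b, D := setLIntegral_mono measurable_const fun t ht => hD t ht.1 ht.2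
    _ < ⊤ := by
        rw [setLIntegral_const]
        exact ENNReal.mul_lt_top ENNReal.coe_lt_top measure_Ioc_lt_top

/-- As `a` is strictly increasing, the front passes each point `x` at most once. This is the only
time at which the classical derivative may fail to exist. -/
theorem hasWeakTimeDeriv (H : IsBarrierData k s C t₀ a a' h h') (hN : 0 < N) :
    HasWeakTimeDeriv (fun z : ℝ × 𝔼 => radialBarrier k s C t₀ a h z.1 z.2)
      (barrierTimeDeriv k s C t₀ a a' h) := by
  refine hasWeakTimeDeriv_of_hasDerivAt (H.continuousOn_barrier.mono fun z hz =>
    ⟨mem_Ici.2 (le_of_lt (show 0 < z.1 from hz)), mem_univ _⟩) (H.locallyIntegrableOn_timeDeriv hN)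
    fun x => ⟨{t | 0 < t ∧ a t = h ‖x‖}, ?_, fun t ht htS => ?_⟩
  · refine Subsingleton.countable fun t ht τ hτ => ?_
    exact H.strictMonoOn.injOn ht.1.le hτ.1.le (ht.2.trans hτ.2.symm)
  have hac : ContinuousAt a t := (H.hasDerivAt t ht.le).continuousAt
  have hne : a t ≠ h ‖x‖ := fun e => htS ⟨ht, e⟩
  rcases hne.lt_or_gt with hlt | hgt
  · rw [barrierTimeDeriv, indicator_of_notMem (fun hz => absurd hz.2 (not_lt.2 hlt.le))]
    refine (hasDerivAt_const t (0 : ℝ)).congr_of_eventuallyEq ?_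
    filter_upwards [hac.eventually_lt_const hlt] with τ hτ using H.barrier_eq_zero hτ.le
  · rw [barrierTimeDeriv, indicator_of_mem (show (t, x) ∈ positivitySet N a h from ⟨ht, hgt⟩)]
    have hA : 0 < a t - h ‖x‖ := sub_pos.2 hgt
    have h1 := (H.hasDerivAt_coef ht.le).mul (((H.hasDerivAt t ht.le).sub_const (h ‖x‖)).rpow_const
      (p := s) (Or.inl hA.ne'))
    refine (h1.congr_deriv ?_).congr_of_eventuallyEq ?_
    · ring
    · filter_upwards [hac.eventually_const_lt hgt] with τ hτ
      rw [radialBarrier, max_eq_left (sub_pos.2 hτ).le, Pi.mul_apply]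

theorem hasStrongTimeDeriv (H : IsBarrierData k s C t₀ a a' h h') (hg : ContinuousOn g (Ici 0))
    (hN : 0 < N) : HasStrongTimeDeriv N g (radialBarrier k s C t₀ a h) := by
  refine ⟨_, H.hasWeakTimeDeriv hN, fun α β hα K hK => ?_⟩
  obtain ⟨D, hD⟩ := H.lintegral_timeDeriv_le hN β
  obtain ⟨W, hW⟩ := hK.exists_bound_of_continuousOn (continuous_weight hg).continuousOn
  refine ⟨W.toNNReal * D, ae_of_all _ fun t ht => ?_⟩
  have hwm : Measurable fun x : 𝔼 => ENNReal.ofReal (weight g x) :=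
    (continuous_weight hg).measurable.ennreal_ofReal
  rw [weightMeasure, restrict_withDensity hK.measurableSet,
    lintegral_withDensity_eq_lintegral_mul_non_measurable _ hwm
      (ae_of_all _ fun x => ENNReal.ofReal_lt_top)]
  calc ∫⁻ x in K, ENNReal.ofReal (weight g x) *
        ‖barrierTimeDeriv k s C t₀ a a' h (t, x)‖ₑ
      ≤ ∫⁻ x in K, ENNReal.ofReal W * ‖barrierTimeDeriv k s C t₀ a a' h (t, x)‖ₑ := by
        refine setLIntegral_mono' hK.measurableSet fun x hx => ?_
        exact mul_le_mul_left (ENNReal.ofReal_le_ofReal ((le_abs_self _).trans (hW x hx))) _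
    _ ≤ ∫⁻ x, ENNReal.ofReal W * ‖barrierTimeDeriv k s C t₀ a a' h (t, x)‖ₑ :=
        setLIntegral_le_lintegral _ _
    _ = ENNReal.ofReal W * ∫⁻ x, ‖barrierTimeDeriv k s C t₀ a a' h (t, x)‖ₑ :=
        lintegral_const_mul' _ _ ENNReal.ofReal_ne_top
    _ ≤ ENNReal.ofReal W * D := by gcongr; exact hD t (hα.trans_le ht.1) ht.2
    _ = ((W.toNNReal * D : NNReal) : ENNReal) := by rw [ENNReal.coe_mul]; rfl

end IsBarrierData

end RadialTime

/-! ### From the pointwise differential inequality to a weak supersolution. -/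

section RadialSupersolution

variable {N : ℕ}

local notation "𝔼" => EuclideanSpace ℝ (Fin N)

namespace IsBarrierData

variable {C t₀ : ℝ} {a a' h h' : ℝ → ℝ} {p m : ℝ} {g : ℝ → ℝ}

theorem mul_gradExponent (hp : 1 < p) (hm : 0 < p + m - 3) :
    (p - 1) / (p + m - 3) * gradExponent p m = 1 + 1 / (p + m - 3) := by
  have h1 : p - 1 ≠ 0 := by linarith
  rw [gradExponent]
  field_simp
  ring

theorem one_lt_mul_gradExponent (hp : 1 < p) (hm : 0 < p + m - 3) :
    1 < (p - 1) / (p + m - 3) * gradExponent p m := by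
  rw [mul_gradExponent hp hm]
  linarith [one_div_pos.2 hm]

/-- The exponents fit because `κ (p - 1) = k + 1` and `(s κ - 1)(p - 1) = s`: the flux carries the
power `s` of the gap and the power `k + 1` of the amplitude. The normalization `κ^(1-p)` of the flux
cancels. -/
theorem flux_grad (H : IsBarrierData (p + m - 3) ((p - 1) / (p + m - 3)) C t₀ a a' h h')
    (hp : 1 < p) (hm : 0 < p + m - 3) {t r : ℝ} (ht : 0 ≤ t) (hr : 0 < r) {ω : 𝔼} (hω : ‖ω‖ = 1) :
    flux p m (barrierGrad (p + m - 3) ((p - 1) / (p + m - 3)) C t₀ (gradExponent p m) a h h'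
      (t, r • ω)) =
      -(((p - 1) / (p + m - 3)) ^ (p - 1) * (C / (t + t₀) ^ (1 / (p + m - 3))) ^ (p + m - 3 + 1) *
        (max (a t - h r) 0) ^ ((p - 1) / (p + m - 3)) * h' r ^ (p - 1)) • ω := by
  set k := p + m - 3 with hk
  set s := (p - 1) / k with hs
  set κ := gradExponent p m with hκ
  have hκ0 : 0 < κ := gradExponent_pos hp hm
  have hs0 : 0 < s := H.s_pos
  have hb := H.coef_pos ht
  set b := C / (t + t₀) ^ (1 / k)
  have hA : 0 ≤ max (a t - h r) 0 := le_max_right _ _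
  set A := max (a t - h r) 0
  have hh := (H.profile.pos r hr).le
  have hσ : s * κ - 1 = 1 / k := by rw [hs, hκ, mul_gradExponent hp hm]; ring
  have hnorm : ‖r • ω‖ = r := by rw [norm_smul, hω, mul_one, Real.norm_of_nonneg hr.le]
  set X := b ^ κ * (s * κ * A ^ (1 / k)) * h' r with hX
  have hX0 : 0 ≤ X := by positivity
  have hV : barrierGrad k s C t₀ κ a h h' (t, r • ω) = -(X • ω) := by
    simp only [barrierGrad, radialField, hnorm, hσ, smul_smul, hX, neg_mul, neg_smul]
    congr 2
    rw [mul_assoc, div_mul_cancel₀ _ hr.ne']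
    exact (mul_assoc (b ^ κ) (s * κ * A ^ (1 / k)) (h' r)).symm
  have hXn : ‖-(X • ω)‖ = X := by
    rw [norm_neg, norm_smul, hω, mul_one, Real.norm_of_nonneg hX0]
  rw [hV, flux, hXn, smul_neg, smul_smul, neg_smul]
  congr 2
  have e1 : X ^ (p - 2) * X = X ^ (p - 1) := by
    rcases hX0.eq_or_lt with h0 | h0
    · rw [← h0, mul_zero, Real.zero_rpow (by linarith)]
    · rw [← Real.rpow_add_one h0.ne']
      congr 1
      ring
  rw [mul_assoc, e1, hX, Real.mul_rpow (by positivity) hh, Real.mul_rpow (by positivity)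
    (by positivity), Real.mul_rpow (by positivity) (by positivity), Real.mul_rpow hs0.le hκ0.le,
    ← Real.rpow_mul hb.le, ← Real.rpow_mul hA]
  have e2 : κ * (p - 1) = k + 1 := by
    rw [hκ, gradExponent, div_mul_cancel₀ _ (by linarith)]
    ring
  have e3 : 1 / k * (p - 1) = s := by rw [hs]; ring
  have e4 : gradExponent p m ^ (1 - p) * κ ^ (p - 1) = 1 := by
    rw [← hκ, ← Real.rpow_add hκ0]
    simp
  rw [e2, e3]
  calc _ = (gradExponent p m ^ (1 - p) * κ ^ (p - 1)) *
        (s ^ (p - 1) * b ^ (k + 1) * A ^ s * h' r ^ (p - 1)) := by ring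
    _ = _ := by rw [e4, one_mul]

/-- The integral inequality for the barrier along a ray. -/
theorem integral_ray_nonneg
    (H : IsBarrierData (p + m - 3) ((p - 1) / (p + m - 3)) C t₀ a a' h h')
    (hp : 1 < p) (hm : 0 < p + m - 3) (hN : 0 < N) (hg : ContinuousOn g (Ici 0)) {g' Q' : ℝ → ℝ}
    (hgd : ∀ r, 0 < r → HasDerivAt g (g' r) r)
    (hQ : ∀ r, 0 < r → HasDerivWithinAt (fun r => h' r ^ (p - 1)) (Q' r) (Ioi r) r)
    {t : ℝ} (ht : 0 < t)
    (hineq : ∀ r, 0 < r → h r < a t → 0 ≤ ((p - 1) / (p + m - 3)) ^ (p - 1) * C ^ (p + m - 3) *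
      (-((p - 1) / (p + m - 3) * h' r * h' r ^ (p - 1)) +
        (a t - h r) * (Q' r + g' r * h' r ^ (p - 1) + (N - 1) * h' r ^ (p - 1) / r)) +
      (p - 1) / (p + m - 3) * (t + t₀) * a' t - (a t - h r) / (p + m - 3))
    {η : ℝ × 𝔼 → ℝ} (hη : IsTest η) (hη0 : ∀ z, 0 ≤ η z) {ω : 𝔼} (hω : ‖ω‖ = 1) :
    0 ≤ ∫ r in Ioi (0 : ℝ), r ^ (N - 1) *
      ((barrierTimeDeriv (p + m - 3) ((p - 1) / (p + m - 3)) C t₀ a a' h (t, r • ω) *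
          η (t, r • ω) +
        inner ℝ (flux p m (barrierGrad (p + m - 3) ((p - 1) / (p + m - 3)) C t₀
          (gradExponent p m) a h h' (t, r • ω))) (spaceGrad η (t, r • ω))) *
        weight g (r • ω)) := by
  set k := p + m - 3 with hk
  set s := (p - 1) / k with hs
  have hs0 : 0 < s := H.s_pos
  have hb := H.coef_pos ht.le
  set b := C / (t + t₀) ^ (1 / k) with hbdef
  set d := s ^ (p - 1) with hd
  have hd0 : 0 < d := Real.rpow_pos_of_pos hs0 _
  set φ : ℝ → ℝ := fun r => r ^ (N - 1) *
    ((barrierTimeDeriv k s C t₀ a a' h (t, r • ω) * η (t, r • ω) +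
      inner ℝ (flux p m (barrierGrad k s C t₀ (gradExponent p m) a h h' (t, r • ω)))
        (spaceGrad η (t, r • ω))) * weight g (r • ω)) with hφ
  by_cases hint : IntegrableOn φ (Ioi 0)
  swap
  · rw [integral_undef hint]
  have hfront : h 0 < a t := H.front.trans_le (H.strictMonoOn.monotoneOn (by simp) ht.le ht.le)
  obtain ⟨ρ, hρ, hρa⟩ := H.profile.exists_eq le_rfl hfront
  have hlt : ∀ r, 0 ≤ r → (h r < a t ↔ r < ρ) := fun r hr => by
    rw [← hρa]
    exact H.profile.strictMonoOn.lt_iff_lt hr hρ.le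
  have hnorm : ∀ r : ℝ, 0 ≤ r → ‖r • ω‖ = r := fun r hr => by
    rw [norm_smul, hω, mul_one, Real.norm_of_nonneg hr]
  have hηd : ∀ r : ℝ, HasDerivAt (fun r : ℝ => η (t, r • ω))
      (inner ℝ ω (spaceGrad η (t, r • ω))) r := by
    intro r
    have h1 : HasDerivAt (fun r : ℝ => ((t, r • ω) : ℝ × 𝔼)) (0, ω) r :=
      (hasDerivAt_const r t).prodMk (by simpa using (hasDerivAt_id r).smul_const ω)
    have h2 := (hη.differentiable (t, r • ω)).hasFDerivAt.comp_hasDerivAt r h1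
    rwa [← inner_spaceGrad (hη.differentiable (t, r • ω)), real_inner_comm] at h2
  -- the flux across spheres
  set P : ℝ → ℝ := fun r => d * b ^ (k + 1) * (a t - h r) ^ s * h' r ^ (p - 1) *
    (Real.exp (g r) * r ^ (N - 1)) with hP
  have hout : ∀ r ∈ Ioi 0 \ Ioc 0 ρ, φ r = 0 := by
    intro r hr
    have hr0 : 0 < r := hr.1
    have hrρ : ρ ≤ r := (not_le.1 fun h => hr.2 ⟨hr0, h⟩).le
    have h1 : ¬ h r < a t := fun h => absurd ((hlt r hr0.le).1 h) (not_lt.2 hrρ)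
    simp only [hφ]
    rw [H.flux_grad hp hm ht.le hr0 hω, max_eq_right (by linarith [not_lt.1 h1]),
      Real.zero_rpow hs0.ne', barrierTimeDeriv, indicator_of_notMem fun hz => h1 (by
        have := hz.2
        rwa [hnorm r hr0.le] at this)]
    simp
  rw [setIntegral_eq_of_subset_of_forall_sdiff_eq_zero measurableSet_Ioi Ioc_subset_Ioi_self hout,
    ← intervalIntegral.integral_of_le hρ.le]
  have hPc : ContinuousOn P (Icc 0 ρ) := by
    have hsub : Icc 0 ρ ⊆ Ici 0 := fun x hx => hx.1
    refine ((continuousOn_const.mul ((continuousOn_const.sub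
      (H.profile.continuousOn.mono hsub)).rpow_const fun _ _ => Or.inr hs0.le)).mul
      ((H.profile.continuousOn'.mono hsub).rpow_const fun _ _ => Or.inr (by linarith))).mul
      ((Real.continuous_exp.comp_continuousOn (hg.mono hsub)).mul (continuousOn_pow _))
  have hηc : Continuous fun r : ℝ => η (t, r • ω) :=
    continuous_iff_continuousAt.2 fun r => (hηd r).continuousAt
  have hder : ∀ r ∈ Ioo 0 ρ, HasDerivWithinAt (fun r => -(P r * η (t, r • ω)))
      (-(d * b ^ (k + 1) * (Real.exp (g r) * r ^ (N - 1)) *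
        (-(s * (a t - h r) ^ (s - 1) * h' r) * h' r ^ (p - 1) + (a t - h r) ^ s *
          (Q' r + g' r * h' r ^ (p - 1) + (N - 1) * h' r ^ (p - 1) / r)) * η (t, r • ω) +
        P r * inner ℝ ω (spaceGrad η (t, r • ω)))) (Ioi r) r := by
    intro r hr
    have hA : 0 < a t - h r := sub_pos.2 ((hlt r hr.1.le).2 hr.2)
    have h1 := (((H.profile.hasDerivAt r hr.1).const_sub (a t)).rpow_const (p := s)
      (Or.inl hA.ne')).hasDerivWithinAt (s := Ioi r)
    have h2 := ((hgd r hr.1).exp.mul (hasDerivAt_pow (N - 1) r)).hasDerivWithinAt (s := Ioi r)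
    have h3 := (((h1.const_mul (d * b ^ (k + 1))).mul (hQ r hr.1)).mul h2).mul
      (hηd r).hasDerivWithinAt |>.neg
    refine h3.congr_deriv ?_
    -- For `N = 1` the truncated exponent is harmless, since the factor `N - 1` vanishes on both
    -- sides.
    have e1 : ((N - 1 : ℕ) : ℝ) * r ^ (N - 1 - 1) = (N - 1) * r ^ (N - 1) / r := by
      rcases Nat.exists_eq_add_of_le' hN with ⟨n, rfl⟩
      rcases n with _ | n
      · simp
      · have := hr.1.ne'
        simp only [Nat.add_sub_cancel]
        push_cast
        field_simp
        ring
    simp only [Pi.mul_apply, hP]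
    rw [e1]
    ring
  have hle : ∀ r ∈ Ioo 0 ρ, -(d * b ^ (k + 1) * (Real.exp (g r) * r ^ (N - 1)) *
        (-(s * (a t - h r) ^ (s - 1) * h' r) * h' r ^ (p - 1) + (a t - h r) ^ s *
          (Q' r + g' r * h' r ^ (p - 1) + (N - 1) * h' r ^ (p - 1) / r)) * η (t, r • ω) +
        P r * inner ℝ ω (spaceGrad η (t, r • ω))) ≤ φ r := by
    intro r hr
    have hht : h r < a t := (hlt r hr.1.le).2 hr.2
    have hA : 0 < a t - h r := sub_pos.2 hht
    have hT : 0 < t + t₀ := by linarith [H.one_lt]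
    have hin := hineq r hr.1 hht
    -- The decay exponent `1 / k` gives the diffusion term the same power of `t + t₀` as the
    -- derivative of the amplitude, so that `b A^(s-1) / (t + t₀)` factors out of all terms.
    have e2 : b ^ (k + 1) = b * C ^ k / (t + t₀) := by
      rw [Real.rpow_add_one hb.ne', hbdef, Real.div_rpow H.C_pos.le (Real.rpow_nonneg hT.le _),
        ← Real.rpow_mul hT.le, one_div_mul_cancel H.k_pos.ne', Real.rpow_one]
      ring
    have e3 : (a t - h r) ^ s = (a t - h r) ^ (s - 1) * (a t - h r) := by
      rw [← Real.rpow_add_one hA.ne']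
      congr 1
      ring
    simp only [hφ]
    rw [H.flux_grad hp hm ht.le hr.1 hω, max_eq_left hA.le, barrierTimeDeriv, indicator_of_mem
      (show (t, r • ω) ∈ positivitySet N a h from ⟨ht, by rwa [hnorm r hr.1.le]⟩),
      inner_smul_left, weight]
    simp only [hnorm r hr.1.le, hP, ← hbdef]
    rw [e2, e3]
    set A := a t - h r with hAdef
    set q := h' r ^ (p - 1)
    have hk0 := H.k_pos
    have hpos : 0 ≤ (b * A ^ (s - 1) * (Real.exp (g r) * r ^ (N - 1)) * η (t, r • ω) / (t + t₀)) *
        (d * C ^ k * (-(s * h' r * q) + A * (Q' r + g' r * q + (N - 1) * q / r)) +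
          s * (t + t₀) * a' t - A / k) := by
      have := hη0 (t, r • ω)
      have := hr.1
      have := Real.rpow_nonneg hA.le (s - 1)
      exact mul_nonneg (by positivity) hin
    simp only [conj_trivial]
    refine sub_nonneg.1 (le_of_le_of_eq hpos ?_)
    have hr0 := hr.1.ne'
    field_simp
    ring
  -- Right derivatives suffice here, which permits a kink of `h' ^ (p - 1)`. The integral dominates
  -- the increment of `-P η`, and this is zero: the gap vanishes at `ρ` and `h'` vanishes at the
  -- origin.
  have key := intervalIntegral.sub_le_integral_of_hasDeriv_right_of_le hρ.le
    (hPc.mul hηc.continuousOn).neg hder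
    ((integrableOn_Icc_iff_integrableOn_Ioc (by simp)).2 (hint.mono_set Ioc_subset_Ioi_self)) hle
  have z1 : P ρ = 0 := by simp [hP, hρa, Real.zero_rpow hs0.ne']
  have z2 : P 0 = 0 := by
    simp [hP, H.profile.zero, Real.zero_rpow (show p - 1 ≠ 0 by linarith)]
  simp only [Pi.neg_apply, Pi.mul_apply, z1, z2, zero_mul, neg_zero, sub_self] at key
  exact key

/-- A pointwise differential inequality makes the barrier a strong supersolution. -/
theorem weakForm_nonneg
    (H : IsBarrierData (p + m - 3) ((p - 1) / (p + m - 3)) C t₀ a a' h h')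
    (hp : 1 < p) (hm : 0 < p + m - 3) (hN : 0 < N) (hg : ContinuousOn g (Ici 0)) {g' Q' : ℝ → ℝ}
    (hgd : ∀ r, 0 < r → HasDerivAt g (g' r) r)
    (hQ : ∀ r, 0 < r → HasDerivWithinAt (fun r => h' r ^ (p - 1)) (Q' r) (Ioi r) r)
    (hineq : ∀ t, 0 < t → ∀ r, 0 < r → h r < a t →
      0 ≤ ((p - 1) / (p + m - 3)) ^ (p - 1) * C ^ (p + m - 3) *
      (-((p - 1) / (p + m - 3) * h' r * h' r ^ (p - 1)) +
        (a t - h r) * (Q' r + g' r * h' r ^ (p - 1) + (N - 1) * h' r ^ (p - 1) / r)) +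
      (p - 1) / (p + m - 3) * (t + t₀) * a' t - (a t - h r) / (p + m - 3))
    {η : ℝ × 𝔼 → ℝ} (hη : IsTest η) (hη0 : ∀ z, 0 ≤ η z) :
    0 ≤ weakForm p m g (radialBarrier (p + m - 3) ((p - 1) / (p + m - 3)) C t₀ a h)
      (barrierGrad (p + m - 3) ((p - 1) / (p + m - 3)) C t₀ (gradExponent p m) a h h') η := by
  rw [weakForm_eq hg (H.isInClass hg (one_lt_mul_gradExponent hp hm)) (H.hasWeakTimeDeriv hN) hη]
  set Φ : ℝ × 𝔼 → ℝ := fun z =>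
    (barrierTimeDeriv (p + m - 3) ((p - 1) / (p + m - 3)) C t₀ a a' h z * η z +
      inner ℝ (flux p m (barrierGrad (p + m - 3) ((p - 1) / (p + m - 3)) C t₀
        (gradExponent p m) a h h' z)) (spaceGrad η z)) * weight g z.2 with hΦ
  by_cases hi : Integrable Φ
  swap
  · rw [integral_undef hi]
  rw [Measure.volume_eq_prod] at hi ⊢
  rw [integral_prod _ hi]
  refine integral_nonneg fun t => ?_
  rcases le_or_gt t 0 with ht | ht
  · refine le_of_eq (integral_eq_zero_of_ae (ae_of_all _ fun x => ?_)).symm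
    have hz : (t, x) ∉ tsupport η := fun h => absurd (hη.support h) (not_lt.2 ht)
    simp only [hΦ, Pi.zero_apply]
    rw [image_eq_zero_of_notMem_tsupport hz, spaceGrad_eq_zero_of_notMem hz]
    simp
  · exact integral_nonneg_of_rays hN fun ω hω =>
      H.integral_ray_nonneg hp hm hN hg hgd hQ ht (hineq t ht) hη hη0 hω

end IsBarrierData

end RadialSupersolution

/-! ### The concrete profile `h` and its slope. -/

section BarrierProfile

variable {p α₁ α₂ r₀ : ℝ} {g : ℝ → ℝ}

theorem rpow_div_rpow_eq {r c : ℝ} (hp : 1 < p) (hr : 0 ≤ r) (hc : 0 ≤ c) :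
    (r ^ p / c) ^ (1 / (p - 1)) = r * (r / c) ^ (1 / (p - 1)) := by
  have h1 : r ^ p / c = r ^ (p - 1) * (r / c) := by
    rw [← rpow_sub_one_mul_self hr hp]
    ring
  rw [h1, Real.mul_rpow (Real.rpow_nonneg hr _) (div_nonneg hr hc), ← Real.rpow_mul hr,
    mul_one_div_cancel (by linarith), Real.rpow_one]

theorem hasDerivAt_rpow_div_rpow {γ : ℝ → ℝ} {γ' r : ℝ} (hp : 1 < p) (hr : 0 < r)
    (hγ : HasDerivAt γ γ' r) (h0 : 0 < γ r) :
    HasDerivAt (fun r => (r ^ p / γ r) ^ (1 / (p - 1)))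
      ((r / γ r) ^ (1 / (p - 1)) * ((p - r * γ' / γ r) / (p - 1))) r := by
  have hrp := Real.rpow_pos_of_pos hr p
  have hJ : 0 < r ^ p / γ r := div_pos hrp h0
  have h1 := ((Real.hasDerivAt_rpow_const (p := p) (Or.inl hr.ne')).fun_div hγ h0.ne').rpow_const
    (p := 1 / (p - 1)) (Or.inl hJ.ne')
  refine h1.congr_deriv ?_
  rw [Real.rpow_sub_one hJ.ne', rpow_div_rpow_eq hp hr.le h0.le, Real.rpow_sub_one hr.ne']
  have hp1 : p - 1 ≠ 0 := by linarith
  field_simp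

/-- The outer part `J^(1/(p-1))` of the radial profile. -/
def outerProfile (p : ℝ) (g : ℝ → ℝ) (r : ℝ) : ℝ := bigJ p g r ^ (1 / (p - 1))

/-- The elasticity `g / G` of the weight exponent. -/
def elasticity (g : ℝ → ℝ) (r : ℝ) : ℝ := g r / bigG g r

/-- The radial profile of the barrier. -/
def profile (p : ℝ) (g : ℝ → ℝ) (r₀ : ℝ) (r : ℝ) : ℝ :=
  if r₀ ≤ r then bigJ p g r ^ (1 / (p - 1)) else bigI p g r₀ (1 - elasticity g r₀ / p) r

/-- The derivative of `profile`. -/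
def profileSlope (p : ℝ) (g : ℝ → ℝ) (r₀ : ℝ) (r : ℝ) : ℝ :=
  (r / bigG g (max r r₀)) ^ (1 / (p - 1)) * ((p - elasticity g (max r r₀)) / (p - 1))

theorem elasticity_mem (hα : 0 < α₁) (hg : IsPowerlike α₁ α₂ g) {r : ℝ} (hr : 0 < r) :
    elasticity g r ∈ Icc α₁ α₂ := by
  have := hg.bigG_pos hα hr
  exact ⟨(le_div_iff₀ this).2 (hg.mul_bigG_le hα hr.le), (div_le_iff₀ this).2 (hg.le_mul_bigG hα hr.le)⟩

theorem hasDerivAt_elasticity (hα : 0 < α₁) (hg : IsPowerlike α₁ α₂ g) {r : ℝ} (hr : 0 < r) :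
    HasDerivAt (elasticity g) (elasticity g r / r * (r * deriv g r / g r - elasticity g r)) r := by
  have hG := hg.bigG_pos hα hr
  have hgr := hg.pos r hr
  refine ((hg.hasDerivAt hr).div (hg.hasDerivAt_bigG hα hr) hG.ne').congr_deriv ?_
  simp only [elasticity]
  field_simp

theorem hasDerivAt_outerProfile (hp : 1 < p) (hα : 0 < α₁) (hg : IsPowerlike α₁ α₂ g) {r : ℝ}
    (hr : 0 < r) : HasDerivAt (outerProfile p g)
      ((r / bigG g r) ^ (1 / (p - 1)) * ((p - elasticity g r) / (p - 1))) r := by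
  have := hasDerivAt_rpow_div_rpow hp hr (hg.hasDerivAt_bigG hα hr) (hg.bigG_pos hα hr)
  rwa [mul_div_cancel₀ _ hr.ne'] at this

theorem outerProfile_eq (hp : 1 < p) (hα : 0 < α₁) (hg : IsPowerlike α₁ α₂ g) {r : ℝ}
    (hr : 0 < r) : outerProfile p g r = r * (r / bigG g r) ^ (1 / (p - 1)) :=
  rpow_div_rpow_eq hp hr.le (hg.bigG_pos hα hr).le

theorem outerProfile_pos (hα : 0 < α₁) (hg : IsPowerlike α₁ α₂ g) {r : ℝ}
    (hr : 0 < r) : 0 < outerProfile p g r :=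
  Real.rpow_pos_of_pos (div_pos (Real.rpow_pos_of_pos hr p) (hg.bigG_pos hα hr)) _

/-- The logarithmic derivative of `outerProfile` is `(p - θ) / (p - 1)` divided by `r`, with `θ = g
/ G ≤ α₂`. Since `α₂ < p` in the application, the profile then grows at least like a positive power.
-/
theorem mul_rpow_le_outerProfile (hp : 1 < p) (hα : 0 < α₁) (hg : IsPowerlike α₁ α₂ g) {s r : ℝ}
    (hs : 0 < s) (hsr : s ≤ r) :
    outerProfile p g s * (r / s) ^ ((p - α₂) / (p - 1)) ≤ outerProfile p g r := by
  refine mul_rpow_le_of_le_deriv (fun x hx => hasDerivAt_outerProfile hp hα hg hx)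
    (fun x hx => ?_) hs hsr
  rw [outerProfile_eq hp hα hg hx, mul_div_cancel_left₀ _ hx.ne', mul_comm]
  have h1 := (elasticity_mem hα hg hx).2
  have h2 := (hg.bigG_pos hα hx).le
  have hp1 : 0 < p - 1 := by linarith
  gcongr

theorem outerProfile_lt (hp : 1 < p) (hα : 0 < α₁) (hα₂ : α₂ < p) (hg : IsPowerlike α₁ α₂ g)
    {s r : ℝ} (hs : 0 < s) (hsr : s < r) : outerProfile p g s < outerProfile p g r := by
  refine lt_of_lt_of_le ?_ (mul_rpow_le_outerProfile hp hα hg hs hsr.le)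
  refine lt_mul_of_one_lt_right (outerProfile_pos hα hg hs)
    (Real.one_lt_rpow ((one_lt_div hs).2 hsr) (div_pos (by linarith) (by linarith)))

theorem outerProfile_le (hp : 1 < p) (hα : 0 < α₁) (hα₂ : α₂ < p) (hg : IsPowerlike α₁ α₂ g)
    {s r : ℝ} (hs : 0 < s) (hsr : s ≤ r) : outerProfile p g s ≤ outerProfile p g r := by
  rcases hsr.eq_or_lt with rfl | h
  · exact le_rfl
  · exact (outerProfile_lt hp hα hα₂ hg hs h).le

theorem tendsto_outerProfile (hp : 1 < p) (hα : 0 < α₁) (hα₂ : α₂ < p)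
    (hg : IsPowerlike α₁ α₂ g) : Tendsto (outerProfile p g) atTop atTop := by
  refine tendsto_atTop_mono' atTop ?_ ((tendsto_rpow_atTop
    (show 0 < (p - α₂) / (p - 1) from div_pos (by linarith) (by linarith))).const_mul_atTop
    (outerProfile_pos (p := p) hα hg one_pos))
  filter_upwards [eventually_ge_atTop 1] with r hr
  simpa using mul_rpow_le_outerProfile hp hα hg one_pos hr

theorem profile_of_le {r : ℝ} (hr : r₀ ≤ r) : profile p g r₀ r = outerProfile p g r := if_pos hr

theorem bigI_self (ν : ℝ) : bigI p g r₀ ν r₀ = outerProfile p g r₀ := by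
  rw [bigI, outerProfile, bigJ]
  ring

theorem profile_of_ge {r : ℝ} (hr : r ≤ r₀) :
    profile p g r₀ r = bigI p g r₀ (1 - elasticity g r₀ / p) r := by
  rcases hr.eq_or_lt with rfl | hr
  · rw [profile_of_le le_rfl, bigI_self]
  · exact if_neg (not_le.2 hr)

/-- The value `1 - θ(r₀) / p` of `ν₀`, with `θ = g / G`, makes the slopes match at `r₀`: the inner
branch has slope `(r / G(r₀))^(1/(p-1)) (p - θ(r₀)) / (p - 1)`, so one formula in `max r r₀` covers
both branches. -/
theorem isProfile (hp : 1 < p) (hα : 0 < α₁) (hα₂ : α₂ < p) (hg : IsPowerlike α₁ α₂ g)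
    (hr₀ : 0 < r₀) : IsProfile (profile p g r₀) (profileSlope p g r₀) := by
  have hG := hg.bigG_pos hα hr₀
  have hp1 : 0 < p - 1 := by linarith
  have hm0 : ∀ r, 0 < max r r₀ := fun r => hr₀.trans_le (le_max_right _ _)
  have hθ0 := elasticity_mem hα hg hr₀
  have hd : ∀ r, 0 < r → HasDerivAt (profile p g r₀) (profileSlope p g r₀ r) r := by
    intro r hr
    have hI : r ≤ r₀ → HasDerivAt (fun r => bigI p g r₀ (1 - elasticity g r₀ / p) r)
        (profileSlope p g r₀ r) r := by
      intro hle
      have h1 := ((hasDerivAt_rpow_div_rpow hp hr (hasDerivAt_const r (bigG g r₀)) hG).const_mul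
        (1 - elasticity g r₀ / p)).add_const
          ((1 - (1 - elasticity g r₀ / p)) * bigJ p g r₀ ^ (1 / (p - 1)))
      refine h1.congr_deriv ?_
      rw [profileSlope, max_eq_right hle]
      field_simp
      ring
    have hH : r₀ ≤ r → HasDerivAt (outerProfile p g) (profileSlope p g r₀ r) r := by
      intro hle
      rw [profileSlope, max_eq_left hle]
      exact hasDerivAt_outerProfile hp hα hg hr
    rcases lt_trichotomy r r₀ with hlt | heq | hgt
    · refine (hI hlt.le).congr_of_eventuallyEq ?_
      filter_upwards [Iio_mem_nhds hlt] with x hx using profile_of_ge (le_of_lt hx)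
    · subst heq
      have h1 : HasDerivWithinAt (profile p g r) (profileSlope p g r r) (Iic r) r :=
        (hI le_rfl).hasDerivWithinAt.congr (fun x hx => profile_of_ge hx)
          (profile_of_ge le_rfl)
      have h2 : HasDerivWithinAt (profile p g r) (profileSlope p g r r) (Ici r) r :=
        (hH le_rfl).hasDerivWithinAt.congr (fun x hx => profile_of_le hx) (profile_of_le le_rfl)
      have := h1.union h2
      rwa [Iic_union_Ici, hasDerivWithinAt_univ] at this
    · refine (hH hgt.le).congr_of_eventuallyEq ?_
      filter_upwards [Ioi_mem_nhds hgt] with x hx using profile_of_le (le_of_lt hx)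
  refine ⟨?_, ?_, hd, ?_, ?_, ?_, ?_⟩
  · intro r hr
    rcases (mem_Ici.1 hr).eq_or_lt with rfl | hr
    · have hI : ContinuousAt (fun r => bigI p g r₀ (1 - elasticity g r₀ / p) r) 0 := by
        have h1 : Continuous fun r : ℝ => (r ^ p / bigG g r₀) ^ (1 / (p - 1)) :=
          ((continuous_id.rpow_const fun _ => Or.inr (by linarith)).div_const _).rpow_const
            fun _ => Or.inr (by positivity)
        exact ((h1.const_mul (1 - elasticity g r₀ / p)).add continuous_const).continuousAt
      refine (hI.congr ?_).continuousWithinAt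
      filter_upwards [Iio_mem_nhds hr₀] with x hx using (profile_of_ge (le_of_lt hx)).symm
    · exact (hd r hr).continuousAt.continuousWithinAt
  · have hmc : ContinuousOn (fun r => max r r₀) (Ici 0) := by fun_prop
    have hGc : ContinuousOn (fun r => bigG g (max r r₀)) (Ici 0) :=
      (hg.bigG_isPowerlike hα).continuousOn.comp hmc fun r _ => (hm0 r).le
    have hgc : ContinuousOn (fun r => g (max r r₀)) (Ici 0) :=
      hg.continuousOn.comp hmc fun r _ => (hm0 r).le
    have hGn : ∀ r ∈ Ici (0 : ℝ), bigG g (max r r₀) ≠ 0 := fun r _ => (hg.bigG_pos hα (hm0 r)).ne'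
    exact ((continuousOn_id.div hGc hGn).rpow_const fun _ _ => Or.inr (by positivity)).mul
      ((continuousOn_const.sub (hgc.div hGc hGn)).div_const _)
  · rw [profileSlope, zero_div, Real.zero_rpow (by positivity), zero_mul]
  · intro r hr
    have h1 := (elasticity_mem hα hg (hm0 r)).2
    have h2 := hg.bigG_pos hα (hm0 r)
    exact mul_pos (Real.rpow_pos_of_pos (div_pos hr h2) _) (div_pos (by linarith) hp1)
  · rw [profile_of_ge hr₀.le, bigI, Real.zero_rpow (by linarith), zero_div,
      Real.zero_rpow (by positivity), mul_zero, zero_add, sub_sub_cancel]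
    have h1 := hθ0.1
    have h2 := outerProfile_pos (p := p) hα hg hr₀
    exact mul_nonneg (div_nonneg (by linarith) (by linarith)) h2.le
  · refine (tendsto_outerProfile hp hα hα₂ hg).congr' ?_
    filter_upwards [eventually_ge_atTop r₀] with r hr using (profile_of_le hr).symm

/-- The right derivative of `profileSlope ^ (p - 1)`. -/
def slopeDeriv (p : ℝ) (g : ℝ → ℝ) (r₀ : ℝ) (r : ℝ) : ℝ :=
  profileSlope p g r₀ r ^ (p - 1) / r *
    if r₀ ≤ r then 1 - elasticity g r -
      (p - 1) * (elasticity g r * (r * deriv g r / g r - elasticity g r)) / (p - elasticity g r)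
    else 1

theorem profileSlope_rpow (hp : 1 < p) (hα : 0 < α₁) (hα₂ : α₂ < p) (hg : IsPowerlike α₁ α₂ g)
    (hr₀ : 0 < r₀) {r : ℝ} (hr : 0 ≤ r) : profileSlope p g r₀ r ^ (p - 1) =
      r / bigG g (max r r₀) * ((p - elasticity g (max r r₀)) / (p - 1)) ^ (p - 1) := by
  have hm0 : 0 < max r r₀ := hr₀.trans_le (le_max_right _ _)
  have h1 := (elasticity_mem hα hg hm0).2
  have h2 := hg.bigG_pos hα hm0
  have h3 : 0 ≤ r / bigG g (max r r₀) := div_nonneg hr h2.le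
  have hp1 : 0 < p - 1 := by linarith
  rw [profileSlope, Real.mul_rpow (Real.rpow_nonneg h3 _) (div_nonneg (by linarith) hp1.le),
    ← Real.rpow_mul h3, one_div_mul_cancel hp1.ne', Real.rpow_one]

/-- Inside, the power of the slope is linear in `r`; outside, it contains `θ = g / G`, whose
derivative can create a kink at `r₀`. There the right derivative is that of the outer branch. -/
theorem hasDerivWithinAt_slope (hp : 1 < p) (hα : 0 < α₁) (hα₂ : α₂ < p)
    (hg : IsPowerlike α₁ α₂ g) (hr₀ : 0 < r₀) {r : ℝ} (hr : 0 < r) :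
    HasDerivWithinAt (fun r => profileSlope p g r₀ r ^ (p - 1)) (slopeDeriv p g r₀ r) (Ioi r) r := by
  have hp1 : 0 < p - 1 := by linarith
  rcases lt_or_ge r r₀ with hlt | hge
  · have h1 : HasDerivAt (fun x => x / bigG g r₀ *
        ((p - elasticity g r₀) / (p - 1)) ^ (p - 1)) (slopeDeriv p g r₀ r) r := by
      refine (((hasDerivAt_id r).div_const _).mul_const _).congr_deriv ?_
      rw [slopeDeriv, if_neg (not_le.2 hlt), profileSlope_rpow hp hα hα₂ hg hr₀ hr.le,
        max_eq_right hlt.le]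
      field_simp
    refine (h1.congr_of_eventuallyEq ?_).hasDerivWithinAt
    filter_upwards [Iio_mem_nhds hlt, Ioi_mem_nhds hr] with x hx hx0
    rw [profileSlope_rpow hp hα hα₂ hg hr₀ (le_of_lt hx0), max_eq_right (le_of_lt hx)]
  · have hG := hg.bigG_pos hα hr
    have hθ := (elasticity_mem hα hg hr).2
    have he : 0 < p - elasticity g r := by linarith
    have hgr := hg.pos r hr
    have h1 : HasDerivAt (fun x => x / bigG g x *
        ((p - elasticity g x) / (p - 1)) ^ (p - 1)) (slopeDeriv p g r₀ r) r := by
      have d1 := (hasDerivAt_id r).div (hg.hasDerivAt_bigG hα hr) hG.ne'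
      have d2 := (((hasDerivAt_elasticity hα hg hr).const_sub p).div_const (p - 1)).rpow_const
        (p := p - 1) (Or.inl (div_pos he hp1).ne')
      refine (d1.mul d2).congr_deriv ?_
      rw [slopeDeriv, if_pos hge, profileSlope_rpow hp hα hα₂ hg hr₀ hr.le, max_eq_left hge,
        Real.rpow_sub_one (div_pos he hp1).ne' (p - 1)]
      set X := ((p - elasticity g r) / (p - 1)) ^ (p - 1)
      have hgG : g r = elasticity g r * bigG g r := by
        rw [elasticity, div_mul_cancel₀ _ hG.ne']
      simp only [Pi.div_apply, id]
      set D := r * deriv g r / g r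
      rw [hgG]
      set θ := elasticity g r
      field_simp
      ring
    refine h1.hasDerivWithinAt.congr (fun x hx => ?_) ?_
    · have hx' : r < x := hx
      rw [profileSlope_rpow hp hα hα₂ hg hr₀ (hr.trans hx').le, max_eq_left (hge.trans hx'.le)]
    · rw [profileSlope_rpow hp hα hα₂ hg hr₀ hr.le, max_eq_left hge]

/-- Both `g / G` and `r g' / g` are at most `α₂`, so this term costs at most a constant times
`h'^(p-1) / r`. The term `g' h'^(p-1)` compensates for it when `g(r₀)` is large. -/
theorem le_slopeDeriv (hp : 1 < p) (hα : 0 < α₁) (hα₂ : α₂ < p) (hα₁₂ : α₁ ≤ α₂)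
    (hg : IsPowerlike α₁ α₂ g) (hr₀ : 0 < r₀) {r : ℝ} (hr : r₀ ≤ r) :
    -(α₂ + (p - 1) * α₂ ^ 2 / (p - α₂)) * (profileSlope p g r₀ r ^ (p - 1) / r) ≤
      slopeDeriv p g r₀ r := by
  have hr' : 0 < r := hr₀.trans_le hr
  have hp1 : 0 < p - 1 := by linarith
  have hq : 0 ≤ profileSlope p g r₀ r ^ (p - 1) / r :=
    div_nonneg (Real.rpow_nonneg ((isProfile hp hα hα₂ hg hr₀).pos r hr').le _) hr'.le
  rw [slopeDeriv, if_pos hr, mul_comm]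
  refine mul_le_mul_of_nonneg_left ?_ hq
  obtain ⟨h1, h2⟩ := elasticity_mem hα hg hr'
  have hgr := hg.pos r hr'
  set θ := elasticity g r
  have h3 : r * deriv g r / g r ≤ α₂ := by
    rw [div_le_iff₀ hgr]
    have := mul_le_mul_of_nonneg_left (hg.upper r hr') hr'.le
    rwa [mul_div_assoc', mul_div_cancel₀ _ hr'.ne'] at this
  have h4 : θ * (r * deriv g r / g r - θ) ≤ α₂ ^ 2 := by
    have : r * deriv g r / g r - θ ≤ α₂ := by linarith
    rcases le_total 0 (r * deriv g r / g r - θ) with h | h <;> nlinarith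
  have h5 : (p - 1) * (θ * (r * deriv g r / g r - θ)) / (p - θ) ≤ (p - 1) * α₂ ^ 2 / (p - α₂) := by
    have e1 : 0 < p - α₂ := by linarith
    have e2 : p - α₂ ≤ p - θ := by linarith
    refine div_le_div₀ (by positivity) (mul_le_mul_of_nonneg_left h4 hp1.le) e1 e2
  linarith

end BarrierProfile

/-! ### The differential inequality for the barrier. -/

section BarrierInequality

variable {p α₁ α₂ r₀ : ℝ} {g : ℝ → ℝ}

/-- The differential inequality near the origin. -/
theorem barrier_inequality_inner (hp : 1 < p) (hα : 0 < α₁) (hα₂ : α₂ < p)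
    (hg : IsPowerlike α₁ α₂ g) (hr₀ : 0 < r₀) {n k s Λ A τ r : ℝ} (hn : 1 ≤ n) (hs : 0 < s)
    (hΛ : 0 ≤ Λ) (hτ : 0 ≤ τ)
    (hK : 2 / k ≤ Λ * (((p - elasticity g r₀) / (p - 1)) ^ (p - 1) / bigG g r₀))
    (hA : 2 * s * profileSlope p g r₀ r₀ * r₀ ≤ A) (hA0 : 0 ≤ A) (hr : 0 < r) (hrr : r < r₀) :
    0 ≤ Λ * (-(s * profileSlope p g r₀ r * profileSlope p g r₀ r ^ (p - 1)) +
      A * (slopeDeriv p g r₀ r + deriv g r * profileSlope p g r₀ r ^ (p - 1) +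
        (n - 1) * profileSlope p g r₀ r ^ (p - 1) / r)) + s * τ - A / k := by
  have hp1 : 0 < p - 1 := by linarith
  have hG := hg.bigG_pos hα hr₀
  have hθ := (elasticity_mem hα hg hr₀).2
  have he : 0 < (p - elasticity g r₀) / (p - 1) := div_pos (by linarith) hp1
  set K := ((p - elasticity g r₀) / (p - 1)) ^ (p - 1) / bigG g r₀ with hKdef
  have hK0 : 0 < K := div_pos (Real.rpow_pos_of_pos he _) hG
  -- Because `h'^(p-1)` is linear, its divergence is at least `K`. One half of `A K` absorbs the
  -- gradient term, as the gap `A` is large, and the other half covers `A / k`, as `Λ K ≥ 2 / k`.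
  have hq : profileSlope p g r₀ r ^ (p - 1) = K * r := by
    rw [profileSlope_rpow hp hα hα₂ hg hr₀ hr.le, max_eq_right hrr.le, hKdef]
    ring
  have hq' : slopeDeriv p g r₀ r = K := by
    rw [slopeDeriv, if_neg (not_le.2 hrr), hq, mul_one, mul_div_cancel_right₀ _ hr.ne']
  have hS0 : 0 < profileSlope p g r₀ r := (isProfile hp hα hα₂ hg hr₀).pos r hr
  have hS : profileSlope p g r₀ r ≤ profileSlope p g r₀ r₀ := by
    rw [profileSlope, profileSlope, max_eq_right hrr.le, max_self]
    have h1 := hr.le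
    have h2 := hrr.le
    gcongr
  rw [hq, hq']
  have hg' := (hg.deriv_pos hα hr).le
  have hS1 := hS0.trans_le hS
  have e1 : s * profileSlope p g r₀ r * (K * r) ≤ A * K / 2 := by
    calc s * profileSlope p g r₀ r * (K * r)
        ≤ s * profileSlope p g r₀ r₀ * (K * r₀) := by gcongr
      _ = (2 * s * profileSlope p g r₀ r₀ * r₀) * K / 2 := by ring
      _ ≤ A * K / 2 := by gcongr
  have e2 : A * K ≤ A * (K + deriv g r * (K * r) + (n - 1) * (K * r) / r) := by
    refine mul_le_mul_of_nonneg_left ?_ hA0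
    have h1 : 0 ≤ deriv g r * (K * r) := by positivity
    have h2 : 0 ≤ (n - 1) * (K * r) / r :=
      div_nonneg (mul_nonneg (by linarith) (by positivity)) hr.le
    linarith
  have e3 : A / k ≤ Λ * (A * K / 2) := by
    have := mul_le_mul_of_nonneg_left hK hA0
    have h3 : A * (2 / k) = 2 * (A / k) := by ring
    have h4 : A * (Λ * K) = 2 * (Λ * (A * K / 2)) := by ring
    linarith
  have e4 : Λ * (A * K / 2) ≤ Λ * (-(s * profileSlope p g r₀ r * (K * r)) +
      A * (K + deriv g r * (K * r) + (n - 1) * (K * r) / r)) :=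
    mul_le_mul_of_nonneg_left (by linarith) hΛ
  have e5 : 0 ≤ s * τ := by positivity
  linarith

/-- The differential inequality away from the origin. -/
theorem barrier_inequality_outer (hp : 1 < p) (hα : 0 < α₁) (hα₁₂ : α₁ ≤ α₂) (hα₂ : α₂ < p)
    (hg : IsPowerlike α₁ α₂ g) (hr₀ : 0 < r₀) {n k s Λ Γ τ r ρ : ℝ} (hn : 1 ≤ n) (hs : 0 < s)
    (hk : 0 < k) (hΛ : 0 ≤ Λ) (hΓ : 0 ≤ Γ)
    (hτ : Γ * ((p - α₂) / (p - 1)) * (outerProfile p g ρ / g ρ) ≤ τ)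
    (hc₁ : 2 * (α₂ + (p - 1) * α₂ ^ 2 / (p - α₂)) ≤ α₁ * g r₀)
    (hc₂ : 4 * s * (p / (p - 1)) ≤ (2 ^ ((p - α₂) / (p - 1)) - 1) * (α₁ * g r₀))
    (hc₃ : 4 / k ≤ Λ * (α₁ * (α₁ * ((p - α₂) / (p - 1)) ^ (p - 1))))
    (hc₄ : Λ * ((p / (p - 1)) ^ p * (2 ^ α₂ * α₂)) ≤ Γ * ((p - α₂) / (p - 1)))
    (hr : r₀ ≤ r) (hrρ : outerProfile p g r < outerProfile p g ρ) (hρ : 0 < ρ) :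
    0 ≤ Λ * (-(s * profileSlope p g r₀ r * profileSlope p g r₀ r ^ (p - 1)) +
      (outerProfile p g ρ - outerProfile p g r) *
        (slopeDeriv p g r₀ r + deriv g r * profileSlope p g r₀ r ^ (p - 1) +
        (n - 1) * profileSlope p g r₀ r ^ (p - 1) / r)) + s * τ -
      (outerProfile p g ρ - outerProfile p g r) / k := by
  have hp1 : 0 < p - 1 := by linarith
  have hr' : 0 < r := hr₀.trans_le hr
  have hlt : r < ρ := by
    by_contra hcon
    exact absurd hrρ (not_lt.2 (outerProfile_le hp hα hα₂ hg hρ (not_lt.1 hcon)))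
  have hG := hg.bigG_pos hα hr'
  have hGρ := hg.bigG_pos hα hρ
  have hgr := hg.pos r hr'
  have hgρ := hg.pos ρ hρ
  have hH := outerProfile_pos (p := p) hα hg hr'
  have hHρ := outerProfile_pos (p := p) hα hg hρ
  have hslope : profileSlope p g r₀ r = outerProfile p g r / r *
      ((p - elasticity g r) / (p - 1)) := by
    rw [profileSlope, max_eq_left hr, outerProfile_eq hp hα hg hr', mul_div_cancel_left₀ _ hr'.ne']
  have hq : profileSlope p g r₀ r ^ (p - 1) =
      r / bigG g r * ((p - elasticity g r) / (p - 1)) ^ (p - 1) := by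
    rw [profileSlope_rpow hp hα hα₂ hg hr₀ hr'.le, max_eq_left hr]
  have hsd := le_slopeDeriv hp hα hα₂ hα₁₂ hg hr₀ hr
  obtain ⟨hθ1, hθ2⟩ := elasticity_mem hα hg hr'
  have hgG : g r = elasticity g r * bigG g r := by rw [elasticity, div_mul_cancel₀ _ hG.ne']
  set e₀ := (p - α₂) / (p - 1) with he₀
  set e₁ := p / (p - 1) with he₁
  set e := (p - elasticity g r) / (p - 1) with he
  have he₀p : 0 < e₀ := div_pos (by linarith) hp1
  have hee₀ : e₀ ≤ e := div_le_div_of_nonneg_right (by linarith) hp1.le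
  have hee₁ : e ≤ e₁ := div_le_div_of_nonneg_right (by linarith) hp1.le
  have hep : 0 < e := he₀p.trans_le hee₀
  set q := profileSlope p g r₀ r ^ (p - 1) with hqdef
  set H := outerProfile p g r with hHdef
  set Hρ := outerProfile p g ρ
  set K₀ := α₂ + (p - 1) * α₂ ^ 2 / (p - α₂)
  -- All terms are measured in units of `X = e^(p-1) / G`: the derivative of `q` is at least `-K₀
  -- X`, the weight contributes `g' q ≥ α₁ g X`, and the gradient term is `s H e X`.
  set X := q / r with hXdef
  have hqX : q = X * r := by rw [hXdef, div_mul_cancel₀ _ hr'.ne']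
  have hX : X = e ^ (p - 1) / bigG g r := by
    rw [hXdef, hq]
    field_simp
  have hX0 : 0 ≤ X := by rw [hX]; positivity
  have hA : 0 < Hρ - H := sub_pos.2 hrρ
  set A := Hρ - H with hAdef
  have hgmono : g r₀ ≤ g r := (hg.le_iff hα hr₀.le hr'.le).2 hr
  have hXg : α₁ * e₀ ^ (p - 1) ≤ X * g r := by
    rw [hX, hgG]
    have := hα.le.trans hθ1
    calc α₁ * e₀ ^ (p - 1) ≤ elasticity g r * e ^ (p - 1) := by gcongr
      _ = _ := by field_simp
  have hlow : α₁ * g r ≤ r * deriv g r := by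
    have := mul_le_mul_of_nonneg_left (hg.lower r hr') hr'.le
    rwa [mul_left_comm, mul_div_cancel₀ _ hr'.ne'] at this
  -- the zero order terms
  have hzero : X * (α₁ * g r / 2) ≤ slopeDeriv p g r₀ r + deriv g r * q + (n - 1) * q / r := by
    have h1 : 0 ≤ (n - 1) * q / r := by
      rw [mul_div_assoc]
      exact mul_nonneg (by linarith) hX0
    have h2 : X * (α₁ * g r / 2) ≤ X * (-K₀ + r * deriv g r) := by
      refine mul_le_mul_of_nonneg_left ?_ hX0
      have := mul_le_mul_of_nonneg_left hgmono hα.le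
      linarith
    have h3 : deriv g r * q = X * (r * deriv g r) := by rw [hqX]; ring
    linarith
  have hzero' := mul_le_mul_of_nonneg_left hzero hA.le
  have hfirst : s * profileSlope p g r₀ r * q = s * (H * e * X) := by
    rw [hslope, hqX]
    field_simp
  rw [hfirst]
  -- The zero order terms supply twice the quantity on the right. One copy pays for `A / k`, since
  -- `X g` is bounded below by the comparability of `g` and `G`; the other one remains available for
  -- the gradient term.
  have hmain : A / k ≤ Λ * (A * (X * (α₁ * g r / 4))) := by
    have h1 : Λ * (α₁ * (α₁ * e₀ ^ (p - 1))) ≤ Λ * (α₁ * (X * g r)) := by gcongr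
    have h2 := mul_le_mul_of_nonneg_left (hc₃.trans h1) hA.le
    have h3 : A * (4 / k) = 4 * (A / k) := by ring
    have h4 : A * (Λ * (α₁ * (X * g r))) = 4 * (Λ * (A * (X * (α₁ * g r / 4)))) := by ring
    linarith
  have hτ0 : 0 ≤ s * τ := mul_nonneg hs.le (le_trans (by positivity) hτ)
  rcases le_or_gt (2 * r) ρ with hcase | hcase
  · -- far from the front the diffusion wins
    have hδ : H * 2 ^ e₀ ≤ Hρ := by
      refine le_trans ?_ (mul_rpow_le_outerProfile hp hα hg hr' hlt.le)
      refine mul_le_mul_of_nonneg_left (Real.rpow_le_rpow (by norm_num) ?_ he₀p.le) hH.le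
      rwa [le_div_iff₀ hr']
    have hδ0 : 0 < (2 : ℝ) ^ e₀ - 1 := sub_pos.2 (Real.one_lt_rpow one_lt_two he₀p)
    have hAδ : ((2 : ℝ) ^ e₀ - 1) * H ≤ A := by linarith
    have h1 : s * (H * e * X) ≤ A * (X * (α₁ * g r / 4)) := by
      have h2 : s * e * 4 ≤ (2 ^ e₀ - 1) * (α₁ * g r) := by
        calc s * e * 4 ≤ s * e₁ * 4 := by gcongr
          _ = 4 * s * e₁ := by ring
          _ ≤ (2 ^ e₀ - 1) * (α₁ * g r₀) := hc₂
          _ ≤ (2 ^ e₀ - 1) * (α₁ * g r) := by gcongr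
      calc s * (H * e * X) = (s * e * 4) * (H * X / 4) := by ring
        _ ≤ ((2 ^ e₀ - 1) * (α₁ * g r)) * (H * X / 4) := by gcongr
        _ = ((2 ^ e₀ - 1) * H) * (X * (α₁ * g r / 4)) := by ring
        _ ≤ A * (X * (α₁ * g r / 4)) := by gcongr
    have h2 : Λ * (A * (X * (α₁ * g r / 4))) ≤ Λ * (-(s * (H * e * X)) +
        A * (slopeDeriv p g r₀ r + deriv g r * q + (n - 1) * q / r)) := by
      refine mul_le_mul_of_nonneg_left ?_ hΛ
      have : A * (X * (α₁ * g r / 2)) = 2 * (A * (X * (α₁ * g r / 4))) := by ring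
      linarith
    linarith
  · -- near the front the motion of the front wins
    have h1 : g ρ ≤ 2 ^ α₂ * α₂ * bigG g r := by
      calc g ρ ≤ α₂ * bigG g ρ := hg.le_mul_bigG hα hρ.le
        _ ≤ α₂ * (bigG g r * (ρ / r) ^ α₂) := by
            have := (hg.bigG_isPowerlike hα).le_mul_rpow hr' hlt.le
            have := hα.trans_le hα₁₂
            gcongr
        _ ≤ α₂ * (bigG g r * 2 ^ α₂) := by
            have := hα.trans_le hα₁₂
            gcongr
            rw [div_le_iff₀ hr']
            exact hcase.le
        _ = _ := by ring
    have hα₂0 := hα.trans_le hα₁₂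
    -- Within a factor `2` of the front radius, `g ρ` is at most a multiple of `G(r)`. Hence the
    -- gradient term has at most the size `Hρ / g ρ` of the front speed, and `Γ` beats the constant.
    have h2 : H * e * X ≤ e₁ ^ p * (2 ^ α₂ * α₂) * (Hρ / g ρ) := by
      calc H * e * X = H * (e ^ (p - 1) * e) / bigG g r := by rw [hX]; ring
        _ = H * e ^ p / bigG g r := by rw [rpow_sub_one_mul_self hep.le hp]
        _ ≤ Hρ * e₁ ^ p / bigG g r := by gcongr
        _ ≤ Hρ * e₁ ^ p / (g ρ / (2 ^ α₂ * α₂)) := by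
            have : 0 < e₁ := hep.trans_le hee₁
            gcongr
            rw [div_le_iff₀ (by positivity), mul_comm]
            exact h1
        _ = _ := by field_simp
    have h3 : Λ * (s * (H * e * X)) ≤ s * τ := by
      calc Λ * (s * (H * e * X)) ≤ Λ * (s * (e₁ ^ p * (2 ^ α₂ * α₂) * (Hρ / g ρ))) := by gcongr
        _ = s * (Λ * (e₁ ^ p * (2 ^ α₂ * α₂)) * (Hρ / g ρ)) := by ring
        _ ≤ s * (Γ * e₀ * (Hρ / g ρ)) := by gcongr
        _ ≤ s * τ := by gcongr
    have h4 : Λ * (A * (X * (α₁ * g r / 2))) ≤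
        Λ * (A * (slopeDeriv p g r₀ r + deriv g r * q + (n - 1) * q / r)) :=
      mul_le_mul_of_nonneg_left hzero' hΛ
    have h5 : Λ * (A * (X * (α₁ * g r / 2))) = 2 * (Λ * (A * (X * (α₁ * g r / 4)))) := by ring
    have h6 : 0 ≤ A / k := by positivity
    have h7 : Λ * (-(s * (H * e * X)) + A * (slopeDeriv p g r₀ r + deriv g r * q +
        (n - 1) * q / r)) = -(Λ * (s * (H * e * X))) +
        Λ * (A * (slopeDeriv p g r₀ r + deriv g r * q + (n - 1) * q / r)) := by ring
    linarith

end BarrierInequality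

/-! ### Motion of the front. -/

section Front

variable {p α₁ α₂ Γ t₀ : ℝ} {g : ℝ → ℝ}

/-- The position of the front. -/
def frontRadius (g : ℝ → ℝ) (t₀ Γ t : ℝ) : ℝ := inv (bigG g) (Γ * Real.log (t + t₀))

/-- The height of the front function, `E(Γ log (t + t₀))^(1/(p-1))`. -/
def frontHeight (p : ℝ) (g : ℝ → ℝ) (t₀ Γ t : ℝ) : ℝ :=
  bigE p g (Γ * Real.log (t + t₀)) ^ (1 / (p - 1))

/-- The time derivative of `frontHeight`. -/
def frontSlope (p : ℝ) (g : ℝ → ℝ) (t₀ Γ t : ℝ) : ℝ :=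
  outerProfile p g (frontRadius g t₀ Γ t) * ((p - elasticity g (frontRadius g t₀ Γ t)) / (p - 1)) *
    (Γ / (g (frontRadius g t₀ Γ t) * (t + t₀)))

theorem frontHeight_eq (t : ℝ) :
    frontHeight p g t₀ Γ t = outerProfile p g (frontRadius g t₀ Γ t) := rfl

theorem log_arg_pos (hΓ : 0 < Γ) (ht₀ : 1 < t₀) {t : ℝ} (ht : 0 ≤ t) :
    0 < Γ * Real.log (t + t₀) :=
  mul_pos hΓ (Real.log_pos (by linarith))

theorem frontRadius_pos (hα : 0 < α₁) (hg : IsPowerlike α₁ α₂ g) (hΓ : 0 < Γ) (ht₀ : 1 < t₀)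
    {t : ℝ} (ht : 0 ≤ t) : 0 < frontRadius g t₀ Γ t :=
  (hg.bigG_isPowerlike hα).inv_pos hα (log_arg_pos hΓ ht₀ ht)

theorem bigG_frontRadius (hα : 0 < α₁) (hg : IsPowerlike α₁ α₂ g) (hΓ : 0 < Γ) (ht₀ : 1 < t₀)
    {t : ℝ} (ht : 0 ≤ t) : bigG g (frontRadius g t₀ Γ t) = Γ * Real.log (t + t₀) :=
  (hg.bigG_isPowerlike hα).apply_inv hα (log_arg_pos hΓ ht₀ ht).le

theorem hasDerivAt_frontRadius (hα : 0 < α₁) (hg : IsPowerlike α₁ α₂ g) (hΓ : 0 < Γ)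
    (ht₀ : 1 < t₀) {t : ℝ} (ht : 0 ≤ t) : HasDerivAt (frontRadius g t₀ Γ)
      (frontRadius g t₀ Γ t * (Γ / (g (frontRadius g t₀ Γ t) * (t + t₀)))) t := by
  have h1 := (hg.bigG_isPowerlike hα).hasDerivAt_inv hα (log_arg_pos hΓ ht₀ ht)
  have hρ := frontRadius_pos hα hg hΓ ht₀ ht
  have hT : 0 < t + t₀ := by linarith
  have h2 := (((hasDerivAt_id t).add_const t₀).log hT.ne').const_mul Γ
  refine (h1.comp t h2).congr_deriv ?_
  change (deriv (bigG g) (frontRadius g t₀ Γ t))⁻¹ * _ = _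
  rw [hg.deriv_bigG hα hρ]
  have := (hg.pos _ hρ).ne'
  simp only [id]
  field_simp

theorem hasDerivAt_frontHeight (hp : 1 < p) (hα : 0 < α₁) (hg : IsPowerlike α₁ α₂ g) (hΓ : 0 < Γ)
    (ht₀ : 1 < t₀) {t : ℝ} (ht : 0 ≤ t) :
    HasDerivAt (frontHeight p g t₀ Γ) (frontSlope p g t₀ Γ t) t := by
  have hρ := frontRadius_pos hα hg hΓ ht₀ ht
  refine ((hasDerivAt_outerProfile hp hα hg hρ).comp t
    (hasDerivAt_frontRadius hα hg hΓ ht₀ ht)).congr_deriv ?_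
  rw [frontSlope, outerProfile_eq hp hα hg hρ]
  ring

theorem frontSlope_pos (hp : 1 < p) (hα : 0 < α₁) (hα₂ : α₂ < p) (hg : IsPowerlike α₁ α₂ g)
    (hΓ : 0 < Γ) (ht₀ : 1 < t₀) {t : ℝ} (ht : 0 ≤ t) : 0 < frontSlope p g t₀ Γ t := by
  have hρ := frontRadius_pos hα hg hΓ ht₀ ht
  have h1 := (elasticity_mem hα hg hρ).2
  have h2 := hg.pos _ hρ
  have hT : 0 < t + t₀ := by linarith
  exact mul_pos (mul_pos (outerProfile_pos hα hg hρ) (div_pos (by linarith) (by linarith)))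
    (by positivity)

/-- The front follows `G(ρ) = Γ log(t + t₀)`, so multiplying the slope by `t + t₀` removes the
explicit time. This gives the contribution, proportional to `Γ`, that controls the barrier near its
front. -/
theorem le_mul_frontSlope (hp : 1 < p) (hα : 0 < α₁) (hg : IsPowerlike α₁ α₂ g)
    (hΓ : 0 < Γ) (ht₀ : 1 < t₀) {t : ℝ} (ht : 0 ≤ t) :
    Γ * ((p - α₂) / (p - 1)) *
      (outerProfile p g (frontRadius g t₀ Γ t) / g (frontRadius g t₀ Γ t)) ≤
      (t + t₀) * frontSlope p g t₀ Γ t := by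
  have hρ := frontRadius_pos hα hg hΓ ht₀ ht
  have h1 := (elasticity_mem hα hg hρ).2
  have h2 := hg.pos _ hρ
  have h3 := outerProfile_pos (p := p) hα hg hρ
  have hT : 0 < t + t₀ := by linarith
  have hp1 : 0 < p - 1 := by linarith
  have e : (t + t₀) * frontSlope p g t₀ Γ t = Γ *
      ((p - elasticity g (frontRadius g t₀ Γ t)) / (p - 1)) *
      (outerProfile p g (frontRadius g t₀ Γ t) / g (frontRadius g t₀ Γ t)) := by
    rw [frontSlope]
    field_simp
  rw [e]
  gcongr

theorem continuousOn_frontSlope (hp : 1 < p) (hα : 0 < α₁) (hg : IsPowerlike α₁ α₂ g)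
    (hΓ : 0 < Γ) (ht₀ : 1 < t₀) : ContinuousOn (frontSlope p g t₀ Γ) (Ici 0) := by
  intro t ht
  have hρ := frontRadius_pos hα hg hΓ ht₀ ht
  have hc := (hasDerivAt_frontRadius hα hg hΓ ht₀ ht).continuousAt
  have hT : 0 < t + t₀ := by linarith [mem_Ici.1 ht]
  have h2 := hg.pos _ hρ
  refine ContinuousAt.continuousWithinAt ?_
  have c1 : ContinuousAt (fun t => outerProfile p g (frontRadius g t₀ Γ t)) t :=
    ContinuousAt.comp (hasDerivAt_outerProfile hp hα hg hρ).continuousAt hc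
  have c2 : ContinuousAt (fun t => elasticity g (frontRadius g t₀ Γ t)) t :=
    ContinuousAt.comp (hasDerivAt_elasticity hα hg hρ).continuousAt hc
  have c3 : ContinuousAt (fun t => g (frontRadius g t₀ Γ t)) t :=
    ContinuousAt.comp (hg.hasDerivAt hρ).continuousAt hc
  exact (c1.mul ((continuousAt_const.sub c2).div_const _)).mul
    (continuousAt_const.div (c3.mul (by fun_prop)) (by positivity))

/-- The front radius grows polylogarithmically. -/
theorem exists_frontHeight_bound (hp : 1 < p) (hα : 0 < α₁) (hα₁₂ : α₁ ≤ α₂) (hα₂ : α₂ < p)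
    (hg : IsPowerlike α₁ α₂ g) (hΓ : 0 < Γ) (ht₀ : 1 < t₀) :
    ∃ B, ∀ t, 0 ≤ t → bigJ p g (frontRadius g t₀ Γ t) ≤ B * (t + t₀) := by
  set ρ₀ := frontRadius g t₀ Γ 0 with hρ₀
  have hρ₀p : 0 < ρ₀ := frontRadius_pos hα hg hΓ ht₀ le_rfl
  have hG₀ := hg.bigG_pos hα hρ₀p
  -- Since `ρ` is at most a multiple of `G(ρ)^(1/α₁)`, the quantity `J(ρ)` is at most a multiple of
  -- `G(ρ)^β`, that is, of a power of `log(t + t₀)`. Here `β > 0` because `α₁ < p`.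
  set β := p / α₁ - 1 with hβ
  have hβ0 : 0 < β := by
    rw [hβ, sub_pos, one_lt_div hα]
    linarith
  set c := (Γ / (bigG g ρ₀) * β) ^ β with hc
  refine ⟨ρ₀ ^ p / bigG g ρ₀ * c, fun t ht => ?_⟩
  set ρ := frontRadius g t₀ Γ t with hρ
  have hρp : 0 < ρ := frontRadius_pos hα hg hΓ ht₀ ht
  have hT : 1 < t + t₀ := by linarith
  have hGρ : bigG g ρ = Γ * Real.log (t + t₀) := bigG_frontRadius hα hg hΓ ht₀ ht
  have hG := hg.bigG_pos hα hρp
  have hle : ρ₀ ≤ ρ := by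
    refine ((hg.bigG_isPowerlike hα).le_iff hα hρ₀p.le hρp.le).1 ?_
    rw [hGρ, hρ₀, bigG_frontRadius hα hg hΓ ht₀ le_rfl]
    have : 0 < 0 + t₀ := by linarith
    gcongr
  have h1 : ρ / ρ₀ ≤ (bigG g ρ / bigG g ρ₀) ^ (1 / α₁) := by
    have h2 := (hg.bigG_isPowerlike hα).mul_rpow_le hρ₀p hle
    have h3 : (ρ / ρ₀) ^ α₁ ≤ bigG g ρ / bigG g ρ₀ := by
      rw [le_div_iff₀ hG₀, mul_comm]
      exact h2
    have h4 := Real.rpow_le_rpow (by positivity) h3 (one_div_pos.2 hα).le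
    rwa [← Real.rpow_mul (by positivity), mul_one_div_cancel hα.ne', Real.rpow_one] at h4
  set Y := bigG g ρ / bigG g ρ₀ with hY
  have hY0 : 0 < Y := by positivity
  have h5 : ρ ^ p ≤ ρ₀ ^ p * Y ^ (p / α₁) := by
    have h6 : ρ ≤ ρ₀ * Y ^ (1 / α₁) := by rwa [div_le_iff₀' hρ₀p] at h1
    refine (Real.rpow_le_rpow hρp.le h6 (by linarith)).trans (le_of_eq ?_)
    rw [Real.mul_rpow hρ₀p.le (by positivity), ← Real.rpow_mul hY0.le]
    congr 2
    ring
  have h7 : Y ^ β ≤ c * (t + t₀) := by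
    have hlog := Real.log_le_rpow_div (x := t + t₀) (by linarith) (one_div_pos.2 hβ0)
    have h8 : Y ≤ (Γ / bigG g ρ₀ * β) * (t + t₀) ^ (1 / β) := by
      calc Y = Γ / bigG g ρ₀ * Real.log (t + t₀) := by rw [hY, hGρ]; ring
        _ ≤ Γ / bigG g ρ₀ * ((t + t₀) ^ (1 / β) / (1 / β)) := by gcongr
        _ = _ := by field_simp
    refine (Real.rpow_le_rpow hY0.le h8 hβ0.le).trans (le_of_eq ?_)
    rw [Real.mul_rpow (by positivity) (by positivity), ← Real.rpow_mul (by linarith),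
      one_div_mul_cancel hβ0.ne', Real.rpow_one]
  calc bigJ p g ρ = ρ ^ p / bigG g ρ := rfl
    _ ≤ ρ₀ ^ p * Y ^ (p / α₁) / bigG g ρ := by gcongr
    _ = ρ₀ ^ p / bigG g ρ₀ * Y ^ β := by
        rw [hβ, Real.rpow_sub_one hY0.ne', hY]
        field_simp
    _ ≤ ρ₀ ^ p / bigG g ρ₀ * (c * (t + t₀)) := by gcongr
    _ = _ := by ring

end Front

/-! ### Essential supports. -/

section EssSupport

variable {N : ℕ}

local notation "𝔼" => EuclideanSpace ℝ (Fin N)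

/-- Each point outside the essential support has a neighbourhood where `v` vanishes almost
everywhere, and a locally null set is null. -/
theorem ae_eq_zero_of_essSupport_subset {v : 𝔼 → ℝ} {S : Set 𝔼} (h : essSupport v ⊆ S) :
    ∀ᵐ x, x ∉ S → v x = 0 := by
  have h0 : volume {x : 𝔼 | x ∉ S ∧ v x ≠ 0} = 0 := by
    refine measure_null_of_locally_null _ fun x hx => ?_
    have hx' : x ∉ essSupport v := fun hmem => hx.1 (h hmem)
    simp only [essSupport, mem_ofPred_eq, not_forall, not_frequently] at hx'
    obtain ⟨U, hU, hUv⟩ := hx'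
    refine ⟨U ∩ {x | x ∉ S ∧ v x ≠ 0}, inter_mem (mem_nhdsWithin_of_mem_nhds hU)
      self_mem_nhdsWithin, ?_⟩
    exact measure_mono_null (fun y hy => not_not.2 ⟨hy.1, hy.2.2⟩) (ae_iff.1 hUv)
  rw [ae_iff]
  convert h0 using 3
  push Not
  rfl

theorem essSupport_subset_closedBall {v : 𝔼 → ℝ} {ρ : ℝ} (h : ∀ᵐ x, ρ < ‖x‖ → v x = 0) :
    essSupport v ⊆ Metric.closedBall 0 ρ := by
  intro x hx
  by_contra hcon
  rw [Metric.mem_closedBall, dist_zero_right, not_le] at hcon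
  obtain ⟨y, hy, hy'⟩ := ((hx _ ((isOpen_lt continuous_const continuous_norm).mem_nhds
    hcon)).and_eventually h).exists
  exact hy.2 (hy' hy.1)

end EssSupport

/-! ### Assembly of the barrier and its long-time asymptotics. -/

section Main

variable {N : ℕ} {p m α₁ α₂ : ℝ} {g : ℝ → ℝ}

theorem IsBarrierData.barrier_le_coef {k s C t₀ : ℝ} {a a' h h' : ℝ → ℝ}
    (H : IsBarrierData k s C t₀ a a' h h') {t : ℝ} (ht : 0 ≤ t) (x : EuclideanSpace ℝ (Fin N)) :
    radialBarrier k s C t₀ a h t x ≤ C / (t + t₀) ^ (1 / k) * a t ^ s := by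
  refine mul_le_mul_of_nonneg_left (Real.rpow_le_rpow (le_max_right _ _) ?_ H.s_pos.le)
    (H.coef_pos ht).le
  exact max_le (by linarith [H.profile.nonneg' (norm_nonneg x)]) (H.a_pos ht).le

theorem outerProfile_rpow (hp : 1 < p) (hα : 0 < α₁) (hg : IsPowerlike α₁ α₂ g) {ρ : ℝ}
    (hρ : 0 < ρ) (k : ℝ) :
    outerProfile p g ρ ^ ((p - 1) / k) = bigJ p g ρ ^ (1 / k) := by
  have hJ : 0 ≤ bigJ p g ρ := div_nonneg (Real.rpow_nonneg hρ.le p) (hg.bigG_pos hα hρ).le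
  have hp1 : p - 1 ≠ 0 := by linarith
  rw [outerProfile, ← Real.rpow_mul hJ]
  congr 1
  field_simp

theorem coef_mul_frontHeight {k C t₀ Γ : ℝ} (hp : 1 < p) (hα : 0 < α₁) (hg : IsPowerlike α₁ α₂ g)
    (hΓ : 0 < Γ) (ht₀ : 1 < t₀) {t : ℝ} (ht : 0 ≤ t) :
    C / (t + t₀) ^ (1 / k) * frontHeight p g t₀ Γ t ^ ((p - 1) / k) =
      C * (bigJ p g (frontRadius g t₀ Γ t) / (t + t₀)) ^ (1 / k) := by
  have hρ := frontRadius_pos hα hg hΓ ht₀ ht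
  have hJ : 0 ≤ bigJ p g (frontRadius g t₀ Γ t) :=
    div_nonneg (Real.rpow_nonneg hρ.le p) (hg.bigG_pos hα hρ).le
  rw [frontHeight_eq, outerProfile_rpow hp hα hg hρ, Real.div_rpow hJ (by linarith)]
  ring

theorem isBarrierData {k C t₀ Γ r₀ : ℝ} (hp : 1 < p) (hk : 0 < k) (hα : 0 < α₁) (hα₁₂ : α₁ ≤ α₂)
    (hα₂ : α₂ < p) (hg : IsPowerlike α₁ α₂ g) (hΓ : 0 < Γ) (ht₀ : 1 < t₀) (hC : 0 < C)
    (hr₀ : 0 < r₀) (hfront : r₀ < frontRadius g t₀ Γ 0) :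
    IsBarrierData k ((p - 1) / k) C t₀ (frontHeight p g t₀ Γ) (frontSlope p g t₀ Γ)
      (profile p g r₀) (profileSlope p g r₀) where
  k_pos := hk
  s_pos := div_pos (by linarith) hk
  C_pos := hC
  one_lt := ht₀
  profile := isProfile hp hα hα₂ hg hr₀
  hasDerivAt := fun t ht => hasDerivAt_frontHeight hp hα hg hΓ ht₀ ht
  continuousOn' := continuousOn_frontSlope hp hα hg hΓ ht₀
  pos' := fun t ht => frontSlope_pos hp hα hα₂ hg hΓ ht₀ ht
  front := by
    have h1 := (isProfile hp hα hα₂ hg hr₀).strictMonoOn (a := 0) (b := frontRadius g t₀ Γ 0)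
      (by simp) (hr₀.trans hfront).le (hr₀.trans hfront)
    rwa [profile_of_le hfront.le] at h1
  bdd := by
    obtain ⟨B, hB⟩ := exists_frontHeight_bound hp hα hα₁₂ hα₂ hg hΓ ht₀
    refine ⟨C * B ^ (1 / k), fun t ht => ?_⟩
    rw [coef_mul_frontHeight hp hα hg hΓ ht₀ ht]
    have hρ := frontRadius_pos hα hg hΓ ht₀ ht
    have hJ : 0 ≤ bigJ p g (frontRadius g t₀ Γ t) :=
      div_nonneg (Real.rpow_nonneg hρ.le p) (hg.bigG_pos hα hρ).le
    have hT : 0 < t + t₀ := by linarith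
    have := (div_le_iff₀ hT).2 (hB t ht)
    gcongr

/-- The front is comparable to `g⁻¹(log t)`. -/
theorem frontRadius_lt {Γ : ℝ} (hα : 0 < α₁) (hα₁₂ : α₁ ≤ α₂) (hg : IsPowerlike α₁ α₂ g)
    (hΓ : 0 < Γ) {t : ℝ} (ht : 2 < t) :
    frontRadius g 2 Γ t < (1 + 2 * Γ * α₂) ^ (1 / α₁) * inv g (Real.log t) := by
  have hlog : 0 < Real.log t := Real.log_pos (by linarith)
  have hG := hg.bigG_isPowerlike hα
  have hα₂ := hα.trans_le hα₁₂
  set σ := inv g (Real.log t) with hσ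
  have hσ0 : 0 < σ := hg.inv_pos hα hlog
  have hgσ : g σ = Real.log t := hg.apply_inv hα hlog.le
  have hbase : 1 < 1 + 2 * Γ * α₂ := by
    have : 0 < 2 * Γ * α₂ := by positivity
    linarith
  -- For `σ = g⁻¹(log t)` one has `G(l σ) ≥ l^α₁ G(σ)` and `Γ log(t + 2) ≤ 2 Γ log t ≤ 2 Γ α₂ G(σ)`.
  -- The additional `1` gives `l > 1` and a strict inequality, needed for an open ball.
  set l := (1 + 2 * Γ * α₂) ^ (1 / α₁) with hl
  have hl1 : 1 < l := Real.one_lt_rpow hbase (by positivity)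
  have hlα : l ^ α₁ = 1 + 2 * Γ * α₂ := by
    rw [hl, ← Real.rpow_mul (by linarith), one_div_mul_cancel hα.ne', Real.rpow_one]
  have hρ := frontRadius_pos hα hg hΓ one_lt_two (t := t) (by linarith)
  rw [← hG.lt_iff hα hρ.le (by positivity), bigG_frontRadius hα hg hΓ one_lt_two (by linarith)]
  have hGσ := hg.bigG_pos hα hσ0
  have h1 : Real.log (t + 2) ≤ 2 * Real.log t := by
    rw [← Real.log_rpow (by linarith)]
    refine Real.log_le_log (by linarith) ?_
    rw [Real.rpow_two]
    nlinarith
  have h2 := hG.mul_rpow_le hσ0 (le_mul_of_one_le_left hσ0.le hl1.le)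
  rw [mul_div_cancel_right₀ _ hσ0.ne', hlα] at h2
  have h3 := hg.le_mul_bigG hα hσ0.le
  rw [hgσ] at h3
  calc Γ * Real.log (t + 2) ≤ Γ * (2 * (α₂ * bigG g σ)) := by gcongr; linarith
    _ < bigG g σ * (1 + 2 * Γ * α₂) := by linarith
    _ ≤ _ := h2

theorem bigJ_frontRadius_div_le {Γ : ℝ} (hp : 1 < p) (hα : 0 < α₁) (hα₁₂ : α₁ ≤ α₂)
    (hg : IsPowerlike α₁ α₂ g) (hΓ : 0 < Γ) {t : ℝ} (ht : 2 < t) :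
    bigJ p g (frontRadius g 2 Γ t) / (t + 2) ≤
      ((1 + 2 * Γ * α₂) ^ (1 / α₁)) ^ p / Γ * (inv g (Real.log t) ^ p / (t * Real.log t)) := by
  have hlog : 0 < Real.log t := Real.log_pos (by linarith)
  have hα₂ := hα.trans_le hα₁₂
  have hρ := frontRadius_pos hα hg hΓ one_lt_two (t := t) (by linarith)
  have hσ0 : 0 < inv g (Real.log t) := hg.inv_pos hα hlog
  rw [bigJ, bigG_frontRadius hα hg hΓ one_lt_two (by linarith)]
  have h1 := frontRadius_lt hα hα₁₂ hg hΓ ht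
  have ht0 : 0 < t := by linarith
  have h2 : Real.log t ≤ Real.log (t + 2) := Real.log_le_log ht0 (by linarith)
  calc frontRadius g 2 Γ t ^ p / (Γ * Real.log (t + 2)) / (t + 2)
      ≤ ((1 + 2 * Γ * α₂) ^ (1 / α₁) * inv g (Real.log t)) ^ p / (Γ * Real.log t) / t := by
        gcongr
        linarith
    _ = _ := by
        rw [Real.mul_rpow (by positivity) hσ0.le]
        field_simp

/-- The comparison of the constants that makes the barrier a strong supersolution. -/
theorem isStrongSupersolution_barrier {C t₀ Γ r₀ : ℝ} (hp : 1 < p) (hm : 0 < p + m - 3)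
    (hN : 0 < N) (hα : 0 < α₁) (hα₁₂ : α₁ ≤ α₂) (hα₂ : α₂ < p) (hg : IsPowerlike α₁ α₂ g)
    (hΓ : 0 < Γ) (ht₀ : 1 < t₀) (hC : 0 < C) (hr₀ : 0 < r₀)
    (hfront : r₀ < frontRadius g t₀ Γ 0)
    (hgap : outerProfile p g r₀ +
      2 * ((p - 1) / (p + m - 3)) * profileSlope p g r₀ r₀ * r₀ ≤ frontHeight p g t₀ Γ 0)
    (hK : 2 / (p + m - 3) ≤ ((p - 1) / (p + m - 3)) ^ (p - 1) * C ^ (p + m - 3) *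
      (((p - elasticity g r₀) / (p - 1)) ^ (p - 1) / bigG g r₀))
    (hc₁ : 2 * (α₂ + (p - 1) * α₂ ^ 2 / (p - α₂)) ≤ α₁ * g r₀)
    (hc₂ : 4 * ((p - 1) / (p + m - 3)) * (p / (p - 1)) ≤
      (2 ^ ((p - α₂) / (p - 1)) - 1) * (α₁ * g r₀))
    (hc₃ : 4 / (p + m - 3) ≤ ((p - 1) / (p + m - 3)) ^ (p - 1) * C ^ (p + m - 3) *
      (α₁ * (α₁ * ((p - α₂) / (p - 1)) ^ (p - 1))))
    (hc₄ : ((p - 1) / (p + m - 3)) ^ (p - 1) * C ^ (p + m - 3) *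
      ((p / (p - 1)) ^ p * (2 ^ α₂ * α₂)) ≤ Γ * ((p - α₂) / (p - 1)))
    {η : ℝ × EuclideanSpace ℝ (Fin N) → ℝ} (hη : IsTest η) (hη0 : ∀ z, 0 ≤ η z) :
    0 ≤ weakForm p m g (radialBarrier (p + m - 3) ((p - 1) / (p + m - 3)) C t₀
      (frontHeight p g t₀ Γ) (profile p g r₀))
      (barrierGrad (p + m - 3) ((p - 1) / (p + m - 3)) C t₀ (gradExponent p m)
        (frontHeight p g t₀ Γ) (profile p g r₀) (profileSlope p g r₀)) η := by
  have H := isBarrierData (k := p + m - 3) hp hm hα hα₁₂ hα₂ hg hΓ ht₀ hC hr₀ hfront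
  have hs := H.s_pos
  refine H.weakForm_nonneg hp hm hN hg.continuousOn (fun r hr => hg.hasDerivAt hr)
    (fun r hr => hasDerivWithinAt_slope hp hα hα₂ hg hr₀ hr) (fun t ht r hr hrt => ?_) hη hη0
  have hΛ : 0 ≤ ((p - 1) / (p + m - 3)) ^ (p - 1) * C ^ (p + m - 3) := by positivity
  have hn : (1 : ℝ) ≤ N := by exact_mod_cast hN
  have hT : 0 < t + t₀ := by linarith
  have hτ := le_mul_frontSlope (p := p) hp hα hg hΓ ht₀ ht.le
  have ha' := frontSlope_pos hp hα hα₂ hg hΓ ht₀ ht.le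
  have hρ := frontRadius_pos hα hg hΓ ht₀ ht.le
  rw [mul_assoc _ (t + t₀)]
  rcases lt_or_ge r r₀ with hrr | hrr
  · refine barrier_inequality_inner hp hα hα₂ hg hr₀ hn hs hΛ (by positivity) hK ?_
      (sub_pos.2 hrt).le hr hrr
    have h1 : frontHeight p g t₀ Γ 0 ≤ frontHeight p g t₀ Γ t :=
      H.strictMonoOn.monotoneOn (by simp) ht.le ht.le
    have h2 : profile p g r₀ r ≤ profile p g r₀ r₀ :=
      H.profile.strictMonoOn.monotoneOn hr.le hr₀.le hrr.le
    rw [profile_of_le le_rfl] at h2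
    linarith
  · rw [profile_of_le hrr] at hrt ⊢
    exact barrier_inequality_outer hp hα hα₁₂ hα₂ hg hr₀ hn hs hm hΛ hΓ.le hτ hc₁ hc₂ hc₃ hc₄
      hrr hrt hρ

end Main

end DNL

end

/-! ### Choice of the constants and conclusion. -/

theorem theorem1p3 (N : ℕ) (p m α₁ α₂ : ℝ) (g : ℝ → ℝ)
    (hp : 1 < p) (hpN : p < N) (hm : 0 < p + m - 3)
    (hα₁ : 0 < α₁) (hα₁₂ : α₁ ≤ α₂) (hα₂ : α₂ < p)
    (hg : DNL.IsPowerlike α₁ α₂ g) (M L : ℝ) :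
    ∃ t₀ C r₀ Γ ν₀ γ : ℝ,
      1 < t₀ ∧ 0 < C ∧ 0 < r₀ ∧ 0 < Γ ∧ 0 < ν₀ ∧ ν₀ < 1 ∧ 0 < γ ∧
      ν₀ = 1 - r₀ * deriv (DNL.bigG g) r₀ / (p * DNL.bigG g r₀) ∧
      DNL.IsStrongSupersolution N p m g (DNL.barrier p m g t₀ C r₀ Γ ν₀) ∧
      ∀ (u₀ : EuclideanSpace ℝ (Fin N) → ℝ) (u : ℝ → EuclideanSpace ℝ (Fin N) → ℝ),
        (∀ᵐ x, 0 ≤ u₀ x ∧ u₀ x ≤ M) →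
        DNL.essSupport u₀ ⊆ Metric.closedBall 0 L →
        DNL.IsStrongCauchySolution N p m g u₀ u →
        (∀ t, 0 < t → ∀ᵐ x, u t x ≤ DNL.barrier p m g t₀ C r₀ Γ ν₀ t x) ∧
        (∀ t, t₀ < t →
          DNL.essSupport (u t) ⊆ Metric.ball 0 (γ * DNL.inv g (Real.log t))) ∧
        (∀ t, t₀ < t → ∀ᵐ x,
          u t x ≤ γ * (DNL.inv g (Real.log t) ^ p / (t * Real.log t)) ^ (1 / (p + m - 3))) := by
  open DNL in
  have hp1 : 0 < p - 1 := by linarith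
  have hα₂0 := hα₁.trans_le hα₁₂
  have hN : 0 < N := by
    have : (0 : ℝ) < N := by linarith
    exact_mod_cast this
  set k := p + m - 3 with hk
  set s := (p - 1) / k with hs
  have hs0 : 0 < s := div_pos hp1 hm
  have he₀ : 0 < (p - α₂) / (p - 1) := div_pos (by linarith) hp1
  have hδ : 0 < (2 : ℝ) ^ ((p - α₂) / (p - 1)) - 1 := sub_pos.2 (Real.one_lt_rpow one_lt_two he₀)
  have hlog2 : 0 < Real.log 2 := Real.log_pos one_lt_two
  -- the radius
  have hgt := (hg.tendsto_atTop hα₁).const_mul_atTop hα₁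
  -- With `t₀ = 2` fixed, the constants are chosen in the order `r₀`, `C`, `Γ`: each condition holds
  -- for large values of the new constant, given the earlier ones.
  obtain ⟨r₀, ⟨hc₁, hc₂⟩, hr₀⟩ := (((hgt.eventually_ge_atTop
    (2 * (α₂ + (p - 1) * α₂ ^ 2 / (p - α₂)))).and ((hgt.const_mul_atTop hδ).eventually_ge_atTop
      (4 * s * (p / (p - 1))))).and (eventually_gt_atTop 0)).exists
  have hG₀ := hg.bigG_pos hα₁ hr₀
  have hθ := elasticity_mem hα₁ hg hr₀
  have hK₀ : 0 < ((p - elasticity g r₀) / (p - 1)) ^ (p - 1) / bigG g r₀ :=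
    div_pos (Real.rpow_pos_of_pos (div_pos (by linarith [hθ.2]) hp1) _) hG₀
  -- the amplitude
  have hCt : Tendsto (fun C : ℝ => s ^ (p - 1) * C ^ k) atTop atTop :=
    (tendsto_rpow_atTop hm).const_mul_atTop (Real.rpow_pos_of_pos hs0 _)
  -- The factor `2 ^ (1 / k)` in the condition on `M` offsets the amplitude factor `(0 + t₀)^(-1/k)`
  -- at time zero.
  obtain ⟨C, ⟨⟨hK, hc₃⟩, hCM⟩, hC⟩ := ((((hCt.atTop_mul_const hK₀).eventually_ge_atTop
    (2 / k)).and ((hCt.atTop_mul_const (show 0 < α₁ * (α₁ * ((p - α₂) / (p - 1)) ^ (p - 1)) by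
      positivity)).eventually_ge_atTop (4 / k))).and
      (eventually_ge_atTop (M * 2 ^ (1 / k)))).and (eventually_gt_atTop 0) |>.exists
  -- the speed
  obtain ⟨ρ₀, hρ₀, hρ₀r⟩ := (((tendsto_outerProfile hp hα₁ hα₂ hg).eventually_ge_atTop
    (outerProfile p g (max L r₀) + 1 + 2 * s * profileSlope p g r₀ r₀ * r₀)).and
    (eventually_gt_atTop r₀)).exists
  -- The condition `Γ log 2 ≥ G(ρ₀)` places the front beyond `ρ₀` from the start. By the choice of
  -- `ρ₀` the gap is then at least `1` on the ball of radius `L`, so the barrier is above `M` there,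
  -- and it is large enough inside `r₀` for the inner inequality.
  obtain ⟨Γ, ⟨hc₄, hΓρ⟩, hΓ⟩ := ((((tendsto_id (α := ℝ)).atTop_mul_const he₀).eventually_ge_atTop
    (s ^ (p - 1) * C ^ k * ((p / (p - 1)) ^ p * (2 ^ α₂ * α₂)))).and
    (((tendsto_id (α := ℝ)).atTop_mul_const hlog2).eventually_ge_atTop (bigG g ρ₀))).and
    (eventually_gt_atTop 0) |>.exists
  simp only [id] at hc₄ hΓρ
  have hρ₀0 : 0 < ρ₀ := hr₀.trans hρ₀r
  have hrad : ∀ t, 0 ≤ t → ρ₀ ≤ frontRadius g 2 Γ t := by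
    intro t ht
    rw [← (hg.bigG_isPowerlike hα₁).le_iff hα₁ hρ₀0.le
      (frontRadius_pos hα₁ hg hΓ one_lt_two ht).le, bigG_frontRadius hα₁ hg hΓ one_lt_two ht]
    refine hΓρ.trans (mul_le_mul_of_nonneg_left (Real.log_le_log two_pos (by linarith)) hΓ.le)
  have hfront : r₀ < frontRadius g 2 Γ 0 := hρ₀r.trans_le (hrad 0 le_rfl)
  have H := isBarrierData (k := k) hp hm hα₁ hα₁₂ hα₂ hg hΓ one_lt_two hC hr₀ hfront
  have hheight : outerProfile p g (max L r₀) + 1 + 2 * s * profileSlope p g r₀ r₀ * r₀ ≤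
      frontHeight p g 2 Γ 0 :=
    hρ₀.trans (outerProfile_le hp hα₁ hα₂ hg hρ₀0 (hrad 0 le_rfl))
  have hgap : outerProfile p g r₀ + 2 * s * profileSlope p g r₀ r₀ * r₀ ≤ frontHeight p g 2 Γ 0 := by
    linarith [outerProfile_le hp hα₁ hα₂ hg hr₀ (le_max_right L r₀)]
  have hsuper : ∀ η : ℝ × EuclideanSpace ℝ (Fin N) → ℝ, IsTest η → (∀ z, 0 ≤ η z) → 0 ≤ weakForm
      p m g (radialBarrier k s C 2 (frontHeight p g 2 Γ) (profile p g r₀)) (barrierGrad k s C 2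
        (gradExponent p m) (frontHeight p g 2 Γ) (profile p g r₀) (profileSlope p g r₀)) η :=
    fun η hη hη0 => isStrongSupersolution_barrier hp hm hN hα₁ hα₁₂ hα₂ hg hΓ one_lt_two hC hr₀
      hfront hgap hK hc₁ hc₂ hc₃ hc₄ hη hη0
  have hσ := IsBarrierData.one_lt_mul_gradExponent hp hm
  have hclass := H.isInClass (N := N) hg.continuousOn hσ
  set l := (1 + 2 * Γ * α₂) ^ (1 / α₁) with hl
  have hl0 : 0 < l := by positivity
  have hCl : 0 ≤ C * (l ^ p / Γ) ^ (1 / k) := by positivity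
  have hp0 : 0 < p := by linarith
  -- `γ` is a sum so as to dominate both the support constant `l` and the amplitude constant. For
  -- these parameters `barrier` unfolds definitionally to `radialBarrier` with `frontHeight` and
  -- `profile`.
  refine ⟨2, C, r₀, Γ, 1 - elasticity g r₀ / p, l + C * (l ^ p / Γ) ^ (1 / k), one_lt_two, hC, hr₀,
    hΓ, ?_, ?_, by positivity, ?_, ⟨⟨_, hclass, hsuper⟩, H.hasStrongTimeDeriv hg.continuousOn hN⟩,
    fun u₀ u hu₀ hsupp hu => ?_⟩
  · rw [sub_pos, div_lt_one hp0]
    linarith [hθ.2]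
  · have : 0 < elasticity g r₀ / p := div_pos (hα₁.trans_le hθ.1) hp0
    linarith
  · rw [hg.deriv_bigG hα₁ hr₀, elasticity, mul_div_cancel₀ _ hr₀.ne', div_div, mul_comm p]
  obtain ⟨⟨⟨V, hV, heq⟩, v, hv, -⟩, hinit⟩ := hu
  have hcomp : ∀ t, 0 < t → ∀ᵐ x, u t x ≤
      radialBarrier k s C 2 (frontHeight p g 2 Γ) (profile p g r₀) t x := by
    intro t ht
    refine comparison hp hm hg.continuousOn hV hv heq hclass (H.hasWeakTimeDeriv hN) hsuper
      (fun b => ?_) ?_ ht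
    · obtain ⟨R, -, hR⟩ := H.exists_radius b
      exact ⟨R, fun z hz hzb hzR => IsBarrierData.grad_eq_zero hσ (hR z.1 hz.le hzb _ hzR)⟩
    · filter_upwards [hinit, hu₀, ae_eq_zero_of_essSupport_subset hsupp] with x hx1 hx2 hx3
      rw [hx1]
      by_cases hxL : x ∈ Metric.closedBall 0 L
      · rw [Metric.mem_closedBall, dist_zero_right] at hxL
        have h1 : profile p g r₀ ‖x‖ ≤ outerProfile p g (max L r₀) := by
          rw [← profile_of_le (p := p) (g := g) (le_max_right L r₀)]
          exact H.profile.strictMonoOn.monotoneOn (norm_nonneg x) (hr₀.le.trans (le_max_right _ _))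
            (hxL.trans (le_max_left _ _))
        have h2 : 0 ≤ 2 * s * profileSlope p g r₀ r₀ * r₀ := by
          have := H.profile.pos r₀ hr₀
          positivity
        have h3 : 1 ≤ max (frontHeight p g 2 Γ 0 - profile p g r₀ ‖x‖) 0 :=
          le_max_of_le_left (by linarith)
        have h4 : M ≤ C / (0 + 2) ^ (1 / k) := by
          rw [zero_add, le_div_iff₀ (by positivity)]
          exact hCM
        exact (hx2.2.trans h4).trans (le_mul_of_one_le_right (H.coef_pos le_rfl).le
          (Real.one_le_rpow h3 hs0.le))
      · rw [hx3 hxL]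
        exact H.barrier_nonneg le_rfl x
  refine ⟨hcomp, fun t ht => ?_, fun t ht => ?_⟩
  · have ht0 : 0 < t := by linarith
    have hlt := frontRadius_lt hα₁ hα₁₂ hg hΓ ht
    have hσ0 : 0 < DNL.inv g (Real.log t) := hg.inv_pos hα₁ (Real.log_pos (by linarith))
    refine (essSupport_subset_closedBall (ρ := frontRadius g 2 Γ t) ?_).trans
      (Metric.closedBall_subset_ball (hlt.trans_le ?_))
    · filter_upwards [hcomp t ht0, hV.nonneg t ht0.le] with x hx1 hx2 hx3
      have hρ := hρ₀0.trans_le (hrad t ht0.le)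
      have h1 : frontHeight p g 2 Γ t ≤ profile p g r₀ ‖x‖ := by
        rw [frontHeight_eq, ← profile_of_le (hρ₀r.le.trans (hrad t ht0.le))]
        exact H.profile.strictMonoOn.monotoneOn hρ.le (norm_nonneg x) hx3.le
      rw [H.barrier_eq_zero h1] at hx1
      exact le_antisymm hx1 hx2
    · exact mul_le_mul_of_nonneg_right (by linarith) hσ0.le
  · have ht0 : 0 < t := by linarith
    have hlog : 0 < Real.log t := Real.log_pos (by linarith)
    have hσ0 : 0 < DNL.inv g (Real.log t) := hg.inv_pos hα₁ hlog
    filter_upwards [hcomp t ht0] with x hx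
    refine (hx.trans (H.barrier_le_coef ht0.le x)).trans ?_
    rw [coef_mul_frontHeight hp hα₁ hg hΓ one_lt_two ht0.le]
    have h1 := bigJ_frontRadius_div_le hp hα₁ hα₁₂ hg hΓ ht
    have hρ := hρ₀0.trans_le (hrad t ht0.le)
    have hJ : 0 ≤ bigJ p g (frontRadius g 2 Γ t) / (t + 2) :=
      div_nonneg (div_nonneg (Real.rpow_nonneg hρ.le p) (hg.bigG_pos hα₁ hρ).le) (by linarith)
    set W := DNL.inv g (Real.log t) ^ p / (t * Real.log t)
    have hW : 0 ≤ W := by positivity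
    calc C * (bigJ p g (frontRadius g 2 Γ t) / (t + 2)) ^ (1 / k)
        ≤ C * (l ^ p / Γ * W) ^ (1 / k) := by gcongr
      _ = C * (l ^ p / Γ) ^ (1 / k) * W ^ (1 / k) := by
          rw [Real.mul_rpow (by positivity) hW]
          ring
      _ ≤ _ := mul_le_mul_of_nonneg_right (by linarith) (by positivity)
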